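/- Let $X$ and $Y$ be manifolds ($C^\infty$, real analytic or complex), with structure sheaves $\mathcal{O}$ of real or complex valued functions of the respective class, and let $f\colon Y\to X$ be a map of manifolds. A *Courant algebroid* on $X$ is a sheaf of $\mathcal{O}_X$-modules $\mathcal{Q}$ with a bilinear (over the constants) bracket satisfying the Leibniz identity $[q,[p,r]]=[[q,p],r]+[p,[q,r]]$, an $\mathcal{O}_X$-linear anchor $\pi\colon\mathcal{Q}\to\mathcal{T}_X$ compatible with brackets, a symmetric $\mathcal{O}_X$-bilinear (possibly degenerate) pairing $\langle\ ,\ \rangle$ with values in $\mathcal{O}_X$ and an $\mathcal{O}_X$-linear co-anchor $\pi^\dagger\colon\Omega^1_X\to\mathcal{Q}$, such that $$\pi\circ\pi^\dagger=0,\qquad [q,\varphi p]=\varphi[q,p]+\pi(q)(\varphi)p,\qquad \langle[q,p],r\rangle+\langle p,[q,r]\rangle=\pi(q)\langle p,r\rangle,$$ $$[q,\pi^\dagger(\alpha)]=\pi^\dagger(L_{\pi(q)}\alpha),\qquad \langle q,\pi^\dagger(\alpha)\rangle=\iota_{\pi(q)}\alpha,\qquad [q,p]+[p,q]=\pi^\dagger(d\langle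 q,p\rangle).$$ It is *exact* if $0\to\Omega^1_X\xrightarrow{\pi^\dagger}\mathcal{Q}\xrightarrow{\pi}\mathcal{T}_X\to0$ is exact. A *connection* on $\mathcal{Q}|_U$, for $U\subseteq X$ open, is an $\mathcal{O}_U$-linear map $\nabla\colon\mathcal{T}_U\to\mathcal{Q}|_U$ with $\pi\circ\nabla=\mathrm{id}$ and $\langle\nabla\xi,\nabla\eta\rangle=0$ for all $\xi,\eta$. If $\mathcal{Q}$ is exact, its *curvature* $c(\nabla)$ is the $3$-form on $U$ with $[\nabla\xi,\nabla\eta]-\nabla[\xi,\eta]=\pi^\dagger\big(c(\nabla)(\xi,\eta,\cdot)\big)$ for all local vector fields $\xi,\eta$. Let $\mathcal{Q}$ be a Courant algebroid on $X$, and let $$f^{++}\mathcal{Q}=\big(\Omega^1_Y\oplus f^*\mathcal{Q}\times_{f^*\mathcal{T}_X}\mathcal{T}_Y\big)\big/f^*\Omega^1_X,$$ the quotient by the image of $\gamma\mapsto(df^\vee(\gamma),-f^*(\pi^\dagger)(\gamma),0)$. (1) The formulas $$\big[(\alpha,h\otimes q,\xi),(\beta,g\otimes p,\eta)\big]=\big(-\iota_\eta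 d\alpha+L_\xi\beta+g\,f^*\langle q,p\rangle\,dh,\ hg\otimes[q,p]-\eta(h)\otimes q+\xi(g)\otimes p,\ [\xi,\eta]\big),$$ $$\big\langle(\alpha,h\otimes q,\xi),(\beta,g\otimes p,\eta)\big\rangle=hg\,f^*\langle q,p\rangle+\iota_\xi\beta+\iota_\eta\alpha$$ (extended additively in the terms $h\otimes q$, $g\otimes p$), the anchor $(\alpha,s,\xi)\mapsto\xi$ and the co-anchor $\alpha\mapsto(\alpha,0,0)$ are well defined on $f^{++}\mathcal{Q}$ and make it a Courant algebroid on $Y$. It is exact if $\mathcal{Q}$ is. (2) Let $U\subseteq X$ be open and let $\nabla$ be a connection on $\mathcal{Q}|_U$. Then $$f^{++}(\nabla)\colon\mathcal{T}_{f^{-1}(U)}\to f^{++}\mathcal{Q}|_{f^{-1}(U)},\qquad f^{++}(\nabla)(\xi)=\text{class of }\big(0,f^*(\nabla)(df(\xi)),\xi\big),$$ is a connection on $f^{++}\mathcal{Q}|_{f^{-1}(U)}$, i.e. an isotropic splitting of the anchor. (3) Suppose moreover that $\mathcal{Q}$ is exact. Then the curvatures $c(\nabla)$ and $c(f^{++}(\nabla))$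 exist, are unique and are closed $3$-forms on $U$ and on $f^{-1}(U)$, and $$c\big(f^{++}(\nabla)\big)=f^*c(\nabla).$$ -/

import Mathlib

open scoped Manifold ContDiff TensorProduct
open TopologicalSpace

universe u v w w₁ w₂ w₃

set_option linter.checkUnivs false
set_option linter.unusedVariables false

/-- A (boundaryless, finite-dimensional) manifold of class `n` over `𝕜`, with structure sheaf the
sheaf of `K`-valued functions of class `n`. Here `n` is `∞` or `ω`. The cases
`(𝕜, K, n) = (ℝ, ℝ, ∞), (ℝ, ℂ, ∞)` are the `C^∞` manifolds with real or complex valued functions,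
`(ℝ, ℝ, ω), (ℝ, ℂ, ω)` the real analytic ones, and `(ℂ, ℂ, ω)` are the complex manifolds. -/
structure Mfd (𝕜 K : Type) [RCLike 𝕜] [RCLike K] [NormedAlgebra 𝕜 K] (n : WithTop ℕ∞)
    [Fact (n = ∞ ∨ n = ω)] where
  carrier : Type u
  E : Type v
  [normed : NormedAddCommGroup E]
  [space : NormedSpace 𝕜 E]
  [findim : FiniteDimensional 𝕜 E]
  [top : TopologicalSpace carrier]
  [charted : ChartedSpace E carrier]
  [mfd : IsManifold 𝓘(𝕜, E) n carrier]

namespace Mfd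

attribute [instance] normed space findim top charted mfd

variable {𝕜 K : Type} [RCLike 𝕜] [RCLike K] [NormedAlgebra 𝕜 K] {n : WithTop ℕ∞}
  [Fact (n = ∞ ∨ n = ω)]

instance : CoeSort (Mfd.{u, v} 𝕜 K n) (Type u) := ⟨carrier⟩

variable (X : Mfd.{u, v} 𝕜 K n)

/-- The `K`-algebra of `K`-valued functions of class `n` on the open set `U`. -/
def functions (U : Opens X) : Subalgebra K (U → K) where
  carrier := {φ | ContMDiff 𝓘(𝕜, X.E) 𝓘(𝕜, K) n φ}
  mul_mem' {a b} ha hb := by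
    have : ContDiff 𝕜 n (fun p : K × K => p.1 * p.2) := contDiff_mul
    exact this.contMDiff.comp (ha.prodMk_space hb)
  add_mem' {a b} ha hb := by
    have : ContDiff 𝕜 n (fun p : K × K => p.1 + p.2) := contDiff_add
    exact this.contMDiff.comp (ha.prodMk_space hb)
  algebraMap_mem' c := contMDiff_const

/-- Sections of the structure sheaf over `U`. -/
abbrev O (U : Opens X) : Type u := X.functions U

/-- Restriction of functions. -/
def resO {U V : Opens X} (h : V ≤ U) : X.O U →ₐ[K] X.O V where
  toFun φ := ⟨fun x => φ.1 ⟨x.1, h x.2⟩, ContMDiff.comp φ.2 (contMDiff_inclusion h)⟩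
  map_one' := rfl
  map_mul' _ _ := rfl
  map_zero' := rfl
  map_add' _ _ := rfl
  commutes' _ := rfl

@[simp] theorem resO_apply {U V : Opens X} (h : V ≤ U) (φ : X.O U) (x : V) :
    (X.resO h φ).1 x = φ.1 ⟨x.1, h x.2⟩ := rfl

theorem O_ext {U : Opens X} {φ ψ : X.O U} (h : ∀ x : U, φ.1 x = ψ.1 x) : φ = ψ :=
  Subtype.ext (funext h)

end Mfd

section Main

variable {𝕜 K : Type} [RCLike 𝕜] [RCLike K] [NormedAlgebra 𝕜 K] {n : WithTop ℕ∞}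
  [Fact (n = ∞ ∨ n = ω)]

/-- A presheaf of `𝒪_X`-modules on the manifold `X`. -/
structure PMod (X : Mfd.{u, v} 𝕜 K n) where
  Sec : Opens X → Type w
  [grp : ∀ U, AddCommGroup (Sec U)]
  [mod : ∀ U, Module (X.O U) (Sec U)]
  res : ∀ {U V : Opens X}, V ≤ U → Sec U →+ Sec V
  res_self : ∀ {U : Opens X} (s : Sec U), res le_rfl s = s
  res_res : ∀ {U V W : Opens X} (h : V ≤ U) (h' : W ≤ V) (s : Sec U),
    res h' (res h s) = res (h'.trans h) s
  res_smul : ∀ {U V : Opens X} (h : V ≤ U) (φ : X.O U) (s : Sec U),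
    res h (φ • s) = X.resO h φ • res h s

namespace PMod

attribute [instance] grp mod

variable {X : Mfd.{u, v} 𝕜 K n}

/-- The structure sheaf as a module over itself. -/
abbrev unit (X : Mfd.{u, v} 𝕜 K n) : PMod.{u, v, u} X where
  Sec := X.O
  res h := (X.resO h : _ →+ _)
  res_self _ := rfl
  res_res _ _ _ := rfl
  res_smul _ _ _ := rfl

variable (P : PMod.{u, v, w} X)

/-- Two sections near `x` are identified when they agree on a neighbourhood of `x`. -/
@[reducible]
def germSetoid (x : X) : Setoid (Σ U : {U : Opens X // x ∈ U}, P.Sec U.1) where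
  r a b := ∃ (W : Opens X) (_ : x ∈ W) (h : W ≤ a.1.1) (h' : W ≤ b.1.1),
    P.res h a.2 = P.res h' b.2
  iseqv := ⟨fun a => ⟨_, a.1.2, le_rfl, le_rfl, rfl⟩,
    fun ⟨W, hW, h, h', e⟩ => ⟨W, hW, h', h, e.symm⟩,
    fun ⟨W, hW, h, h', e⟩ ⟨W', hW', k, k', e'⟩ =>
      ⟨W ⊓ W', ⟨hW, hW'⟩, inf_le_left.trans h, inf_le_right.trans k', by
        rw [← P.res_res h inf_le_left, e, P.res_res, ← P.res_res k' inf_le_right, ← e',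
          P.res_res]⟩⟩

/-- The stalk of `P` at `x`. -/
def Germ (x : X) : Type _ := Quotient (P.germSetoid x)

variable {P}

/-- The germ at `x` of a section. -/
def gm {U : Opens X} (x : X) (hx : x ∈ U) (s : P.Sec U) : P.Germ x :=
  Quotient.mk (P.germSetoid x) ⟨⟨U, hx⟩, s⟩

theorem gm_eq_iff {U V : Opens X} {x : X} {hU : x ∈ U} {hV : x ∈ V} {s : P.Sec U}
    {t : P.Sec V} : gm x hU s = gm x hV t ↔
      ∃ (W : Opens X) (_ : x ∈ W) (h : W ≤ U) (h' : W ≤ V), P.res h s = P.res h' t :=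
  ⟨fun h => Quotient.exact h, fun h => Quotient.sound h⟩

theorem gm_res {U V : Opens X} (x : X) (h : V ≤ U) (hx : x ∈ V) (s : P.Sec U) :
    gm x hx (P.res h s) = gm x (h hx) s :=
  gm_eq_iff.2 ⟨V, hx, le_rfl, h, P.res_self _⟩

theorem gm_surj {x : X} (g : P.Germ x) :
    ∃ (U : Opens X) (hx : x ∈ U) (s : P.Sec U), g = gm x hx s := by
  induction g using Quotient.inductionOn with
  | h a => exact ⟨a.1.1, a.1.2, a.2, rfl⟩

/-- Extend a compatible family of maps on sections to the stalk. -/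
def lift {x : X} {C : Sort*} (F : ∀ U : Opens X, x ∈ U → P.Sec U → C)
    (hF : ∀ (U V : Opens X) (h : V ≤ U) (hx : x ∈ V) (s : P.Sec U),
      F V hx (P.res h s) = F U (h hx) s) (g : P.Germ x) : C :=
  Quotient.lift (fun a : Σ U : {U : Opens X // x ∈ U}, P.Sec U.1 => F a.1.1 a.1.2 a.2)
    (by
      rintro ⟨⟨U, hU⟩, s⟩ ⟨⟨V, hV⟩, t⟩ ⟨W, hW, h, h', e⟩
      simp only at e ⊢
      rw [← hF U W h hW, ← hF V W h' hW, e]) g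

@[simp] theorem lift_gm {x : X} {C : Sort*} (F : ∀ U : Opens X, x ∈ U → P.Sec U → C) (hF)
    {U : Opens X} (hx : x ∈ U) (s : P.Sec U) : lift F hF (gm x hx s) = F U hx s := rfl

section ops
variable {P₁ : PMod.{u, v, w₁} X} {P₂ : PMod.{u, v, w₂} X} {P₃ : PMod.{u, v, w₃} X}

/-- A local operation, i.e. a family of maps compatible with restrictions, acts on germs. -/
def map (F : ∀ U : Opens X, P₁.Sec U → P₂.Sec U)
    (hF : ∀ (U V : Opens X) (h : V ≤ U) (s : P₁.Sec U), F V (P₁.res h s) = P₂.res h (F U s))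
    {x : X} (g : P₁.Germ x) : P₂.Germ x :=
  lift (fun U hx s => gm x hx (F U s))
    (fun U V h hx s => by rw [hF, gm_res]) g

theorem map_gm (F : ∀ U : Opens X, P₁.Sec U → P₂.Sec U) (hF)
    {U : Opens X} {x : X} (hx : x ∈ U) (s : P₁.Sec U) :
    map F hF (gm x hx s) = gm x hx (F U s) := rfl

/-- A local binary operation acts on germs. -/
def map₂ (F : ∀ U : Opens X, P₁.Sec U → P₂.Sec U → P₃.Sec U)
    (hF : ∀ (U V : Opens X) (h : V ≤ U) (s : P₁.Sec U) (t : P₂.Sec U),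
      F V (P₁.res h s) (P₂.res h t) = P₃.res h (F U s t))
    {x : X} (g : P₁.Germ x) (g' : P₂.Germ x) : P₃.Germ x :=
  lift (fun U hU s => lift (fun V hV t =>
      gm x (U := U ⊓ V) ⟨hU, hV⟩ (F _ (P₁.res inf_le_left s) (P₂.res inf_le_right t)))
      (fun V V' h hV t => by
        rw [← gm_res x (inf_le_inf_left U h) (show x ∈ U ⊓ V' from ⟨hU, hV⟩), ← hF,
          P₁.res_res, P₂.res_res, P₂.res_res]) g')
    (fun U U' h hU s => by
      obtain ⟨V, hV, t, rfl⟩ := gm_surj g'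
      rw [lift_gm, lift_gm, ← gm_res x (inf_le_inf_right V h)
        (show x ∈ U' ⊓ V from ⟨hU, hV⟩), ← hF, P₁.res_res, P₁.res_res, P₂.res_res]) g

theorem map₂_gm (F : ∀ U : Opens X, P₁.Sec U → P₂.Sec U → P₃.Sec U) (hF)
    {U : Opens X} {x : X} (hx : x ∈ U) (s : P₁.Sec U) (t : P₂.Sec U) :
    map₂ F hF (gm x hx s) (gm x hx t) = gm x hx (F U s t) := by
  change gm x _ (F _ (P₁.res _ s) (P₂.res _ t)) = _
  rw [hF]
  exact gm_res x inf_le_left _ _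

theorem gm_surj₂ {x : X} (a : P₁.Germ x) (b : P₂.Germ x) :
    ∃ (U : Opens X) (hx : x ∈ U) (s : P₁.Sec U) (t : P₂.Sec U), a = gm x hx s ∧ b = gm x hx t := by
  obtain ⟨U, hU, s, rfl⟩ := gm_surj a
  obtain ⟨V, hV, t, rfl⟩ := gm_surj b
  exact ⟨U ⊓ V, ⟨hU, hV⟩, P₁.res inf_le_left s, P₂.res inf_le_right t,
    (gm_res x inf_le_left (show x ∈ U ⊓ V from ⟨hU, hV⟩) s).symm,
    (gm_res x inf_le_right (show x ∈ U ⊓ V from ⟨hU, hV⟩) t).symm⟩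

theorem gm_surj₃ {x : X} (a : P₁.Germ x) (b : P₂.Germ x) (c : P₃.Germ x) :
    ∃ (U : Opens X) (hx : x ∈ U) (s : P₁.Sec U) (t : P₂.Sec U) (r : P₃.Sec U),
      a = gm x hx s ∧ b = gm x hx t ∧ c = gm x hx r := by
  obtain ⟨U, hU, s, t, rfl, rfl⟩ := gm_surj₂ a b
  obtain ⟨V, hV, r, rfl⟩ := gm_surj c
  exact ⟨U ⊓ V, ⟨hU, hV⟩, P₁.res inf_le_left s, P₂.res inf_le_left t, P₃.res inf_le_right r,
    (gm_res x inf_le_left (show x ∈ U ⊓ V from ⟨hU, hV⟩) s).symm,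
    (gm_res x inf_le_left (show x ∈ U ⊓ V from ⟨hU, hV⟩) t).symm,
    (gm_res x inf_le_right (show x ∈ U ⊓ V from ⟨hU, hV⟩) r).symm⟩

end ops

instance (x : X) : Add (P.Germ x) :=
  ⟨map₂ (fun _ s t => s + t) (fun _ _ _ _ _ => ((P.res _).map_add _ _).symm)⟩

instance (x : X) : Neg (P.Germ x) :=
  ⟨map (fun _ s => -s) (fun _ _ _ _ => ((P.res _).map_neg _).symm)⟩

instance (x : X) : Zero (P.Germ x) := ⟨gm (U := ⊤) x trivial 0⟩

theorem gm_add {U : Opens X} {x : X} (hx : x ∈ U) (s t : P.Sec U) :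
    gm x hx (s + t) = gm x hx s + gm x hx t :=
  (map₂_gm (P₁ := P) (P₂ := P) (P₃ := P) (fun _ s t => s + t) _ hx s t).symm

theorem gm_neg {U : Opens X} {x : X} (hx : x ∈ U) (s : P.Sec U) :
    gm x hx (-s) = -gm x hx s := rfl

theorem gm_zero {U : Opens X} {x : X} (hx : x ∈ U) : gm x hx (0 : P.Sec U) = 0 := by
  rw [← (P.res (le_top : U ≤ ⊤)).map_zero, gm_res]; rfl

instance (x : X) : AddCommGroup (P.Germ x) where
  add_assoc a b c := by
    obtain ⟨U, hU, r, s, t, rfl, rfl, rfl⟩ := gm_surj₃ a b c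
    simp only [← gm_add, add_assoc]
  zero_add a := by
    obtain ⟨U, hU, r, rfl⟩ := gm_surj a
    rw [← gm_zero hU, ← gm_add, zero_add]
  add_zero a := by
    obtain ⟨U, hU, r, rfl⟩ := gm_surj a
    rw [← gm_zero hU, ← gm_add, add_zero]
  neg_add_cancel a := by
    obtain ⟨U, hU, r, rfl⟩ := gm_surj a
    rw [← gm_neg, ← gm_add, neg_add_cancel, gm_zero]
  add_comm a b := by
    obtain ⟨U, hU, r, s, rfl, rfl⟩ := gm_surj₂ a b
    simp only [← gm_add, add_comm]
  nsmul := nsmulRec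
  zsmul := zsmulRec

end PMod

namespace Mfd

variable (X : Mfd.{u, v} 𝕜 K n)

/-- The ring of germs of functions at `x`. -/
def OGerm (x : X) : Type u := (PMod.unit X).Germ x

variable {X}

open PMod

/-- The germ of a function. -/
def og {U : Opens X} (x : X) (hx : x ∈ U) (φ : X.O U) : X.OGerm x := gm (P := unit X) x hx φ

theorem og_res {U V : Opens X} (x : X) (h : V ≤ U) (hx : x ∈ V) (s : X.O U) :
    og x hx (X.resO h s) = og x (h hx) s := gm_res (P := unit X) x h hx s

theorem og_surj {x : X} (g : X.OGerm x) :
    ∃ (U : Opens X) (hx : x ∈ U) (s : X.O U), g = og x hx s := gm_surj (P := unit X) g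

theorem og_surj₂ {x : X} (a b : X.OGerm x) :
    ∃ (U : Opens X) (hx : x ∈ U) (s t : X.O U), a = og x hx s ∧ b = og x hx t :=
  gm_surj₂ (P₁ := unit X) (P₂ := unit X) a b

theorem og_surj₃ {x : X} (a b c : X.OGerm x) :
    ∃ (U : Opens X) (hx : x ∈ U) (s t r : X.O U), a = og x hx s ∧ b = og x hx t ∧ c = og x hx r :=
  gm_surj₃ (P₁ := unit X) (P₂ := unit X) (P₃ := unit X) a b c

instance (x : X) : AddCommGroup (X.OGerm x) :=
  inferInstanceAs (AddCommGroup ((PMod.unit X).Germ x))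

instance (x : X) : Mul (X.OGerm x) :=
  ⟨map₂ (P₁ := unit X) (P₂ := unit X) (P₃ := unit X) (fun U (s t : X.O U) => (s * t : X.O U))
    (fun _ _ h s t => ((X.resO h).map_mul s t).symm)⟩

instance (x : X) : One (X.OGerm x) := ⟨og (U := ⊤) x trivial 1⟩

theorem og_add {U : Opens X} {x : X} (hx : x ∈ U) (s t : X.O U) :
    og x hx (s + t) = og x hx s + og x hx t := gm_add (P := unit X) hx s t

theorem og_neg {U : Opens X} {x : X} (hx : x ∈ U) (s : X.O U) :
    og x hx (-s) = -og x hx s := rfl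

theorem og_zero {U : Opens X} {x : X} (hx : x ∈ U) : og x hx (0 : X.O U) = 0 :=
  gm_zero (P := unit X) hx

theorem og_mul {U : Opens X} {x : X} (hx : x ∈ U) (s t : X.O U) :
    og x hx (s * t) = og x hx s * og x hx t :=
  (map₂_gm (P₁ := unit X) (P₂ := unit X) (P₃ := unit X)
    (fun U (s t : X.O U) => (s * t : X.O U)) _ hx s t).symm

theorem og_one {U : Opens X} {x : X} (hx : x ∈ U) : og x hx (1 : X.O U) = 1 := by
  rw [← map_one (X.resO (le_top : U ≤ ⊤)), og_res]; rfl

instance (x : X) : CommRing (X.OGerm x) where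
  __ := (inferInstance : AddCommGroup (X.OGerm x))
  mul_assoc a b c := by
    obtain ⟨U, hU, r, s, t, rfl, rfl, rfl⟩ := og_surj₃ a b c
    simp only [← og_mul, mul_assoc]
  one_mul a := by
    obtain ⟨U, hU, r, rfl⟩ := og_surj a
    rw [← og_one hU, ← og_mul, one_mul]
  mul_one a := by
    obtain ⟨U, hU, r, rfl⟩ := og_surj a
    rw [← og_one hU, ← og_mul, mul_one]
  zero_mul a := by
    obtain ⟨U, hU, r, rfl⟩ := og_surj a
    rw [← og_zero hU, ← og_mul, zero_mul]
  mul_zero a := by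
    obtain ⟨U, hU, r, rfl⟩ := og_surj a
    rw [← og_zero hU, ← og_mul, mul_zero]
  left_distrib a b c := by
    obtain ⟨U, hU, r, s, t, rfl, rfl, rfl⟩ := og_surj₃ a b c
    simp only [← og_mul, ← og_add, mul_add]
  right_distrib a b c := by
    obtain ⟨U, hU, r, s, t, rfl, rfl, rfl⟩ := og_surj₃ a b c
    simp only [← og_mul, ← og_add, add_mul]
  mul_comm a b := by
    obtain ⟨U, hU, r, s, rfl, rfl⟩ := og_surj₂ a b
    simp only [← og_mul, mul_comm]

/-- Taking germs of functions is a ring homomorphism. -/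
def ogHom {U : Opens X} (x : X) (hx : x ∈ U) : X.O U →+* X.OGerm x where
  toFun := og x hx
  map_one' := og_one hx
  map_zero' := og_zero hx
  map_add' := og_add hx
  map_mul' := og_mul hx

end Mfd

namespace PMod

variable {X : Mfd.{u, v} 𝕜 K n} {P : PMod.{u, v, w} X}

open Mfd

instance (x : X) : SMul (X.OGerm x) (P.Germ x) :=
  ⟨map₂ (P₁ := unit X) (P₂ := P) (P₃ := P) (fun U (s : X.O U) t => s • t)
    (fun _ _ _ _ _ => (P.res_smul _ _ _).symm)⟩

theorem gm_smul {U : Opens X} {x : X} (hx : x ∈ U) (φ : X.O U) (s : P.Sec U) :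
    gm x hx (φ • s) = og x hx φ • gm x hx s :=
  (map₂_gm (P₁ := unit X) (P₂ := P) (P₃ := P) (fun U (s : X.O U) t => s • t) _ hx φ s).symm

theorem og_gm_surj {x : X} (a : X.OGerm x) (b : P.Germ x) :
    ∃ (U : Opens X) (hx : x ∈ U) (s : X.O U) (t : P.Sec U), a = og x hx s ∧ b = gm x hx t :=
  gm_surj₂ (P₁ := unit X) (P₂ := P) a b

instance (x : X) : Module (X.OGerm x) (P.Germ x) where
  one_smul a := by
    obtain ⟨U, hU, r, rfl⟩ := gm_surj a
    rw [← og_one hU, ← gm_smul, one_smul]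
  mul_smul a b c := by
    obtain ⟨U, hU, r, s, t, rfl, rfl, rfl⟩ := gm_surj₃ (P₁ := unit X) (P₂ := unit X) a b c
    change (og x hU r * og x hU s) • gm x hU t = og x hU r • og x hU s • gm x hU t
    rw [← og_mul, ← gm_smul, mul_smul, gm_smul, gm_smul]
  smul_zero a := by
    obtain ⟨U, hU, r, rfl⟩ := og_surj a
    rw [← gm_zero hU, ← gm_smul, smul_zero]
  zero_smul a := by
    obtain ⟨U, hU, r, rfl⟩ := gm_surj a
    rw [← og_zero hU, ← gm_zero hU, ← gm_smul, zero_smul]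
  smul_add a b c := by
    obtain ⟨U, hU, r, s, t, rfl, rfl, rfl⟩ := gm_surj₃ (P₁ := unit X) a b c
    change og x hU r • (gm x hU s + gm x hU t) = og x hU r • gm x hU s + og x hU r • gm x hU t
    rw [← gm_add, ← gm_smul, smul_add, gm_add, gm_smul, gm_smul]
  add_smul a b c := by
    obtain ⟨U, hU, r, s, t, rfl, rfl, rfl⟩ := gm_surj₃ (P₁ := unit X) (P₂ := unit X) a b c
    change (og x hU r + og x hU s) • gm x hU t = og x hU r • gm x hU t + og x hU s • gm x hU t
    rw [← og_add, ← gm_smul, add_smul, gm_add, gm_smul, gm_smul]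

end PMod

/-- `K`-valued vector fields on the open set `U`: derivations of the sheaf of algebras `𝒪_X|_U`
which at each point are given by a tangent vector, i.e. annihilate every function whose
differential at that point vanishes. -/
structure VField (X : Mfd.{u, v} 𝕜 K n) (U : Opens X) where
  toFun : ∀ V : Opens X, V ≤ U → X.O V →ₗ[K] X.O V
  leibniz : ∀ (V : Opens X) (h : V ≤ U) (φ ψ : X.O V),
    toFun V h (φ * ψ) = φ * toFun V h ψ + ψ * toFun V h φ
  natural : ∀ (V W : Opens X) (h : V ≤ U) (h' : W ≤ V) (φ : X.O V),
    toFun W (h'.trans h) (X.resO h' φ) = X.resO h' (toFun V h φ)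
  tangent : ∀ (V : Opens X) (h : V ≤ U) (φ : X.O V) (x : V),
    mfderiv 𝓘(𝕜, X.E) 𝓘(𝕜, K) φ.1 x = 0 → (toFun V h φ).1 x = 0

namespace VField

variable {X : Mfd.{u, v} 𝕜 K n} {U : Opens X}

@[ext] theorem ext {ξ η : VField X U}
    (h : ∀ (V : Opens X) (hV : V ≤ U) (φ : X.O V), ξ.toFun V hV φ = η.toFun V hV φ) : ξ = η := by
  cases ξ; cases η
  congr
  funext V hV
  exact LinearMap.ext (h V hV)

instance : Zero (VField X U) := ⟨⟨fun _ _ => 0, by simp, by simp, fun _ _ _ _ _ => rfl⟩⟩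

instance : Add (VField X U) := ⟨fun ξ η => ⟨fun V h => ξ.toFun V h + η.toFun V h,
  fun V h φ ψ => by simp only [LinearMap.add_apply, ξ.leibniz, η.leibniz]; ring,
  fun V W h h' φ => by
    rw [LinearMap.add_apply, LinearMap.add_apply, ξ.natural V W h h', η.natural V W h h', map_add],
  fun V h φ x hx => by
    change (ξ.toFun V h φ).1 x + (η.toFun V h φ).1 x = 0
    rw [ξ.tangent V h φ x hx, η.tangent V h φ x hx, add_zero]⟩⟩

instance : Neg (VField X U) := ⟨fun ξ => ⟨fun V h => -ξ.toFun V h,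
  fun V h φ ψ => by simp only [LinearMap.neg_apply, ξ.leibniz]; ring,
  fun V W h h' φ => by
    rw [LinearMap.neg_apply, LinearMap.neg_apply, ξ.natural V W h h', map_neg],
  fun V h φ x hx => by
    change -(ξ.toFun V h φ).1 x = 0
    rw [ξ.tangent V h φ x hx, neg_zero]⟩⟩

instance : SMul (X.O U) (VField X U) := ⟨fun ψ ξ =>
  ⟨fun V h => LinearMap.mulLeft K (X.resO h ψ) ∘ₗ ξ.toFun V h,
  fun V h φ ψ => by simp only [LinearMap.comp_apply, LinearMap.mulLeft_apply, ξ.leibniz]; ring,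
  fun V W h h' φ => by
    simp only [LinearMap.comp_apply, LinearMap.mulLeft_apply, map_mul]
    rw [ξ.natural V W h h']; rfl,
  fun V h φ x hx => by
    change (X.resO h ψ).1 x * (ξ.toFun V h φ).1 x = 0
    rw [ξ.tangent V h φ x hx, mul_zero]⟩⟩

@[simp] theorem zero_apply (V : Opens X) (h : V ≤ U) (φ : X.O V) :
    (0 : VField X U).toFun V h φ = 0 := rfl

@[simp] theorem add_apply (ξ η : VField X U) (V : Opens X) (h : V ≤ U) (φ : X.O V) :
    (ξ + η).toFun V h φ = ξ.toFun V h φ + η.toFun V h φ := rfl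

@[simp] theorem neg_apply (ξ : VField X U) (V : Opens X) (h : V ≤ U) (φ : X.O V) :
    (-ξ).toFun V h φ = -ξ.toFun V h φ := rfl

@[simp] theorem smul_apply (ψ : X.O U) (ξ : VField X U) (V : Opens X) (h : V ≤ U) (φ : X.O V) :
    (ψ • ξ).toFun V h φ = X.resO h ψ * ξ.toFun V h φ := rfl

instance : AddCommGroup (VField X U) where
  add_assoc a b c := by ext1; simp [add_assoc]
  zero_add a := by ext1; simp
  add_zero a := by ext1; simp
  neg_add_cancel a := by ext1; simp
  add_comm a b := by ext1; simp [add_comm]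
  nsmul := nsmulRec
  zsmul := zsmulRec

instance : Module (X.O U) (VField X U) where
  one_smul a := by ext1; simp
  mul_smul a b c := by ext1; simp [mul_assoc]
  smul_zero a := by ext1; simp
  zero_smul a := by ext1; simp
  smul_add a b c := by ext1; simp [mul_add]
  add_smul a b c := by ext1; simp [add_mul]

/-- Restriction of vector fields. -/
def res {V : Opens X} (h : V ≤ U) : VField X U →+ VField X V where
  toFun ξ := ⟨fun W h' => ξ.toFun W (h'.trans h), fun W _ => ξ.leibniz W _,
    fun W W' _ => ξ.natural W W' _, fun W _ => ξ.tangent W _⟩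
  map_zero' := rfl
  map_add' _ _ := rfl

@[simp] theorem res_apply {V : Opens X} (h : V ≤ U) (ξ : VField X U) (W : Opens X) (h' : W ≤ V)
    (φ : X.O W) : (res h ξ).toFun W h' φ = ξ.toFun W (h'.trans h) φ := rfl

/-- The action of a vector field on functions on its domain. -/
def act (ξ : VField X U) : X.O U →ₗ[K] X.O U := ξ.toFun U le_rfl

theorem act_mul (ξ : VField X U) (φ ψ : X.O U) : ξ.act (φ * ψ) = φ * ξ.act ψ + ψ * ξ.act φ :=
  ξ.leibniz U le_rfl φ ψ

theorem res_act {V : Opens X} (h : V ≤ U) (ξ : VField X U) (φ : X.O U) :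
    (res h ξ).act (X.resO h φ) = X.resO h (ξ.act φ) := ξ.natural U V le_rfl h φ

theorem add_act (ξ η : VField X U) (φ : X.O U) : (ξ + η).act φ = ξ.act φ + η.act φ := rfl

theorem smul_act (ψ : X.O U) (ξ : VField X U) (φ : X.O U) : (ψ • ξ).act φ = ψ * ξ.act φ := rfl

theorem ext_act {ξ η : VField X U}
    (h : ∀ (V : Opens X) (hV : V ≤ U) (φ : X.O V), (res hV ξ).act φ = (res hV η).act φ) : ξ = η :=
  ext fun V hV φ => h V hV φ

end VField

/-- The tangent sheaf `𝒯_X`. -/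
abbrev PMod.tangent (X : Mfd.{u, v} 𝕜 K n) : PMod.{u, v, u} X where
  Sec := VField X
  res := VField.res
  res_self _ := rfl
  res_res _ _ _ := rfl
  res_smul _ _ _ := rfl

namespace Mfd

variable {X : Mfd.{u, v} 𝕜 K n}

/-- Extension of a function by zero. -/
noncomputable def extend {V : Opens X} (φ : X.O V) (x : X) : K :=
  open Classical in if h : x ∈ V then φ.1 ⟨x, h⟩ else 0

theorem extend_coe {V : Opens X} (φ : X.O V) (x : V) : extend φ x = φ.1 x := by
  simp [extend]

theorem contMDiffAt_extend {V : Opens X} (φ : X.O V) {x : X} (hx : x ∈ V) :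
    ContMDiffAt 𝓘(𝕜, X.E) 𝓘(𝕜, K) n (extend φ) x := by
  refine (contMDiffAt_subtype_iff (x := (⟨x, hx⟩ : V))).1 ?_
  have : (fun x : V => extend φ x) = φ.1 := funext (extend_coe φ)
  rw [this]
  exact φ.2 _

/-- The domain of the standard chart at `p`. -/
def chartDom (p : X) : Opens X := ⟨(chartAt X.E p).source, (chartAt X.E p).open_source⟩

theorem mem_chartDom (p : X) : p ∈ chartDom p := mem_chart_source _ p

/-- A function expressed in the standard chart at `p`. -/
noncomputable def written (p : X) {V : Opens X} (φ : X.O V) (e : X.E) : K :=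
  extend φ ((chartAt X.E p).symm e)

theorem contDiffAt_written (p : X) {V : Opens X} (φ : X.O V) {x : X} (hx : x ∈ V)
    (hp : x ∈ chartDom p) : ContDiffAt 𝕜 n (written p φ) (chartAt X.E p x) := by
  rw [← contMDiffAt_iff_contDiffAt]
  have h1 := (chartAt X.E p).map_source hp
  have h2 : ContMDiffAt 𝓘(𝕜, X.E) 𝓘(𝕜, X.E) n (chartAt X.E p).symm (chartAt X.E p x) :=
    (contMDiffOn_chart_symm (I := 𝓘(𝕜, X.E)) (x := p)).contMDiffAt
      ((chartAt X.E p).open_target.mem_nhds h1)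
  refine ContMDiffAt.comp _ ?_ h2
  rw [(chartAt X.E p).left_inv hp]
  exact contMDiffAt_extend φ hx

theorem one_le : 1 ≤ n := by
  rcases (Fact.out : n = ∞ ∨ n = ω) with rfl | rfl <;> simp

theorem succ_le : n + 1 ≤ n := by
  rcases (Fact.out : n = ∞ ∨ n = ω) with rfl | rfl <;> simp

theorem symm_le : minSmoothness 𝕜 2 ≤ n := by
  rw [minSmoothness_of_isRCLikeNormedField]
  rcases (Fact.out : n = ∞ ∨ n = ω) with rfl | rfl
  · exact WithTop.coe_le_coe.2 le_top
  · simp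

/-- The index set of coordinates. -/
abbrev Idx (X : Mfd.{u, v} 𝕜 K n) : Type := Fin (Module.finrank 𝕜 X.E)

variable (p : X)

/-- The coordinate functions of the standard chart at `p`. -/
noncomputable def coord (i : X.Idx) : X.O (chartDom p) :=
  ⟨fun x => algebraMap 𝕜 K ((Module.finBasis 𝕜 X.E).coord i (chartAt X.E p x)), by
    have h : ContMDiff 𝓘(𝕜, X.E) 𝓘(𝕜, X.E) n (fun x : chartDom p => chartAt X.E p x) := by
      intro x
      exact (contMDiffAt_subtype_iff (f := chartAt X.E p)).2
        ((contMDiffOn_chart (I := 𝓘(𝕜, X.E)) (x := p)).contMDiffAt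
          ((chartDom p).isOpen.mem_nhds x.2))
    have h2 : ContDiff 𝕜 n (fun e : X.E =>
        algebraMap 𝕜 K ((Module.finBasis 𝕜 X.E).coord i e)) :=
      ((Algebra.linearMap 𝕜 K) ∘ₗ
        (Module.finBasis 𝕜 X.E).coord i).toContinuousLinearMap.contDiff
    exact h2.contMDiff.comp h⟩

/-- Partial derivatives with respect to the coordinates of the standard chart at `p`. -/
noncomputable def pd (i : X.Idx) (V : Opens X) (hV : V ≤ chartDom p) : X.O V →ₗ[K] X.O V where
  toFun φ := ⟨fun x => fderiv 𝕜 (written p φ) (chartAt X.E p x) (Module.finBasis 𝕜 X.E i), by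
    intro x
    have h1 : ContDiffAt 𝕜 n (fun e => fderiv 𝕜 (written p φ) e (Module.finBasis 𝕜 X.E i))
        (chartAt X.E p x) :=
      ((contDiffAt_written p φ x.2 (hV x.2)).fderiv_right succ_le).clm_apply contDiffAt_const
    refine (contMDiffAt_subtype_iff (f := fun x => fderiv 𝕜 (written p φ) (chartAt X.E p x)
      (Module.finBasis 𝕜 X.E i))).2 ?_
    exact h1.contMDiffAt.comp x.1
      ((contMDiffOn_chart (I := 𝓘(𝕜, X.E)) (x := p)).contMDiffAt
          ((chartDom p).isOpen.mem_nhds (hV x.2)))⟩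
  map_add' φ ψ := by
    apply X.O_ext
    intro x
    have : written p (φ + ψ) = written p φ + written p ψ := by
      funext e
      simp only [written, extend, Pi.add_apply]
      split_ifs <;> simp
    change fderiv 𝕜 (written p (φ + ψ)) _ _ = fderiv 𝕜 (written p φ) _ _ + fderiv 𝕜 (written p ψ) _ _
    rw [this, fderiv_add, add_apply]
    · exact (contDiffAt_written p φ x.2 (hV x.2)).differentiableAt (by have := one_le (n := n); positivity)
    · exact (contDiffAt_written p ψ x.2 (hV x.2)).differentiableAt (by have := one_le (n := n); positivity)
  map_smul' c φ := by
    apply X.O_ext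
    intro x
    have : written p (c • φ) = (ContinuousLinearMap.mul 𝕜 K c) ∘ written p φ := by
      funext e
      simp only [written, extend, Function.comp]
      split_ifs <;> simp
    change fderiv 𝕜 (written p (c • φ)) _ _ = c • fderiv 𝕜 (written p φ) _ _
    rw [this, fderiv_comp, ContinuousLinearMap.fderiv]
    · simp
    · exact (ContinuousLinearMap.mul 𝕜 K c).differentiableAt
    · exact (contDiffAt_written p φ x.2 (hV x.2)).differentiableAt (by have := one_le (n := n); positivity)

theorem pd_apply (i : X.Idx) {V : Opens X} (hV : V ≤ chartDom p) (φ : X.O V) (x : V) :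
    (pd p i V hV φ).1 x =
      fderiv 𝕜 (written p φ) (chartAt X.E p x) (Module.finBasis 𝕜 X.E i) := rfl

theorem continuousAt_symm {x : X} (hx : x ∈ chartDom p) :
    ContinuousAt (chartAt X.E p).symm (chartAt X.E p x) :=
  (chartAt X.E p).continuousAt_symm ((chartAt X.E p).map_source hx)

theorem mem_nhds_symm {x : X} (hx : x ∈ chartDom p) {V : Opens X} (hxV : x ∈ V) :
    ∀ᶠ e in nhds (chartAt X.E p x), (chartAt X.E p).symm e ∈ V := by
  apply continuousAt_symm p hx
  rw [(chartAt X.E p).left_inv hx]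
  exact V.isOpen.mem_nhds hxV

theorem pd_res (i : X.Idx) {V W : Opens X} (hV : V ≤ chartDom p) (h : W ≤ V) (φ : X.O V) :
    pd p i W (h.trans hV) (X.resO h φ) = X.resO h (pd p i V hV φ) := by
  apply X.O_ext
  intro x
  rw [resO_apply, pd_apply, pd_apply]
  congr 1
  apply Filter.EventuallyEq.fderiv_eq
  filter_upwards [mem_nhds_symm p (hV (h x.2)) x.2] with e he
  simp [written, extend, he, h he]

theorem written_chart {V : Opens X} (hV : V ≤ chartDom p) (φ : X.O V) (x : V) :
    written p φ (chartAt X.E p x) = φ.1 x := by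
  rw [written, (chartAt X.E p).left_inv (hV x.2), extend_coe]

theorem mdiff_chart {V : Opens X} (hV : V ≤ chartDom p) (x : V) :
    MDifferentiableAt 𝓘(𝕜, X.E) 𝓘(𝕜, X.E) (fun x : V => chartAt X.E p x) x :=
  ((contMDiffAt_subtype_iff (f := chartAt X.E p)).2
    ((contMDiffOn_chart (I := 𝓘(𝕜, X.E)) (n := n) (x := p)).contMDiffAt
      ((chartDom p).isOpen.mem_nhds (hV x.2)))).mdifferentiableAt (by
        have := one_le (n := n); positivity)

theorem diff_written {V : Opens X} (hV : V ≤ chartDom p) (φ : X.O V) (x : V) :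
    DifferentiableAt 𝕜 (written p φ) (chartAt X.E p x) :=
  (contDiffAt_written p φ x.2 (hV x.2)).differentiableAt (by
    have := one_le (n := n); positivity)

theorem mfderiv_eq {V : Opens X} (hV : V ≤ chartDom p) (φ : X.O V) (x : V) :
    mfderiv 𝓘(𝕜, X.E) 𝓘(𝕜, K) φ.1 x = (fderiv 𝕜 (written p φ) (chartAt X.E p x)) ∘L
      (mfderiv 𝓘(𝕜, X.E) 𝓘(𝕜, X.E) (fun x : V => chartAt X.E p x) x) := by
  have : φ.1 = written p φ ∘ (fun x : V => chartAt X.E p x) :=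
    funext fun x => (written_chart p hV φ x).symm
  conv_lhs => rw [this]
  rw [mfderiv_comp x (diff_written p hV φ x).mdifferentiableAt (mdiff_chart p hV x),
    mfderiv_eq_fderiv]
  rfl

/-- The partial derivatives vanish where the differential does. -/
theorem pd_eq_zero (i : X.Idx) {V : Opens X} (hV : V ≤ chartDom p) (φ : X.O V) (hp : p ∈ V)
    (h0 : mfderiv 𝓘(𝕜, X.E) 𝓘(𝕜, K) φ.1 ⟨p, hp⟩ = 0) : (pd p i V hV φ).1 ⟨p, hp⟩ = 0 := by
  rw [mfderiv_eq p hV] at h0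
  have : IsManifold 𝓘(𝕜, X.E) 1 V := IsManifold.of_le (n := n) one_le
  have : (mfderiv 𝓘(𝕜, X.E) 𝓘(𝕜, X.E) (fun x : V => chartAt X.E p x) ⟨p, hp⟩).IsInvertible :=
    isInvertible_mfderiv_extChartAt (I := 𝓘(𝕜, X.E)) (x := (⟨p, hp⟩ : V))
      (mem_extChartAt_source _)
  obtain ⟨e, he⟩ := this
  rw [← he] at h0
  rw [pd_apply]
  have h1 := congrArg (fun l => l (e.symm (Module.finBasis 𝕜 X.E i))) h0
  refine Eq.trans (congrArg _ ?_) h1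
  exact (e.apply_symm_apply _).symm

theorem sumO_apply {V : Opens X} {ι : Type} (s : Finset ι) (φ : ι → X.O V) (x : V) :
    (∑ i ∈ s, φ i).1 x = ∑ i ∈ s, (φ i).1 x := by
  change ((X.functions V).subtype (∑ i ∈ s, φ i)) x = _
  rw [map_sum, Finset.sum_apply]
  rfl

theorem fderiv_coord (j : X.Idx) {V : Opens X} (hV : V ≤ chartDom p) (x : V) (v : X.E) :
    fderiv 𝕜 (written p (X.resO hV (coord p j))) (chartAt X.E p x) v =
      algebraMap 𝕜 K ((Module.finBasis 𝕜 X.E).coord j v) := by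
  have : written p (X.resO hV (coord p j)) =ᶠ[nhds (chartAt X.E p x)]
      ((Algebra.linearMap 𝕜 K) ∘ₗ (Module.finBasis 𝕜 X.E).coord j).toContinuousLinearMap := by
    filter_upwards [mem_nhds_symm p (hV x.2) x.2,
      (chartAt X.E p).open_target.mem_nhds ((chartAt X.E p).map_source (hV x.2))] with e he he2
    simp [written, extend, he, coord, (chartAt X.E p).right_inv he2]
  rw [this.fderiv_eq, ContinuousLinearMap.fderiv]
  rfl

theorem pd_coord (i j : X.Idx) {V : Opens X} (hV : V ≤ chartDom p) :
    pd p i V hV (X.resO hV (coord p j)) = if i = j then 1 else 0 := by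
  apply X.O_ext
  intro x
  rw [pd_apply, fderiv_coord]
  split_ifs with h
  · subst h; simp
  · simp [h]

theorem pd_mul (i : X.Idx) {V : Opens X} (hV : V ≤ chartDom p) (φ ψ : X.O V) :
    pd p i V hV (φ * ψ) = φ * pd p i V hV ψ + ψ * pd p i V hV φ := by
  apply X.O_ext
  intro x
  have : written p (φ * ψ) = written p φ * written p ψ := by
    funext e
    simp only [written, extend, Pi.mul_apply]
    split_ifs <;> simp
  change (pd p i V hV (φ * ψ)).1 x = φ.1 x * (pd p i V hV ψ).1 x + ψ.1 x * (pd p i V hV φ).1 x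
  rw [pd_apply, pd_apply, pd_apply, this, fderiv_mul (diff_written p hV φ x)
    (diff_written p hV ψ x), written_chart p hV, written_chart p hV]
  rfl

theorem pd_comm (i j : X.Idx) {V : Opens X} (hV : V ≤ chartDom p) (φ : X.O V) :
    pd p i V hV (pd p j V hV φ) = pd p j V hV (pd p i V hV φ) := by
  apply X.O_ext
  intro x
  have key : ∀ i j : X.Idx, (pd p i V hV (pd p j V hV φ)).1 x =
      fderiv 𝕜 (fderiv 𝕜 (written p φ)) (chartAt X.E p x) (Module.finBasis 𝕜 X.E i)
        (Module.finBasis 𝕜 X.E j) := by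
    intro i j
    rw [pd_apply]
    have h1 : written p (pd p j V hV φ) =ᶠ[nhds (chartAt X.E p x)]
        fun e => fderiv 𝕜 (written p φ) e (Module.finBasis 𝕜 X.E j) := by
      filter_upwards [mem_nhds_symm p (hV x.2) x.2,
        (chartAt X.E p).open_target.mem_nhds ((chartAt X.E p).map_source (hV x.2))] with e he he2
      simp [written, extend, he, pd, (chartAt X.E p).right_inv he2]
    have h2 : DifferentiableAt 𝕜 (fderiv 𝕜 (written p φ)) (chartAt X.E p x) :=
      ((contDiffAt_written p φ x.2 (hV x.2)).fderiv_right succ_le).differentiableAt (by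
        have := one_le (n := n); positivity)
    rw [h1.fderiv_eq, fderiv_clm_apply h2 (differentiableAt_const _)]
    simp
  rw [key, key]
  exact ((contDiffAt_written p φ x.2 (hV x.2)).isSymmSndFDerivAt symm_le) _ _

end Mfd

namespace VField

open Mfd

variable {X : Mfd.{u, v} 𝕜 K n} {U : Opens X}

/-- A vector field is determined by its values on coordinate functions. -/
theorem act_eq_sum (ξ : VField X U) (p : X) {V : Opens X} (hU : V ≤ U) (hV : V ≤ chartDom p)
    (φ : X.O V) : ξ.toFun V hU φ =
      ∑ i, ξ.toFun V hU (X.resO hV (coord p i)) * pd p i V hV φ := by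
  apply X.O_ext
  intro x
  have h0 := ξ.tangent V hU (φ - ∑ i, (pd p i V hV φ).1 x • X.resO hV (coord p i)) x ?_
  · rw [map_sub, map_sum] at h0
    simp only [map_smul] at h0
    have h1 : (ξ.toFun V hU φ).1 x - (∑ i, (pd p i V hV φ).1 x •
      ξ.toFun V hU (X.resO hV (coord p i))).1 x = 0 := h0
    rw [sub_eq_zero.1 h1, sumO_apply, sumO_apply]
    exact Finset.sum_congr rfl fun i _ => mul_comm _ _
  · rw [mfderiv_eq p hV]
    suffices h : fderiv 𝕜 (written p (φ - ∑ i, (pd p i V hV φ).1 x • X.resO hV (coord p i)))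
        (chartAt X.E p x) = 0 by rw [h]; rfl
    apply ContinuousLinearMap.coe_injective
    refine (Module.finBasis 𝕜 X.E).ext fun j => ?_
    change (pd p j V hV _).1 x = 0
    simp only [map_sub, map_sum, map_smul, pd_coord]
    change (pd p j V hV φ).1 x - (∑ i, _ : X.O V).1 x = 0
    rw [sumO_apply, sub_eq_zero, Finset.sum_eq_single j]
    · simp
    · intro i _ hi
      simp [Ne.symm hi]
    · simp

/-- The Lie bracket of vector fields, `[ξ, η] = ξ η - η ξ` as operators on functions. -/
instance : Bracket (VField X U) (VField X U) := ⟨fun ξ η =>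
  ⟨fun V h => ξ.toFun V h ∘ₗ η.toFun V h - η.toFun V h ∘ₗ ξ.toFun V h,
  fun V h φ ψ => by
    simp only [LinearMap.sub_apply, LinearMap.comp_apply, ξ.leibniz, η.leibniz, map_add]; ring,
  fun V W h h' φ => by
    simp only [LinearMap.sub_apply, LinearMap.comp_apply, map_sub]
    rw [ξ.natural V W h h', η.natural V W h h', ξ.natural V W h h', η.natural V W h h'],
  by
    intro V h φ x hx
    obtain ⟨p, hp⟩ := x
    let W := V ⊓ chartDom p
    have hW : W ≤ chartDom p := inf_le_right
    have hWV : W ≤ V := inf_le_left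
    have hpW : p ∈ W := ⟨hp, mem_chartDom p⟩
    set φ' := X.resO hWV φ with hφ'
    have h0 : ∀ i, (pd p i W hW φ').1 ⟨p, hpW⟩ = 0 := fun i => pd_eq_zero p i hW φ' hpW (by
      have : φ'.1 = φ.1 ∘ TopologicalSpace.Opens.inclusion hWV := rfl
      rw [this, mfderiv_comp (I' := 𝓘(𝕜, X.E))]
      · erw [hx]; exact ContinuousLinearMap.zero_comp _
      · exact φ.2.mdifferentiable (by have := one_le (n := n); positivity) _
      · exact (contMDiff_inclusion (n := 1) hWV).mdifferentiable (by simp) _)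
    have key : ∀ ξ η : VField X U, (ξ.toFun W (hWV.trans h) (η.toFun W (hWV.trans h) φ')).1 ⟨p, hpW⟩
        = ∑ i, ∑ j, (η.toFun W (hWV.trans h) (X.resO hW (coord p i))).1 ⟨p, hpW⟩ *
          ((ξ.toFun W (hWV.trans h) (X.resO hW (coord p j))).1 ⟨p, hpW⟩ *
            (pd p j W hW (pd p i W hW φ')).1 ⟨p, hpW⟩) := by
      intro ξ η
      rw [act_eq_sum η p (hWV.trans h) hW, map_sum, sumO_apply]
      refine Finset.sum_congr rfl fun i _ => ?_
      rw [ξ.leibniz]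
      have : ∀ a b c d : X.O W, (a * b + c * d).1 ⟨p, hpW⟩ =
        a.1 ⟨p, hpW⟩ * b.1 ⟨p, hpW⟩ + c.1 ⟨p, hpW⟩ * d.1 ⟨p, hpW⟩ := fun _ _ _ _ => rfl
      rw [this, h0, zero_mul, add_zero, act_eq_sum ξ p (hWV.trans h) hW, sumO_apply, Finset.mul_sum]
      rfl
    have e : ((ξ.toFun V h (η.toFun V h φ) - η.toFun V h (ξ.toFun V h φ)).1 ⟨p, hp⟩ : K) =
        (ξ.toFun W (hWV.trans h) (η.toFun W (hWV.trans h) φ')).1 ⟨p, hpW⟩ -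
        (η.toFun W (hWV.trans h) (ξ.toFun W (hWV.trans h) φ')).1 ⟨p, hpW⟩ := by
      rw [hφ', ξ.natural V W h hWV, η.natural V W h hWV, ξ.natural V W h hWV, η.natural V W h hWV]
      rfl
    refine e.trans ?_
    rw [key, key, Finset.sum_comm, sub_eq_zero]
    refine Finset.sum_congr rfl fun i _ => Finset.sum_congr rfl fun j _ => ?_
    rw [pd_comm p i j hW]
    ring⟩⟩

theorem bracket_act (ξ η : VField X U) (φ : X.O U) :
    ⁅ξ, η⁆.act φ = ξ.act (η.act φ) - η.act (ξ.act φ) := rfl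

end VField

theorem VField.res_bracket {X : Mfd.{u, v} 𝕜 K n} {U V : Opens X} (h : V ≤ U) (ξ η : VField X U) :
    VField.res h ⁅ξ, η⁆ = ⁅VField.res h ξ, VField.res h η⁆ := rfl

/-- Differential forms of degree `k` on the open set `U`: alternating `𝒪`-multilinear maps
`𝒯_X × ⋯ × 𝒯_X → 𝒪_X` of sheaves on `U`. -/
structure Form (X : Mfd.{u, v} 𝕜 K n) (k : ℕ) (U : Opens X) where
  toFun : ∀ V : Opens X, V ≤ U → VField X V [⋀^Fin k]→ₗ[X.O V] X.O V
  natural : ∀ (V W : Opens X) (h : V ≤ U) (h' : W ≤ V) (ξ : Fin k → VField X V),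
    toFun W (h'.trans h) (fun a => VField.res h' (ξ a)) = X.resO h' (toFun V h ξ)

namespace Form

variable {X : Mfd.{u, v} 𝕜 K n} {k : ℕ} {U : Opens X}

@[ext] theorem ext {α β : Form X k U}
    (h : ∀ (V : Opens X) (hV : V ≤ U) (ξ : Fin k → VField X V),
      α.toFun V hV ξ = β.toFun V hV ξ) : α = β := by
  cases α; cases β
  congr
  funext V hV
  exact AlternatingMap.ext (h V hV)

instance : Zero (Form X k U) := ⟨⟨fun _ _ => 0, by simp⟩⟩

instance : Add (Form X k U) := ⟨fun α β => ⟨fun V h => α.toFun V h + β.toFun V h,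
  fun V W h h' ξ => by
    rw [AlternatingMap.add_apply, AlternatingMap.add_apply, α.natural V W h h',
      β.natural V W h h', map_add]⟩⟩

instance : Neg (Form X k U) := ⟨fun α => ⟨fun V h => -α.toFun V h,
  fun V W h h' ξ => by
    rw [AlternatingMap.neg_apply, AlternatingMap.neg_apply, α.natural V W h h', map_neg]⟩⟩

instance : SMul (X.O U) (Form X k U) := ⟨fun ψ α => ⟨fun V h => X.resO h ψ • α.toFun V h,
  fun V W h h' ξ => by
    rw [AlternatingMap.smul_apply, AlternatingMap.smul_apply, α.natural V W h h', smul_eq_mul,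
      smul_eq_mul, map_mul]
    rfl⟩⟩

@[simp] theorem zero_apply (V : Opens X) (h : V ≤ U) (ξ : Fin k → VField X V) :
    (0 : Form X k U).toFun V h ξ = 0 := rfl

@[simp] theorem add_apply (α β : Form X k U) (V : Opens X) (h : V ≤ U) (ξ : Fin k → VField X V) :
    (α + β).toFun V h ξ = α.toFun V h ξ + β.toFun V h ξ := rfl

@[simp] theorem neg_apply (α : Form X k U) (V : Opens X) (h : V ≤ U) (ξ : Fin k → VField X V) :
    (-α).toFun V h ξ = -α.toFun V h ξ := rfl

@[simp] theorem smul_apply (ψ : X.O U) (α : Form X k U) (V : Opens X) (h : V ≤ U)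
    (ξ : Fin k → VField X V) : (ψ • α).toFun V h ξ = X.resO h ψ * α.toFun V h ξ := rfl

instance : AddCommGroup (Form X k U) where
  add_assoc a b c := by ext1; simp [add_assoc]
  zero_add a := by ext1; simp
  add_zero a := by ext1; simp
  neg_add_cancel a := by ext1; simp
  add_comm a b := by ext1; simp [add_comm]
  nsmul := nsmulRec
  zsmul := zsmulRec

instance : Module (X.O U) (Form X k U) where
  one_smul a := by ext1; simp
  mul_smul a b c := by ext1; simp [mul_assoc]
  smul_zero a := by ext1; simp
  zero_smul a := by ext1; simp
  smul_add a b c := by ext1; simp [mul_add]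
  add_smul a b c := by ext1; simp [add_mul]

/-- Restriction of differential forms. -/
def res {V : Opens X} (h : V ≤ U) : Form X k U →+ Form X k V where
  toFun α := ⟨fun W h' => α.toFun W (h'.trans h), fun W W' _ => α.natural W W' _⟩
  map_zero' := rfl
  map_add' _ _ := rfl

/-- The value of a `1`-form on a vector field. -/
def ap (α : Form X 1 U) (ξ : VField X U) : X.O U := α.toFun U le_rfl (fun _ => ξ)

theorem res_ap {V : Opens X} (h : V ≤ U) (α : Form X 1 U) (ξ : VField X U) :
    (res h α).ap (VField.res h ξ) = X.resO h (α.ap ξ) := α.natural U V le_rfl h fun _ => ξ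

theorem ap_add (α : Form X 1 U) (ξ η : VField X U) : α.ap (ξ + η) = α.ap ξ + α.ap η :=
  ((AlternatingMap.ofSubsingleton (X.O U) (VField X U) (X.O U) (0 : Fin 1)).symm
    (α.toFun U le_rfl)).map_add ξ η

theorem ap_smul (α : Form X 1 U) (ψ : X.O U) (ξ : VField X U) : α.ap (ψ • ξ) = ψ * α.ap ξ :=
  ((AlternatingMap.ofSubsingleton (X.O U) (VField X U) (X.O U) (0 : Fin 1)).symm
    (α.toFun U le_rfl)).map_smul ψ ξ

/-- Construction of `1`-forms. -/
def ofLinear (F : ∀ V : Opens X, V ≤ U → VField X V →ₗ[X.O V] X.O V)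
    (hF : ∀ (V W : Opens X) (h : V ≤ U) (h' : W ≤ V) (ξ : VField X V),
      F W (h'.trans h) (VField.res h' ξ) = X.resO h' (F V h ξ)) : Form X 1 U where
  toFun V h := AlternatingMap.ofSubsingleton (X.O V) (VField X V) (X.O V) (0 : Fin 1) (F V h)
  natural V W h h' ξ := hF V W h h' (ξ 0)

theorem res_ofLinear_ap (F hF) {V : Opens X} (h : V ≤ U) (ξ : VField X V) :
    (res h (ofLinear (U := U) F hF)).ap ξ = F V h ξ := rfl

/-- The differential of a function, `(dφ)(ζ) = ζ(φ)`. -/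
def d (φ : X.O U) : Form X 1 U :=
  ofLinear (fun V h =>
    { toFun := fun ζ => ζ.act (X.resO h φ)
      map_add' := fun _ _ => rfl
      map_smul' := fun _ _ => rfl })
    (fun _ _ h h' ζ => ζ.res_act h' (X.resO h φ))

/-- The Lie derivative of a `1`-form, `(L_ξ α)(ζ) = ξ(α(ζ)) - α([ξ, ζ])`. -/
def lie (ξ : VField X U) (α : Form X 1 U) : Form X 1 U :=
  ofLinear (fun V h =>
    { toFun := fun ζ => (VField.res h ξ).act ((res h α).ap ζ) - (res h α).ap ⁅VField.res h ξ, ζ⁆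
      map_add' := fun ζ ζ' => by
        have : ⁅VField.res h ξ, ζ + ζ'⁆ = ⁅VField.res h ξ, ζ⁆ + ⁅VField.res h ξ, ζ'⁆ := by
          refine VField.ext_act fun W hW φ => ?_
          simp only [VField.res_bracket, VField.bracket_act, map_add, VField.add_act]
          ring
        rw [this, ap_add, ap_add, map_add]
        ring
      map_smul' := fun ψ ζ => by
        have : ⁅VField.res h ξ, ψ • ζ⁆ =
            ψ • ⁅VField.res h ξ, ζ⁆ + (VField.res h ξ).act ψ • ζ := by
          refine VField.ext_act fun W hW φ => ?_
          change (VField.res hW (VField.res h ξ)).act (X.resO hW ψ * (VField.res hW ζ).act φ) -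
            X.resO hW ψ * (VField.res hW ζ).act ((VField.res hW (VField.res h ξ)).act φ) =
            X.resO hW ψ * ((VField.res hW (VField.res h ξ)).act ((VField.res hW ζ).act φ) -
              (VField.res hW ζ).act ((VField.res hW (VField.res h ξ)).act φ)) +
            X.resO hW ((VField.res h ξ).act ψ) * (VField.res hW ζ).act φ
          rw [VField.act_mul, ← VField.res_act]
          ring
        rw [this, ap_add, ap_smul, ap_smul, ap_smul, VField.act_mul, RingHom.id_apply, smul_eq_mul]
        ring })
    (fun V W h h' ζ => by
      have e1 : (res (h'.trans h) α).ap (VField.res h' ζ) = X.resO h' ((res h α).ap ζ) :=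
        res_ap h' (res h α) ζ
      have e2 : (res (h'.trans h) α).ap (VField.res h' ⁅VField.res h ξ, ζ⁆) =
        X.resO h' ((res h α).ap ⁅VField.res h ξ, ζ⁆) := res_ap h' (res h α) _
      have e3 := VField.res_act h' (VField.res h ξ) ((res h α).ap ζ)
      change (VField.res h' (VField.res h ξ)).act ((res (h'.trans h) α).ap (VField.res h' ζ)) -
        (res (h'.trans h) α).ap (VField.res h' ⁅VField.res h ξ, ζ⁆) = X.resO h' (_ - _)
      rw [e1, e2, e3, map_sub])

/-- The contraction `ι_η dα`, i.e. the `1`-form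
`ζ ↦ dα(η, ζ) = η(α(ζ)) - ζ(α(η)) - α([η, ζ])`. -/
def iotaD (η : VField X U) (α : Form X 1 U) : Form X 1 U := lie η α - d (α.ap η)

/-- The contraction of a `3`-form with two vector fields, i.e. the `1`-form `ζ ↦ H(ξ, η, ζ)`. -/
def contract (H : Form X 3 U) (ξ η : VField X U) : Form X 1 U :=
  ofLinear (fun V h => (H.toFun V h).toMultilinearMap.toLinearMap
      ![VField.res h ξ, VField.res h η, 0] 2)
    (fun V W h h' ζ => by
      simp only [MultilinearMap.toLinearMap_apply]
      refine Eq.trans (congrArg (H.toFun W _) ?_) (H.natural V W h h' _)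
      funext a
      fin_cases a <;> rfl)

theorem contract_apply (H : Form X 3 U) (ξ η : VField X U) {V : Opens X} (h : V ≤ U)
    (ζ : VField X V) : (res h (contract H ξ η)).ap ζ =
      H.toFun V h ![VField.res h ξ, VField.res h η, ζ] := by
  refine congrArg (H.toFun V h) ?_
  funext a
  fin_cases a <;> rfl

/-- Closed `3`-forms: `dH = 0`, with `dH` given by the Koszul formula. -/
def IsClosed (H : Form X 3 U) : Prop :=
  ∀ (V : Opens X) (h : V ≤ U) (ξ : Fin 4 → VField X V),
    (ξ 0).act (H.toFun V h ![ξ 1, ξ 2, ξ 3]) - (ξ 1).act (H.toFun V h ![ξ 0, ξ 2, ξ 3])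
      + (ξ 2).act (H.toFun V h ![ξ 0, ξ 1, ξ 3]) - (ξ 3).act (H.toFun V h ![ξ 0, ξ 1, ξ 2])
      - H.toFun V h ![⁅ξ 0, ξ 1⁆, ξ 2, ξ 3] + H.toFun V h ![⁅ξ 0, ξ 2⁆, ξ 1, ξ 3]
      - H.toFun V h ![⁅ξ 0, ξ 3⁆, ξ 1, ξ 2] - H.toFun V h ![⁅ξ 1, ξ 2⁆, ξ 0, ξ 3]
      + H.toFun V h ![⁅ξ 1, ξ 3⁆, ξ 0, ξ 2] - H.toFun V h ![⁅ξ 2, ξ 3⁆, ξ 0, ξ 1] = 0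

end Form

/-- The sheaf of differential forms of degree `k`. -/
abbrev PMod.forms (X : Mfd.{u, v} 𝕜 K n) (k : ℕ) : PMod.{u, v, u} X where
  Sec := Form X k
  res := Form.res
  res_self _ := rfl
  res_res _ _ _ := rfl
  res_smul _ _ _ := rfl

/-- A sheaf of `𝒪_X`-modules on the manifold `X`. -/
structure SMod (X : Mfd.{u, v} 𝕜 K n) extends PMod.{u, v, w} X where
  locality : ∀ {U : Opens X} (s t : Sec U),
    (∀ x ∈ U, ∃ (V : Opens X) (h : V ≤ U), x ∈ V ∧ res h s = res h t) → s = t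
  gluing : ∀ {U : Opens X} (V : U → Opens X) (hV : ∀ x, V x ≤ U) (_ : ∀ x, x.1 ∈ V x)
    (s : ∀ x, Sec (V x)),
    (∀ x y, res (inf_le_left : V x ⊓ V y ≤ V x) (s x) = res inf_le_right (s y)) →
      ∃ t : Sec U, ∀ x, res (hV x) t = s x

/-- The structure of a Courant algebroid on a sheaf of `𝒪_X`-modules `M`: a Leibniz bracket, a
symmetric pairing, an anchor `π : M → 𝒯_X` and a co-anchor `π† : Ω¹_X → M`. (The bracket is
`K`-bilinear, as follows from biadditivity, `bracket_smul` and `bracket_symm`.) -/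
structure CourantStr {X : Mfd.{u, v} 𝕜 K n} (M : SMod.{u, v, w} X) where
  bracket : ∀ U : Opens X, M.Sec U → M.Sec U → M.Sec U
  pairing : ∀ U : Opens X, M.Sec U →ₗ[X.O U] M.Sec U →ₗ[X.O U] X.O U
  anchor : ∀ U : Opens X, M.Sec U →ₗ[X.O U] VField X U
  coanchor : ∀ U : Opens X, Form X 1 U →ₗ[X.O U] M.Sec U
  res_bracket : ∀ {U V : Opens X} (h : V ≤ U) (q p : M.Sec U),
    M.res h (bracket U q p) = bracket V (M.res h q) (M.res h p)
  res_pairing : ∀ {U V : Opens X} (h : V ≤ U) (q p : M.Sec U),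
    X.resO h (pairing U q p) = pairing V (M.res h q) (M.res h p)
  res_anchor : ∀ {U V : Opens X} (h : V ≤ U) (q : M.Sec U),
    VField.res h (anchor U q) = anchor V (M.res h q)
  res_coanchor : ∀ {U V : Opens X} (h : V ≤ U) (α : Form X 1 U),
    M.res h (coanchor U α) = coanchor V (Form.res h α)
  add_bracket : ∀ {U : Opens X} (q q' p : M.Sec U),
    bracket U (q + q') p = bracket U q p + bracket U q' p
  bracket_add : ∀ {U : Opens X} (q p p' : M.Sec U),
    bracket U q (p + p') = bracket U q p + bracket U q p'
  jacobi : ∀ {U : Opens X} (q p r : M.Sec U),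
    bracket U q (bracket U p r) = bracket U (bracket U q p) r + bracket U p (bracket U q r)
  anchor_bracket : ∀ {U : Opens X} (q p : M.Sec U),
    anchor U (bracket U q p) = ⁅anchor U q, anchor U p⁆
  pairing_symm : ∀ {U : Opens X} (q p : M.Sec U), pairing U q p = pairing U p q
  anchor_coanchor : ∀ {U : Opens X} (α : Form X 1 U), anchor U (coanchor U α) = 0
  bracket_smul : ∀ {U : Opens X} (q p : M.Sec U) (φ : X.O U),
    bracket U q (φ • p) = φ • bracket U q p + (anchor U q).act φ • p
  pairing_bracket : ∀ {U : Opens X} (q p r : M.Sec U),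
    pairing U (bracket U q p) r + pairing U p (bracket U q r) = (anchor U q).act (pairing U p r)
  bracket_coanchor : ∀ {U : Opens X} (q : M.Sec U) (α : Form X 1 U),
    bracket U q (coanchor U α) = coanchor U (Form.lie (anchor U q) α)
  pairing_coanchor : ∀ {U : Opens X} (q : M.Sec U) (α : Form X 1 U),
    pairing U q (coanchor U α) = α.ap (anchor U q)
  bracket_symm : ∀ {U : Opens X} (q p : M.Sec U),
    bracket U q p + bracket U p q = coanchor U (Form.d (pairing U q p))

/-- Morphisms of sheaves of modules `𝒯_X → M` on the open set `U`. -/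
structure TMap {X : Mfd.{u, v} 𝕜 K n} (M : SMod.{u, v, w} X) (U : Opens X) where
  toFun : ∀ V : Opens X, V ≤ U → VField X V →ₗ[X.O V] M.Sec V
  natural : ∀ (V W : Opens X) (h : V ≤ U) (h' : W ≤ V) (ξ : VField X V),
    toFun W (h'.trans h) (VField.res h' ξ) = M.res h' (toFun V h ξ)

namespace CourantStr

variable {X : Mfd.{u, v} 𝕜 K n} {M : SMod.{u, v, w} X} (Q : CourantStr M)

/-- `D` is a connection on the restriction of the Courant algebroid to `U`: a splitting of the
anchor which is isotropic for the symmetric pairing. -/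
def IsConnection {U : Opens X} (D : TMap M U) : Prop :=
  (∀ (V : Opens X) (h : V ≤ U) (ξ : VField X V), Q.anchor V (D.toFun V h ξ) = ξ) ∧
    ∀ (V : Opens X) (h : V ≤ U) (ξ η : VField X V),
      Q.pairing V (D.toFun V h ξ) (D.toFun V h η) = 0

/-- The Courant algebroid is exact: `0 → Ω¹_X → M → 𝒯_X → 0` is an exact sequence of sheaves. -/
def IsExact : Prop :=
  (∀ U : Opens X, Function.Injective (Q.coanchor U)) ∧
  (∀ (U : Opens X) (q : M.Sec U), Q.anchor U q = 0 → ∀ x ∈ U,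
    ∃ (V : Opens X) (h : V ≤ U) (α : Form X 1 V), x ∈ V ∧ M.res h q = Q.coanchor V α) ∧
  ∀ (U : Opens X) (ξ : VField X U), ∀ x ∈ U,
    ∃ (V : Opens X) (h : V ≤ U) (q : M.Sec V), x ∈ V ∧ Q.anchor V q = VField.res h ξ

/-- The `3`-form `H` is the curvature of `D`:
`[D ξ, D η] - D [ξ, η] = π†(H(ξ, η, ·))` for all local vector fields `ξ`, `η`. -/
def IsCurvature {U : Opens X} (D : TMap M U) (H : Form X 3 U) : Prop :=
  ∀ (V : Opens X) (h : V ≤ U) (ξ η : VField X V),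
    Q.bracket V (D.toFun V h ξ) (D.toFun V h η) - D.toFun V h ⁅ξ, η⁆ =
      Q.coanchor V ((Form.res h H).contract ξ η)

end CourantStr

/-- Maps of manifolds. -/
abbrev Mfd.Hom (Y : Mfd.{w₁, w₂} 𝕜 K n) (X : Mfd.{u, v} 𝕜 K n) : Type _ :=
  ContMDiffMap 𝓘(𝕜, Y.E) 𝓘(𝕜, X.E) Y X n

namespace InverseImage

open Mfd PMod

variable {Y : Mfd.{w₁, w₂} 𝕜 K n} {X : Mfd.{u, v} 𝕜 K n} (f : Y.Hom X)

/-- The preimage of an open set. -/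
def pre (U : Opens X) : Opens Y := ⟨f ⁻¹' U, U.isOpen.preimage f.contMDiff.continuous⟩

variable {f} in
theorem mem_of {U : Opens X} {V : Opens Y} (h : V ≤ pre f U) {y : Y} (hy : y ∈ V) : f y ∈ U := h hy

/-- The pull-back of functions, restricted to an open subset of the preimage. -/
def pull {U : Opens X} {V : Opens Y} (h : V ≤ pre f U) : X.O U →ₐ[K] Y.O V where
  toFun φ := ⟨fun y => φ.1 ⟨f y.1, h y.2⟩, fun y => by
    have h1 : ContMDiffAt 𝓘(𝕜, Y.E) 𝓘(𝕜, K) n (fun y : Y => extend φ (f y)) y.1 :=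
      (contMDiffAt_extend φ (h y.2)).comp _ (f.contMDiff _)
    have h2 : (fun y : V => φ.1 ⟨f y.1, h y.2⟩) = fun y : V => extend φ (f y.1) :=
      funext fun y => (extend_coe φ ⟨f y.1, h y.2⟩).symm
    rw [h2]
    exact contMDiffAt_subtype_iff.2 h1⟩
  map_one' := rfl
  map_mul' _ _ := rfl
  map_zero' := rfl
  map_add' _ _ := rfl
  commutes' _ := rfl

theorem pull_res {U U' : Opens X} {V : Opens Y} (h : V ≤ pre f U') (hU : U' ≤ U) (φ : X.O U) :
    pull f h (X.resO hU φ) = pull f (h.trans fun _ hy => hU hy) φ := rfl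

/-- The pull-back on germs of functions. -/
def pullGerm (y : Y) : X.OGerm (f y) →+* Y.OGerm y where
  toFun := lift (P := unit X) (fun U hU φ => og (U := pre f U) y hU (pull f le_rfl φ))
    (fun _ _ h hx φ => og_res y (V := pre f _) (fun _ hy => h hy) hx (pull f le_rfl φ))
  map_one' := og_one _
  map_zero' := og_zero _
  map_add' a b := by
    obtain ⟨U, hU, s, t, rfl, rfl⟩ := og_surj₂ a b
    rw [← og_add]
    exact (congrArg (og (U := pre f U) y hU) (map_add (pull f le_rfl) s t)).trans (og_add _ _ _)
  map_mul' a b := by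
    obtain ⟨U, hU, s, t, rfl, rfl⟩ := og_surj₂ a b
    rw [← og_mul]
    exact (congrArg (og (U := pre f U) y hU) (map_mul (pull f le_rfl) s t)).trans (og_mul _ _ _)

instance (y : Y) : Algebra (X.OGerm (f y)) (Y.OGerm y) := (pullGerm f y).toAlgebra

/-- For a vector field `ξ` on `W`, functions `hᵢ` on `W` and vector fields `vᵢ` on `U`, the
equality `df(ξ) = ∑ᵢ hᵢ ⊗ vᵢ` of sections of `f^*𝒯_X`, i.e. `ξ(φ ∘ f) = ∑ᵢ hᵢ · (vᵢ(φ) ∘ f)`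
for all local functions `φ`. -/
def DfEq {W : Opens Y} {U : Opens X} {ι : Type} [Fintype ι]
    (ξ : VField Y W) (h : ι → Y.O W) (v : ι → VField X U) : Prop :=
  ∀ (U' : Opens X) (hU : U' ≤ U) (W' : Opens Y) (hW : W' ≤ W) (hf : W' ≤ pre f U') (φ : X.O U'),
    ξ.toFun W' hW (pull f hf φ) =
      ∑ i, Y.resO hW (h i) * pull f hf ((v i).toFun U' hU φ)

/-- The form `H'` on `V` is the pull-back of the form `H` on `U` under `f`, where `f(V) ⊆ U`:
if `df(ξ_a) = ∑ᵢ h_{a,i} ⊗ v_{a,i}` for `a = 1, …, k`, then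
`H'(ξ₁, …, ξ_k) = ∑ h_{1,i₁} ⋯ h_{k,i_k} · (H(v_{1,i₁}, …, v_{k,i_k}) ∘ f)`. -/
def IsPullback {k : ℕ} {U : Opens X} {V : Opens Y} (H : Form X k U) (H' : Form Y k V) : Prop :=
  ∀ (W : Opens Y) (hW : W ≤ V) (U' : Opens X) (hU : U' ≤ U) (hf : W ≤ pre f U') (m : ℕ)
    (ξ : Fin k → VField Y W) (h : Fin k → Fin m → Y.O W) (v : Fin k → Fin m → VField X U'),
    (∀ a, DfEq f (ξ a) (h a) (v a)) →
      H'.toFun W hW ξ =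
        ∑ I : Fin k → Fin m, (∏ a, h a (I a)) * pull f hf (H.toFun U' hU fun a => v a (I a))

variable {M : SMod.{u, v, w} X} (Q : CourantStr M)

/-- The stalk at `y` of `Ω¹_Y ⊕ f^*M`. -/
abbrev PreStalk (M : SMod.{u, v, w} X) (y : Y) : Type _ :=
  (forms Y 1).Germ y × (Y.OGerm y ⊗[X.OGerm (f y)] M.Germ (f y))

/-- The image of `f^*Ω¹_X` in the stalk of `Ω¹_Y ⊕ f^*M` under `γ ↦ (df^∨(γ), -π†(γ))`. -/
def relations (y : Y) : Submodule (Y.OGerm y) (PreStalk f M y) :=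
  Submodule.span _ {p | ∃ (U : Opens X) (hU : f y ∈ U) (V : Opens Y) (hV : y ∈ V)
    (γ : Form X 1 U) (γ' : Form Y 1 V), V ≤ pre f U ∧ IsPullback f γ γ' ∧
      p = (gm (P := forms Y 1) y hV γ',
        -((1 : Y.OGerm y) ⊗ₜ gm (P := M.toPMod) (f y) hU (Q.coanchor U γ)))}

/-- The stalk at `y` of `(Ω¹_Y ⊕ f^*M) / f^*Ω¹_X ⊕ 𝒯_Y`. -/
abbrev Stalk (y : Y) : Type _ :=
  (PreStalk f M y ⧸ relations f Q y) × (tangent Y).Germ y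

/-- Representatives `(α, ∑ᵢ hᵢ ⊗ qᵢ)` of local sections of `Ω¹_Y ⊕ f^*M`, where `α` and `hᵢ` are
defined on `W` and `qᵢ` are sections of `M` on `U`. -/
structure Rep (M : SMod.{u, v, w} X) (W : Opens Y) (U : Opens X) where
  α : Form Y 1 W
  ι : Type
  [fin : Fintype ι]
  h : ι → Y.O W
  q : ι → M.Sec U

attribute [instance] Rep.fin

namespace Rep

variable {f Q} {W : Opens Y} {U : Opens X}

/-- The class of a representative in the stalk at `y`. -/
noncomputable def cls (Q : CourantStr M) (r : Rep M W U) (hf : W ≤ pre f U) (y : W) :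
    PreStalk f M y.1 ⧸ relations f Q y.1 :=
  Submodule.Quotient.mk (gm (P := forms Y 1) y.1 y.2 r.α,
    ∑ i, og y.1 y.2 (r.h i) ⊗ₜ gm (P := M.toPMod) (f y.1) (mem_of hf y.2) (r.q i))

/-- The family `s` of elements of stalks is given by the triple `(α, ∑ᵢ hᵢ ⊗ qᵢ, ξ)`, which
is a section of `Ω¹_Y ⊕ f^*M ×_{f^*𝒯_X} 𝒯_Y`, i.e. `df(ξ) = ∑ᵢ hᵢ ⊗ π(qᵢ)`. -/
def Represents (r : Rep M W U) (hf : W ≤ pre f U) (ξ : VField Y W)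
    (s : ∀ y : W, Stalk f Q y.1) : Prop :=
  DfEq f ξ r.h (fun i => Q.anchor U (r.q i)) ∧
    ∀ y : W, s y = (r.cls Q hf y, gm (P := tangent Y) y.1 y.2 ξ)

/-- The pairing of `(α, ∑ᵢ hᵢ ⊗ qᵢ, ξ)` with `(β, ∑ⱼ gⱼ ⊗ pⱼ, η)`. -/
noncomputable def pair (Q : CourantStr M) (hf : W ≤ pre f U) (r : Rep M W U) (ξ : VField Y W)
    (r' : Rep M W U) (η : VField Y W) : Y.O W :=
  (∑ i, ∑ j, r.h i * r'.h j * pull f hf (Q.pairing U (r.q i) (r'.q j))) +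
    r'.α.ap ξ + r.α.ap η

/-- The first two components of the bracket of `(α, ∑ᵢ hᵢ ⊗ qᵢ, ξ)` and `(β, ∑ⱼ gⱼ ⊗ pⱼ, η)`:
`-ι_η dα + L_ξ β + ∑ᵢⱼ gⱼ ⟨qᵢ, pⱼ⟩ dhᵢ` and
`∑ᵢⱼ hᵢ gⱼ ⊗ [qᵢ, pⱼ] - ∑ᵢ η(hᵢ) ⊗ qᵢ + ∑ⱼ ξ(gⱼ) ⊗ pⱼ`. -/
noncomputable def bracket (Q : CourantStr M) (hf : W ≤ pre f U) (r : Rep M W U) (ξ : VField Y W)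
    (r' : Rep M W U) (η : VField Y W) : Rep M W U where
  α := -Form.iotaD η r.α + Form.lie ξ r'.α +
    ∑ i, ∑ j, (r'.h j * pull f hf (Q.pairing U (r.q i) (r'.q j))) • Form.d (r.h i)
  ι := (r.ι × r'.ι) ⊕ (r.ι ⊕ r'.ι)
  h := Sum.elim (fun a => r.h a.1 * r'.h a.2)
    (Sum.elim (fun i => -η.act (r.h i)) (fun j => ξ.act (r'.h j)))
  q := Sum.elim (fun a => Q.bracket U (r.q a.1) (r'.q a.2)) (Sum.elim r.q r'.q)

end Rep

namespace Rep

variable {f Q} {W W' : Opens Y} {U U' : Opens X}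

/-- Restriction of representatives. -/
def res (hW : W' ≤ W) (hU : U' ≤ U) (r : Rep M W U) : Rep M W' U' where
  α := Form.res hW r.α
  ι := r.ι
  h i := Y.resO hW (r.h i)
  q i := M.res hU (r.q i)

/-- Sum of representatives. -/
def add (r r' : Rep M W U) : Rep M W U where
  α := r.α + r'.α
  ι := r.ι ⊕ r'.ι
  h := Sum.elim r.h r'.h
  q := Sum.elim r.q r'.q

/-- Multiple of a representative. -/
def smul (φ : Y.O W) (r : Rep M W U) : Rep M W U where
  α := φ • r.α
  ι := r.ι
  h i := φ * r.h i
  q := r.q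

theorem Represents.res {hf : W ≤ pre f U} {r : Rep M W U} {ξ : VField Y W}
    {s : ∀ y : W, Stalk f Q y.1} (H : r.Represents hf ξ s) (hW : W' ≤ W) (hU : U' ≤ U)
    (hf' : W' ≤ pre f U') :
    (r.res hW hU).Represents hf' (VField.res hW ξ) (fun y => s ⟨y.1, hW y.2⟩) := by
  refine ⟨fun U'' hU'' W'' hW'' hf'' φ => ?_, fun y => ?_⟩
  · refine (H.1 U'' (hU''.trans hU) W'' (hW''.trans hW) hf'' φ).trans
      (Finset.sum_congr rfl fun i _ => ?_)
    change _ = _ * pull f hf'' ((Q.anchor U' (M.res hU (r.q i))).toFun U'' hU'' φ)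
    rw [← Q.res_anchor]
    rfl
  · beta_reduce
    rw [H.2]
    refine Prod.ext (congrArg Submodule.Quotient.mk (Prod.ext ?_ ?_)) ?_
    · exact (gm_res (P := forms Y 1) y.1 hW y.2 r.α).symm
    · refine Finset.sum_congr rfl fun i _ => ?_
      change _ = og y.1 y.2 (Y.resO hW (r.h i)) ⊗ₜ
        gm (P := M.toPMod) (f y.1) (mem_of hf' y.2) (M.res hU (r.q i))
      rw [og_res, gm_res]
    · exact (gm_res (P := tangent Y) y.1 hW y.2 ξ).symm

theorem Represents.add {hf : W ≤ pre f U} {r r' : Rep M W U} {ξ ξ' : VField Y W}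
    {s s' : ∀ y : W, Stalk f Q y.1} (H : r.Represents hf ξ s) (H' : r'.Represents hf ξ' s') :
    (r.add r').Represents hf (ξ + ξ') (fun y => s y + s' y) := by
  refine ⟨fun U'' hU'' W'' hW'' hf'' φ => ?_, fun y => ?_⟩
  · refine Eq.trans ?_ (Fintype.sum_sum_type _).symm
    rw [VField.add_apply, H.1 U'' hU'' W'' hW'' hf'', H'.1 U'' hU'' W'' hW'' hf'']
    rfl
  · beta_reduce
    rw [H.2, H'.2]
    refine Prod.ext (congrArg Submodule.Quotient.mk (Prod.ext ?_ ?_)) ?_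
    · exact (gm_add (P := forms Y 1) y.2 r.α r'.α).symm
    · exact (Fintype.sum_sum_type (fun i => og y.1 y.2 ((r.add r').h i) ⊗ₜ
        gm (P := M.toPMod) (f y.1) (mem_of hf y.2) ((r.add r').q i))).symm
    · exact (gm_add (P := tangent Y) y.2 ξ ξ').symm

theorem Represents.smul {hf : W ≤ pre f U} {r : Rep M W U} {ξ : VField Y W}
    {s : ∀ y : W, Stalk f Q y.1} (H : r.Represents hf ξ s) (ψ : Y.O W) :
    (r.smul ψ).Represents hf (ψ • ξ) (fun y => og y.1 y.2 ψ • s y) := by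
  refine ⟨fun U'' hU'' W'' hW'' hf'' φ => ?_, fun y => ?_⟩
  · rw [VField.smul_apply, H.1 U'' hU'' W'' hW'' hf'', Finset.mul_sum]
    refine Finset.sum_congr rfl fun i _ => ?_
    change _ = Y.resO hW'' (ψ * r.h i) * _
    rw [map_mul, mul_assoc]
    rfl
  · beta_reduce
    rw [H.2]
    refine Prod.ext (congrArg Submodule.Quotient.mk (Prod.ext ?_ ?_)) ?_
    · exact (gm_smul (P := forms Y 1) y.2 ψ r.α).symm
    · refine Finset.smul_sum.trans (Finset.sum_congr rfl fun i _ => ?_)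
      change _ = og y.1 y.2 (ψ * r.h i) ⊗ₜ gm (P := M.toPMod) (f y.1) (mem_of hf y.2) (r.q i)
      rw [og_mul, TensorProduct.smul_tmul']
      rfl
    · exact (gm_smul (P := tangent Y) y.2 ψ ξ).symm

end Rep

/-- Families of elements of the stalks over `V`. -/
def Fam (V : Opens Y) : Type _ := ∀ y : V, Stalk f Q y.1

instance (V : Opens Y) : AddCommGroup (Fam f Q V) :=
  inferInstanceAs (AddCommGroup (∀ y : V, Stalk f Q y.1))

instance (V : Opens Y) : Module (Y.O V) (Fam f Q V) where
  smul φ s := fun y => og y.1 y.2 φ • s y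
  one_smul s := funext fun y => by
    change og y.1 y.2 1 • s y = s y
    rw [og_one, one_smul]
  mul_smul a b s := funext fun y => by
    change og y.1 y.2 (a * b) • s y = og y.1 y.2 a • og y.1 y.2 b • s y
    rw [og_mul, mul_smul]
  smul_zero a := funext fun y => smul_zero (og y.1 y.2 a)
  zero_smul s := funext fun y => by
    change og y.1 y.2 0 • s y = 0
    rw [og_zero, zero_smul]
  smul_add a s t := funext fun y => smul_add (og y.1 y.2 a) (s y) (t y)
  add_smul a b s := funext fun y => by
    change og y.1 y.2 (a + b) • s y = og y.1 y.2 a • s y + og y.1 y.2 b • s y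
    rw [og_add, add_smul]

theorem fam_smul {V : Opens Y} (φ : Y.O V) (s : Fam f Q V) (y : V) :
    (φ • s) y = og y.1 y.2 φ • s y := rfl

/-- Sections over `V` of `f^{++}M = (Ω¹_Y ⊕ f^*M ×_{f^*𝒯_X} 𝒯_Y) / f^*Ω¹_X`: families of elements
of stalks which are locally given by sections of `Ω¹_Y ⊕ f^*M ×_{f^*𝒯_X} 𝒯_Y`. -/
def sections (V : Opens Y) : Submodule (Y.O V) (Fam f Q V) where
  carrier := {s | ∀ y ∈ V, ∃ (W : Opens Y) (hW : W ≤ V) (U : Opens X) (hf : W ≤ pre f U)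
    (r : Rep M W U) (ξ : VField Y W), y ∈ W ∧ r.Represents hf ξ fun z => s ⟨z.1, hW z.2⟩}
  zero_mem' y hy := ⟨V, le_rfl, ⊤, fun _ _ => trivial, ⟨0, Empty, Empty.elim, Empty.elim⟩, 0, hy,
    fun U' hU W' hW hf φ => by simp, fun z => by
      refine Prod.ext ?_ (gm_zero (P := tangent Y) z.2).symm
      refine (Submodule.Quotient.mk_zero _).symm.trans
        (congrArg Submodule.Quotient.mk (Prod.ext ?_ ?_))
      · exact (gm_zero (P := forms Y 1) z.2).symm
      · simp⟩
  add_mem' := fun {s t} hs ht y hy => by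
    obtain ⟨W, hW, U, hf, r, ξ, hyW, H⟩ := hs y hy
    obtain ⟨W', hW', U', hf', r', ξ', hyW', H'⟩ := ht y hy
    have h1 : W ⊓ W' ≤ pre f (U ⊓ U') := fun z hz => ⟨hf hz.1, hf' hz.2⟩
    exact ⟨W ⊓ W', inf_le_left.trans hW, U ⊓ U', h1, _, _, ⟨hyW, hyW'⟩,
      (H.res inf_le_left inf_le_left h1).add (H'.res inf_le_right inf_le_right h1)⟩
  smul_mem' := fun φ {s} hs y hy => by
    obtain ⟨W, hW, U, hf, r, ξ, hyW, H⟩ := hs y hy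
    refine ⟨W, hW, U, hf, r.smul (Y.resO hW φ), Y.resO hW φ • ξ, hyW, ?_⟩
    convert H.smul (Y.resO hW φ) using 2 with z
    rw [og_res, fam_smul]

end InverseImage

open InverseImage in
/-- The sheaf of `𝒪_Y`-modules `f^{++}M = (Ω¹_Y ⊕ f^*M ×_{f^*𝒯_X} 𝒯_Y) / f^*Ω¹_X` underlying the
inverse image of the Courant algebroid `(M, Q)`. -/
def inverseImage {Y : Mfd.{w₁, w₂} 𝕜 K n} {X : Mfd.{u, v} 𝕜 K n} (f : Y.Hom X)
    {M : SMod.{u, v, w} X} (Q : CourantStr M) : SMod.{w₁, w₂, max u w w₁} Y where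
  Sec V := sections f Q V
  res {V V'} h :=
    { toFun := fun s => ⟨fun y => s.1 ⟨y.1, h y.2⟩, fun y hy => by
        obtain ⟨W, hW, U, hf, r, ξ, hyW, H⟩ := s.2 y (h hy)
        exact ⟨W ⊓ V', inf_le_right, U, inf_le_left.trans hf, _, _, ⟨hyW, hy⟩,
          H.res inf_le_left le_rfl _⟩⟩
      map_zero' := rfl
      map_add' := fun _ _ => rfl }
  res_self _ := rfl
  res_res _ _ _ := rfl
  res_smul h φ s := Subtype.ext (funext fun y => by
    refine (fam_smul f Q φ s.1 ⟨y.1, h y.2⟩).trans ?_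
    refine Eq.trans ?_ (fam_smul f Q (Y.resO h φ) (fun y => s.1 ⟨y.1, h y.2⟩) y).symm
    rw [Mfd.og_res])
  locality s t H := Subtype.ext (funext fun y => by
    obtain ⟨V, h, hy, e⟩ := H y.1 y.2
    exact congrFun (congrArg Subtype.val e) ⟨y.1, hy⟩)
  gluing {U} V hV hx s H := by
    have key : ∀ (x y : U) (hy : y.1 ∈ V x),
        (s y).1 ⟨y.1, hx y⟩ = (s x).1 ⟨y.1, hy⟩ := fun x y hy =>
      congrFun (congrArg Subtype.val (H y x)) ⟨y.1, ⟨hx y, hy⟩⟩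
    refine ⟨⟨fun y => (s y).1 ⟨y.1, hx y⟩, fun y hy => ?_⟩, fun x => ?_⟩
    · obtain ⟨W, hW, U', hf, r, ξ, hyW, H'⟩ := (s ⟨y, hy⟩).2 y (hx ⟨y, hy⟩)
      refine ⟨W, hW.trans (hV _), U', hf, r, ξ, hyW, ?_⟩
      convert H' using 2 with z
      exact key _ _ _
    · exact Subtype.ext (funext fun y => key x _ y.2)

namespace InverseImage

variable {Y : Mfd.{w₁, w₂} 𝕜 K n} {X : Mfd.{u, v} 𝕜 K n} (f : Y.Hom X)
  {M : SMod.{u, v, w} X} (Q : CourantStr M)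

/-- `P` is the Courant algebroid structure of the inverse image `f^{++}(M, Q)`: on local sections
represented by triples `(α, ∑ᵢ hᵢ ⊗ qᵢ, ξ)` and `(β, ∑ⱼ gⱼ ⊗ pⱼ, η)`,
* the bracket is represented by `(-ι_η dα + L_ξ β + ∑ᵢⱼ gⱼ ⟨qᵢ, pⱼ⟩ dhᵢ,
  ∑ᵢⱼ hᵢ gⱼ ⊗ [qᵢ, pⱼ] - ∑ᵢ η(hᵢ) ⊗ qᵢ + ∑ⱼ ξ(gⱼ) ⊗ pⱼ, [ξ, η])`;
* the pairing is `∑ᵢⱼ hᵢ gⱼ ⟨qᵢ, pⱼ⟩ + β(ξ) + α(η)`;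
* the anchor is the projection to `ξ`;
* the co-anchor sends `α` to the class of `(α, 0, 0)`. -/
structure IsInverseImage (P : CourantStr (inverseImage f Q)) : Prop where
  bracket_eq : ∀ (W : Opens Y) (U : Opens X) (hf : W ≤ pre f U) (r r' : Rep M W U)
    (ξ η : VField Y W) (s t : (inverseImage f Q).Sec W),
    r.Represents hf ξ s.1 → r'.Represents hf η t.1 →
      (r.bracket Q hf ξ r' η).Represents hf ⁅ξ, η⁆ (P.bracket W s t).1
  pairing_eq : ∀ (W : Opens Y) (U : Opens X) (hf : W ≤ pre f U) (r r' : Rep M W U)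
    (ξ η : VField Y W) (s t : (inverseImage f Q).Sec W),
    r.Represents hf ξ s.1 → r'.Represents hf η t.1 →
      P.pairing W s t = Rep.pair Q hf r ξ r' η
  anchor_eq : ∀ (W : Opens Y) (U : Opens X) (hf : W ≤ pre f U) (r : Rep M W U)
    (ξ : VField Y W) (s : (inverseImage f Q).Sec W),
    r.Represents hf ξ s.1 → P.anchor W s = ξ
  coanchor_eq : ∀ (W : Opens Y) (U : Opens X) (hf : W ≤ pre f U) (α : Form Y 1 W),
    (⟨α, Empty, Empty.elim, Empty.elim⟩ : Rep M W U).Represents hf 0 (P.coanchor W α).1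

/-- `D'` is the map `f^{++}(D)` induced by a splitting `D` of the anchor of `Q`: if
`df(ξ) = ∑ᵢ hᵢ ⊗ vᵢ` then `D'(ξ)` is the class of `(0, ∑ᵢ hᵢ ⊗ D(vᵢ), ξ)`. -/
def IsInducedMap {U : Opens X} (D : TMap M U) (D' : TMap (inverseImage f Q) (pre f U)) : Prop :=
  ∀ (W : Opens Y) (hW : W ≤ pre f U) (U' : Opens X) (hU : U' ≤ U) (hf : W ≤ pre f U') (m : ℕ)
    (ξ : VField Y W) (h : Fin m → Y.O W) (v : Fin m → VField X U'), DfEq f ξ h v →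
      (⟨0, Fin m, h, fun i => D.toFun U' hU (v i)⟩ : Rep M W U').Represents hf ξ
        (D'.toFun W hW ξ).1

end InverseImage

end Main

/-! A section of `f^{++}M` is a family of stalk elements given locally by triples (α, ∑ hᵢ⊗qᵢ, ξ)
with df(ξ) = ∑ hᵢ⊗π(qᵢ). So every operation is computed on triples, shown to depend only on the
class in each stalk, and glued. The axioms are local, hence become identities between triples.

Two facts make the stalks tractable. The tangency condition on vector fields gives the chain rule
(`act_pull_eq_sum`), so near each point df(ξ) = ∑ ξ(xₖ∘f)⊗∂ₖ (`DfEq_coord`). And γ = ∑ γ(∂ₖ)dxₖ in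
coordinates, so the relations are generated by the pairs (d(ψ∘f), -1⊗π†dψ) (`relations_le_span`). An
additive map on Ω¹_Y ⊕ f^*M thus descends once it is balanced over germs on X and kills the
multiples of these pairs (`exists_lift`).

For the bracket with a fixed second triple (β, ∑ gⱼ⊗pⱼ, η) this applies because [φq,p] = φ[q,p] -
π(p)(φ)q + ⟨q,p⟩π†dφ in Q: the two error terms are what the summands -η(h)⊗q and g⟨q,p⟩dh of the
formula absorb, once df(η) = ∑ gⱼ⊗π(pⱼ). The relations die because [π†dψ,p] = 0 and ⟨π†dψ,p⟩ =
π(p)ψ. The second argument needs no separate computation: [s,t] + [t,s] is the co-anchor of d⟨s,t⟩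
already for triples, and the pairing is well defined (`bracket_pair_congr`). The hard axiom is the
Leibniz identity. Its terms are sorted by the tensor factors they involve; the groups match up to
sums of π(r)⟨q,p⟩-terms (`anchorSum`), which cancel overall (`fst_jacobi`).

If Q is exact, choose local lifts eₖ of ∂ₖ. Then (α, h⊗m) ↦ α + ∑ h f^*⟨m,eₖ⟩ d(xₖ∘f) retracts the
co-anchor on stalks, which gives injectivity. Expanding the qᵢ in the eₖ modulo π† gives exactness
in the middle. Lifting DfEq_coord through the eₖ gives surjectivity.

A splitting D induces D'(ξ) = (0, ∑ ξ(xₖ∘f)⊗D∂ₖ, ξ), which does not depend on how df(ξ) is written,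
since D is linear (`sum_smul_tau_eq`). The curvature of a connection is the form ⟨[Dξ,Dη],Dζ⟩:
isotropy makes it alternating, hence tensorial, since linearity in ζ is evident, and exactness
identifies it with [Dξ,Dη] - D[ξ,η]. It is closed by the Leibniz identity and invariance of the
pairing. For D' the bracket and pairing formulas collapse by isotropy to ∑ hᵢhⱼhₗ
f^*⟨[Dvᵢ,Dvⱼ],Dvₗ⟩, which is the pull-back of the form for D (`isPullback_curvature`). -/

section Geometry

variable {𝕜 K : Type} [RCLike 𝕜] [RCLike K] [NormedAlgebra 𝕜 K] {n : WithTop ℕ∞}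
  [Fact (n = ∞ ∨ n = ω)]

/-! ### Change of charts and coordinate vector fields. -/

namespace Mfd

variable {X : Mfd.{u, v} 𝕜 K n}

theorem ne_zero_of_fact : n ≠ 0 := by
  have := one_le (n := n)
  positivity

/-- Changing charts: the differential in one chart vanishes if it does in another one. -/
theorem fderiv_written_eq_zero (p p' : X) {V : Opens X} (φ : X.O V) (x : V)
    (hp : x.1 ∈ chartDom p) (hp' : x.1 ∈ chartDom p')
    (h : fderiv 𝕜 (written p φ) (chartAt X.E p x) = 0) :
    fderiv 𝕜 (written p' φ) (chartAt X.E p' x) = 0 := by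
  have h2 : ContMDiffAt 𝓘(𝕜, X.E) 𝓘(𝕜, X.E) n (chartAt X.E p').symm (chartAt X.E p' x) :=
    (contMDiffOn_chart_symm (I := 𝓘(𝕜, X.E)) (x := p')).contMDiffAt
      ((chartAt X.E p').open_target.mem_nhds ((chartAt X.E p').map_source hp'))
  have h3 : ContMDiffAt 𝓘(𝕜, X.E) 𝓘(𝕜, X.E) n (chartAt X.E p) x.1 :=
    (contMDiffOn_chart (I := 𝓘(𝕜, X.E)) (x := p)).contMDiffAt
      ((chartDom p).isOpen.mem_nhds hp)
  have h4 : ContMDiffAt 𝓘(𝕜, X.E) 𝓘(𝕜, X.E) n (chartAt X.E p ∘ (chartAt X.E p').symm)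
      (chartAt X.E p' x) := by
    refine ContMDiffAt.comp _ ?_ h2
    rwa [(chartAt X.E p').left_inv hp']
  have h5 := (contMDiffAt_iff_contDiffAt.1 h4).differentiableAt (ne_zero_of_fact (n := n))
  have h6 : written p' φ =ᶠ[nhds (chartAt X.E p' x)]
      written p φ ∘ (chartAt X.E p ∘ (chartAt X.E p').symm) := by
    filter_upwards [mem_nhds_symm p' hp' hp] with e he
    simp only [written, Function.comp]
    rw [(chartAt X.E p).left_inv he]
  have h7 : (chartAt X.E p ∘ (chartAt X.E p').symm) (chartAt X.E p' x) = chartAt X.E p x := by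
    rw [Function.comp, (chartAt X.E p').left_inv hp']
  have h8 : DifferentiableAt 𝕜 (written p φ)
      ((chartAt X.E p ∘ (chartAt X.E p').symm) (chartAt X.E p' x)) := by
    rw [h7]
    exact (contDiffAt_written p φ x.2 hp).differentiableAt (ne_zero_of_fact (n := n))
  rw [h6.fderiv_eq, fderiv_comp _ h8 h5, h7, h, ContinuousLinearMap.zero_comp]

theorem fderiv_written_eq_zero_of_pd (p : X) {V : Opens X} (hV : V ≤ chartDom p) (φ : X.O V)
    (x : V) (h : ∀ i, (pd p i V hV φ).1 x = 0) :
    fderiv 𝕜 (written p φ) (chartAt X.E p x) = 0 := by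
  apply ContinuousLinearMap.coe_injective
  exact (Module.finBasis 𝕜 X.E).ext fun j => h j

/-- `pd_eq_zero` covers only the centre of a chart. At another point x it is applied in the chart
centred at x, and the vanishing is carried back to the chart at p by a change of charts. This is the
tangency condition needed for `coordField`. -/
theorem pd_eq_zero_of_mfderiv (p : X) (i : X.Idx) {V : Opens X} (hV : V ≤ chartDom p) (φ : X.O V)
    (x : V) (h0 : mfderiv 𝓘(𝕜, X.E) 𝓘(𝕜, K) φ.1 x = 0) : (pd p i V hV φ).1 x = 0 := by
  obtain ⟨x, hx⟩ := x
  let W := V ⊓ chartDom x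
  have hWV : W ≤ V := inf_le_left
  have hxW : x ∈ W := ⟨hx, mem_chartDom x⟩
  have h1 : mfderiv 𝓘(𝕜, X.E) 𝓘(𝕜, K) (X.resO hWV φ).1 ⟨x, hxW⟩ = 0 := by
    have : (X.resO hWV φ).1 = φ.1 ∘ TopologicalSpace.Opens.inclusion hWV := rfl
    rw [this, mfderiv_comp (I' := 𝓘(𝕜, X.E))]
    · erw [h0]; exact ContinuousLinearMap.zero_comp _
    · exact φ.2.mdifferentiable (ne_zero_of_fact (n := n)) _
    · exact (contMDiff_inclusion (n := 1) hWV).mdifferentiable (by simp) _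
  have h2 := fderiv_written_eq_zero_of_pd x (inf_le_right : W ≤ _) (X.resO hWV φ) ⟨x, hxW⟩
    fun i => pd_eq_zero x i _ _ hxW h1
  have h3 := fderiv_written_eq_zero x p (X.resO hWV φ) ⟨x, hxW⟩ (mem_chartDom x) (hV hx) h2
  have h4 : (pd p i W (hWV.trans hV) (X.resO hWV φ)).1 ⟨x, hxW⟩ = 0 := by
    rw [pd_apply, h3]; rfl
  rwa [pd_res p i hV hWV] at h4

/-- The coordinate vector fields of the standard chart at `p`. -/
noncomputable def coordField (p : X) (i : X.Idx) : VField X (chartDom p) where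
  toFun V h := pd p i V h
  leibniz V h := pd_mul p i h
  natural V W h h' := pd_res p i h h'
  tangent V h φ x := pd_eq_zero_of_mfderiv p i h φ x

end Mfd

open Mfd

/-! ### The Lie algebra of vector fields and local frames. -/

namespace VField

variable {X : Mfd.{u, v} 𝕜 K n} {U : Opens X}

theorem res_smul {V : Opens X} (h : V ≤ U) (φ : X.O U) (ξ : VField X U) :
    VField.res h (φ • ξ) = X.resO h φ • VField.res h ξ := rfl

theorem sum_toFun {ι : Type*} (s : Finset ι) (ξ : ι → VField X U) (V : Opens X) (h : V ≤ U)
    (φ : X.O V) : (∑ i ∈ s, ξ i).toFun V h φ = ∑ i ∈ s, (ξ i).toFun V h φ :=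
  map_sum (⟨⟨fun ξ : VField X U => ξ.toFun V h φ, rfl⟩, fun _ _ => rfl⟩ : VField X U →+ X.O V) ξ s

theorem eq_sum_coordField (p : X) (hU : U ≤ chartDom p) (ξ : VField X U) :
    ξ = ∑ i, ξ.act (X.resO hU (coord p i)) • VField.res hU (coordField p i) := by
  refine ext fun V hV φ => ?_
  rw [act_eq_sum ξ p hV (hV.trans hU), sum_toFun]
  refine Finset.sum_congr rfl fun i _ => ?_
  have := ξ.natural U V le_rfl hV (X.resO hU (coord p i))
  rw [smul_apply]
  exact congrArg (· * _) this

theorem locality {ξ η : VField X U}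
    (h : ∀ x ∈ U, ∃ (V : Opens X) (hV : V ≤ U), x ∈ V ∧ VField.res hV ξ = VField.res hV η) :
    ξ = η := by
  refine ext fun V hV φ => X.O_ext fun x => ?_
  obtain ⟨W, hW, hx, e⟩ := h x.1 (hV x.2)
  have h1 := ξ.natural V (V ⊓ W) hV inf_le_left φ
  have h2 := η.natural V (V ⊓ W) hV inf_le_left φ
  have h3 : ξ.toFun (V ⊓ W) (inf_le_left.trans hV) (X.resO inf_le_left φ) =
      η.toFun (V ⊓ W) (inf_le_left.trans hV) (X.resO inf_le_left φ) :=
    congrArg (fun ζ : VField X W => ζ.toFun (V ⊓ W) inf_le_right (X.resO inf_le_left φ)) e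
  rw [h1, h2] at h3
  exact congrFun (congrArg Subtype.val h3) ⟨x.1, x.2, hx⟩

theorem bracket_add (ξ η η' : VField X U) : ⁅ξ, η + η'⁆ = ⁅ξ, η⁆ + ⁅ξ, η'⁆ := by
  refine ext_act fun W hW φ => ?_
  simp only [res_bracket, bracket_act, map_add, add_act]
  ring

theorem bracket_swap (ξ η : VField X U) : ⁅ξ, η⁆ = -⁅η, ξ⁆ := by
  refine ext_act fun W hW φ => ?_
  change _ = -(res hW ⁅η, ξ⁆).act φ
  simp only [res_bracket, bracket_act]
  ring

theorem add_bracket (ξ ξ' η : VField X U) : ⁅ξ + ξ', η⁆ = ⁅ξ, η⁆ + ⁅ξ', η⁆ := by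
  rw [bracket_swap, bracket_add, bracket_swap η, bracket_swap η]
  abel

theorem bracket_smul (ξ η : VField X U) (ψ : X.O U) : ⁅ξ, ψ • η⁆ = ψ • ⁅ξ, η⁆ + ξ.act ψ • η := by
  refine ext_act fun W hW φ => ?_
  change (res hW ξ).act (X.resO hW ψ * (res hW η).act φ) -
      X.resO hW ψ * (res hW η).act ((res hW ξ).act φ) =
    X.resO hW ψ * ((res hW ξ).act ((res hW η).act φ) - (res hW η).act ((res hW ξ).act φ)) +
      X.resO hW (ξ.act ψ) * (res hW η).act φ
  rw [act_mul, ← res_act]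
  ring

theorem jacobi (ξ η ζ : VField X U) : ⁅ξ, ⁅η, ζ⁆⁆ = ⁅⁅ξ, η⁆, ζ⁆ + ⁅η, ⁅ξ, ζ⁆⁆ := by
  refine ext_act fun W hW φ => ?_
  rw [map_add, add_act]
  simp only [res_bracket, bracket_act, map_sub]
  ring

end VField

/-! ### Functions are determined, and can be defined, locally. -/

namespace Mfd

variable {X : Mfd.{u, v} 𝕜 K n} {U : Opens X}

theorem O_locality {φ ψ : X.O U}
    (h : ∀ x ∈ U, ∃ (V : Opens X) (hV : V ≤ U), x ∈ V ∧ X.resO hV φ = X.resO hV ψ) : φ = ψ :=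
  X.O_ext fun x => by
    obtain ⟨W, hW, hx, e⟩ := h x.1 x.2
    exact congrFun (congrArg Subtype.val e) ⟨x.1, hx⟩

/-- A function which locally is of class `n` is of class `n`. -/
theorem exists_O (F : U → K)
    (h : ∀ x ∈ U, ∃ (V : Opens X) (hV : V ≤ U) (φ : X.O V), x ∈ V ∧
      ∀ y : V, F ⟨y.1, hV y.2⟩ = φ.1 y) : ∃ φ : X.O U, ∀ x, φ.1 x = F x := by
  refine ⟨⟨F, fun x => ?_⟩, fun _ => rfl⟩
  obtain ⟨V, hV, φ, hx, e⟩ := h x.1 x.2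
  have h1 : ContMDiffAt 𝓘(𝕜, X.E) 𝓘(𝕜, K) n (fun y : U => extend φ y.1) x :=
    contMDiffAt_subtype_iff.2 (contMDiffAt_extend φ hx)
  refine h1.congr_of_eventuallyEq ?_
  have : ∀ᶠ y : U in nhds x, y.1 ∈ V :=
    continuous_subtype_val.continuousAt.eventually_mem (V.isOpen.mem_nhds hx)
  filter_upwards [this] with y hy
  rw [show extend φ y.1 = φ.1 ⟨y.1, hy⟩ from extend_coe φ ⟨y.1, hy⟩, ← e]

end Mfd

/-! ### Cartan calculus for 1-forms. -/

namespace Form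

variable {X : Mfd.{u, v} 𝕜 K n} {U : Opens X}

theorem ext_ap {α β : Form X 1 U}
    (h : ∀ (V : Opens X) (hV : V ≤ U) (ζ : VField X V),
      (res hV α).ap ζ = (res hV β).ap ζ) : α = β := by
  refine ext fun V hV ξ => ?_
  have e : ξ = fun _ => ξ 0 := funext fun a => by rw [Subsingleton.elim a 0]
  rw [e]
  exact h V hV (ξ 0)

theorem toFun_one {V : Opens X} (hV : V ≤ U) (α : Form X 1 U) (ξ : Fin 1 → VField X V) :
    α.toFun V hV ξ = (res hV α).ap (ξ 0) := by
  have e : ξ = fun _ => ξ 0 := funext fun a => by rw [Subsingleton.elim a 0]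
  rw [e]
  rfl

theorem add_ap (α β : Form X 1 U) (ζ : VField X U) : (α + β).ap ζ = α.ap ζ + β.ap ζ := rfl

theorem neg_ap (α : Form X 1 U) (ζ : VField X U) : (-α).ap ζ = -α.ap ζ := rfl

theorem sub_ap (α β : Form X 1 U) (ζ : VField X U) : (α - β).ap ζ = α.ap ζ - β.ap ζ := by
  rw [sub_eq_add_neg, sub_eq_add_neg]
  rfl

theorem zero_ap (ζ : VField X U) : (0 : Form X 1 U).ap ζ = 0 := rfl

theorem smul_ap (φ : X.O U) (α : Form X 1 U) (ζ : VField X U) : (φ • α).ap ζ = φ * α.ap ζ := rfl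

theorem ap_zero (α : Form X 1 U) : α.ap 0 = 0 := by
  have := α.ap_smul 0 0
  rwa [zero_smul, zero_mul] at this

theorem ap_neg (α : Form X 1 U) (ζ : VField X U) : α.ap (-ζ) = -α.ap ζ := by
  refine eq_neg_of_add_eq_zero_left ?_
  rw [← ap_add, neg_add_cancel, ap_zero]

theorem sum_ap {ι : Type*} (s : Finset ι) (α : ι → Form X 1 U) (ζ : VField X U) :
    (∑ i ∈ s, α i).ap ζ = ∑ i ∈ s, (α i).ap ζ :=
  map_sum (⟨⟨fun α : Form X 1 U => α.ap ζ, rfl⟩, fun _ _ => rfl⟩ : Form X 1 U →+ X.O U) α s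

theorem ap_sum {ι : Type*} (s : Finset ι) (α : Form X 1 U) (ζ : ι → VField X U) :
    α.ap (∑ i ∈ s, ζ i) = ∑ i ∈ s, α.ap (ζ i) :=
  map_sum (⟨⟨fun ζ => α.ap ζ, ap_zero α⟩, ap_add α⟩ : VField X U →+ X.O U) ζ s

theorem res_smul {k : ℕ} {V : Opens X} (h : V ≤ U) (φ : X.O U) (α : Form X k U) :
    res h (φ • α) = X.resO h φ • res h α := rfl

theorem res_res {k : ℕ} {V W : Opens X} (h : V ≤ U) (h' : W ≤ V) (α : Form X k U) :
    res h' (res h α) = res (h'.trans h) α := rfl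

theorem res_d {V : Opens X} (h : V ≤ U) (φ : X.O U) : res h (d φ) = d (X.resO h φ) := rfl

theorem res_lie {V : Opens X} (h : V ≤ U) (ξ : VField X U) (α : Form X 1 U) :
    res h (lie ξ α) = lie (VField.res h ξ) (res h α) := rfl

theorem d_ap (φ : X.O U) (ζ : VField X U) : (d φ).ap ζ = ζ.act φ := rfl

theorem lie_ap (ξ : VField X U) (α : Form X 1 U) (ζ : VField X U) :
    (lie ξ α).ap ζ = ξ.act (α.ap ζ) - α.ap ⁅ξ, ζ⁆ := rfl

theorem iotaD_ap (ξ : VField X U) (α : Form X 1 U) (ζ : VField X U) :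
    (iotaD ξ α).ap ζ = ξ.act (α.ap ζ) - ζ.act (α.ap ξ) - α.ap ⁅ξ, ζ⁆ := by
  rw [iotaD, sub_ap, lie_ap, d_ap]
  ring

theorem res_iotaD {V : Opens X} (h : V ≤ U) (ξ : VField X U) (α : Form X 1 U) :
    res h (iotaD ξ α) = iotaD (VField.res h ξ) (res h α) := by
  rw [iotaD, map_sub, res_lie, res_d, iotaD, res_ap]

theorem d_add (φ ψ : X.O U) : d (φ + ψ) = d φ + d ψ :=
  ext_ap fun V hV ζ => by
    rw [res_d, map_add, map_add, add_ap, res_d, res_d, d_ap, d_ap, d_ap, map_add]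

theorem d_mul (φ ψ : X.O U) : d (φ * ψ) = φ • d ψ + ψ • d φ :=
  ext_ap fun V hV ζ => by
    rw [map_add, res_smul, res_smul, add_ap, smul_ap, smul_ap, res_d, map_mul]
    exact VField.act_mul _ _ _

theorem d_zero : d (0 : X.O U) = 0 := by
  have := d_add (0 : X.O U) 0
  rwa [add_zero, left_eq_add] at this

theorem d_neg (φ : X.O U) : d (-φ) = -d φ :=
  eq_neg_of_add_eq_zero_left (by rw [← d_add, neg_add_cancel, d_zero])

theorem d_sum {ι : Type*} (s : Finset ι) (φ : ι → X.O U) :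
    d (∑ i ∈ s, φ i) = ∑ i ∈ s, d (φ i) :=
  map_sum (⟨⟨d, d_zero⟩, d_add⟩ : X.O U →+ Form X 1 U) φ s

theorem lie_add (ξ : VField X U) (α β : Form X 1 U) : lie ξ (α + β) = lie ξ α + lie ξ β :=
  ext_ap fun V hV ζ => by
    rw [map_add, res_lie, res_lie, res_lie, add_ap, lie_ap, lie_ap, lie_ap, map_add, add_ap,
      add_ap, map_add]
    ring

theorem add_lie (ξ η : VField X U) (α : Form X 1 U) : lie (ξ + η) α = lie ξ α + lie η α :=
  ext_ap fun V hV ζ => by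
    rw [map_add, res_lie, res_lie, res_lie, add_ap, lie_ap, lie_ap, lie_ap, map_add,
      VField.add_act, VField.add_bracket, ap_add]
    ring

theorem lie_smul (ξ : VField X U) (φ : X.O U) (α : Form X 1 U) :
    lie ξ (φ • α) = φ • lie ξ α + ξ.act φ • α :=
  ext_ap fun V hV ζ => by
    rw [map_add, res_smul, res_smul, res_lie, res_lie, add_ap, lie_ap, smul_ap, lie_ap, smul_ap,
      res_smul, smul_ap, smul_ap, VField.act_mul, ← VField.res_act]
    ring

theorem lie_d (ξ : VField X U) (φ : X.O U) : lie ξ (d φ) = d (ξ.act φ) :=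
  ext_ap fun V hV ζ => by
    rw [res_lie, lie_ap, res_d, res_d, d_ap, d_ap, d_ap, VField.bracket_act, VField.res_act]
    ring

theorem lie_zero (ξ : VField X U) : lie ξ (0 : Form X 1 U) = 0 := by
  have := lie_add ξ (0 : Form X 1 U) 0
  rwa [add_zero, left_eq_add] at this

theorem lie_neg (ξ : VField X U) (α : Form X 1 U) : lie ξ (-α) = -lie ξ α :=
  eq_neg_of_add_eq_zero_left (by rw [← lie_add, neg_add_cancel, lie_zero])

theorem lie_sum {ι : Type*} (s : Finset ι) (ξ : VField X U) (α : ι → Form X 1 U) :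
    lie ξ (∑ i ∈ s, α i) = ∑ i ∈ s, lie ξ (α i) :=
  map_sum (⟨⟨lie ξ, lie_zero ξ⟩, lie_add ξ⟩ : Form X 1 U →+ Form X 1 U) α s

theorem iotaD_add (ξ : VField X U) (α β : Form X 1 U) :
    iotaD ξ (α + β) = iotaD ξ α + iotaD ξ β := by
  rw [iotaD, iotaD, iotaD, lie_add, add_ap, d_add]
  abel

theorem iotaD_zero (ξ : VField X U) : iotaD ξ (0 : Form X 1 U) = 0 := by
  have := iotaD_add ξ (0 : Form X 1 U) 0
  rwa [add_zero, left_eq_add] at this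

theorem iotaD_neg (ξ : VField X U) (α : Form X 1 U) : iotaD ξ (-α) = -iotaD ξ α :=
  eq_neg_of_add_eq_zero_left (by rw [← iotaD_add, neg_add_cancel, iotaD_zero])

theorem iotaD_sum {ι : Type*} (s : Finset ι) (ξ : VField X U) (α : ι → Form X 1 U) :
    iotaD ξ (∑ i ∈ s, α i) = ∑ i ∈ s, iotaD ξ (α i) :=
  map_sum (⟨⟨iotaD ξ, iotaD_zero ξ⟩, iotaD_add ξ⟩ : Form X 1 U →+ Form X 1 U) α s

theorem add_iotaD (ξ η : VField X U) (α : Form X 1 U) :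
    iotaD (ξ + η) α = iotaD ξ α + iotaD η α := by
  rw [iotaD, iotaD, iotaD, add_lie, ap_add, d_add]
  abel

theorem zero_iotaD (α : Form X 1 U) : iotaD (0 : VField X U) α = 0 := by
  have := add_iotaD (0 : VField X U) 0 α
  rwa [add_zero, left_eq_add] at this

/-- The terms containing derivatives of φ in the two summands of `iotaD` cancel, so ι_ξ dα is
tensorial in ξ although L_ξ α is not. This gives the rule for [s, φt] on the inverse image. -/
theorem smul_iotaD (φ : X.O U) (ξ : VField X U) (α : Form X 1 U) :
    iotaD (φ • ξ) α = φ • iotaD ξ α :=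
  ext_ap fun V hV ζ => by
    rw [res_smul, res_iotaD, res_iotaD, smul_ap, iotaD_ap, iotaD_ap, VField.res_smul, ap_smul,
      VField.act_mul, VField.smul_act, VField.bracket_swap (X.resO hV φ • _),
      VField.bracket_smul, VField.bracket_swap ζ, ap_neg, ap_add, ap_smul, ap_smul, ap_neg]
    ring

theorem iotaD_smul (φ : X.O U) (ξ : VField X U) (α : Form X 1 U) :
    iotaD ξ (φ • α) = φ • iotaD ξ α + ξ.act φ • α - α.ap ξ • d φ := by
  rw [iotaD, iotaD, lie_smul, smul_ap, d_mul, smul_sub]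
  abel

theorem iotaD_d (ξ : VField X U) (φ : X.O U) : iotaD ξ (d φ) = 0 := by
  rw [iotaD, lie_d, d_ap, sub_self]

theorem iotaD_smul_d (ξ : VField X U) (φ ψ : X.O U) :
    iotaD ξ (φ • d ψ) = ξ.act φ • d ψ - ξ.act ψ • d φ := by
  rw [iotaD_smul, iotaD_d, smul_zero, zero_add, d_ap]

theorem lie_smul_d (ξ : VField X U) (φ ψ : X.O U) :
    lie ξ (φ • d ψ) = ξ.act φ • d ψ + φ • d (ξ.act ψ) := by
  rw [lie_smul, lie_d, add_comm]

theorem lie_lie (ξ η : VField X U) (α : Form X 1 U) :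
    lie ξ (lie η α) = lie ⁅ξ, η⁆ α + lie η (lie ξ α) :=
  ext_ap fun V hV ζ => by
    rw [map_add, add_ap]
    simp only [res_lie, lie_ap, VField.res_bracket, VField.bracket_act, map_sub]
    rw [VField.jacobi (VField.res hV ξ) (VField.res hV η), ap_add]
    ring

theorem lie_iotaD (ξ η : VField X U) (α : Form X 1 U) :
    lie ξ (iotaD η α) = iotaD ⁅ξ, η⁆ α + iotaD η (lie ξ α) := by
  rw [iotaD, iotaD, iotaD, sub_eq_add_neg, lie_add, lie_neg, lie_d, lie_lie, lie_ap,
    sub_eq_add_neg (ξ.act _), d_add, d_neg]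
  abel

/-- ι_η dα and L_η α differ by an exact form, which ι_ξ d kills. -/
theorem iotaD_iotaD (ξ η : VField X U) (α : Form X 1 U) :
    iotaD ξ (iotaD η α) = iotaD ξ (lie η α) := by
  rw [iotaD.eq_1 η, sub_eq_add_neg, iotaD_add, iotaD_neg, iotaD_d, neg_zero, add_zero]

/-- Exact forms generate Ω¹ locally. This is why the relations defining `f^{++}M` need only be
tested on differentials of functions. -/
theorem eq_sum_d_coord (p : X) (hU : U ≤ chartDom p) (γ : Form X 1 U) :
    γ = ∑ i, γ.ap (VField.res hU (coordField p i)) • d (X.resO hU (coord p i)) := by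
  refine ext_ap fun V hV ζ => ?_
  rw [map_sum, sum_ap]
  conv_lhs => rw [VField.eq_sum_coordField p (hV.trans hU) ζ, ap_sum]
  refine Finset.sum_congr rfl fun i _ => ?_
  rw [ap_smul, res_smul, smul_ap, mul_comm]
  exact congrArg (· * _) (res_ap hV γ (VField.res hU (coordField p i)))

theorem locality {k : ℕ} {α β : Form X k U}
    (h : ∀ x ∈ U, ∃ (V : Opens X) (hV : V ≤ U), x ∈ V ∧ res hV α = res hV β) : α = β := by
  refine ext fun V hV ξ => O_locality fun x hx => ?_
  obtain ⟨W, hW, hxW, e⟩ := h x (hV hx)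
  refine ⟨V ⊓ W, inf_le_left, ⟨hx, hxW⟩, ?_⟩
  rw [← α.natural V (V ⊓ W) hV inf_le_left, ← β.natural V (V ⊓ W) hV inf_le_left]
  exact congrArg (fun γ : Form X k W => γ.toFun (V ⊓ W) inf_le_right _) e

end Form

/-! ### The differential of `f` in coordinates. -/

namespace InverseImage

variable {Y : Mfd.{w₁, w₂} 𝕜 K n} {X : Mfd.{u, v} 𝕜 K n} (f : Y.Hom X)

/-- The chain rule for a derivation ξ on Y. It rests on the tangency condition: at a given point, ξ
kills functions whose differential vanishes there. -/
theorem act_pull_eq_sum (p : X) {W : Opens Y} {V : Opens X} (hV : V ≤ chartDom p)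
    (hf : W ≤ pre f V) (ξ : VField Y W) (φ : X.O V) :
    ξ.act (pull f hf φ) =
      ∑ i, ξ.act (pull f hf (X.resO hV (coord p i))) * pull f hf (pd p i V hV φ) := by
  apply Y.O_ext
  intro y
  set x : V := ⟨f y.1, hf y.2⟩ with hx
  -- Subtract from φ the linear combination of coordinates whose constant coefficients are the
  -- partial derivatives at f(y). The pull-back of the difference has vanishing differential at y.
  have h0 := ξ.tangent W le_rfl
    (pull f hf (φ - ∑ i, (pd p i V hV φ).1 x • X.resO hV (coord p i))) y ?_
  · rw [map_sub, map_sum, map_sub, map_sum] at h0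
    simp only [map_smul] at h0
    have h1 : (ξ.act (pull f hf φ)).1 y - (∑ i, (pd p i V hV φ).1 x •
      ξ.act (pull f hf (X.resO hV (coord p i)))).1 y = 0 := h0
    rw [sub_eq_zero.1 h1, sumO_apply, sumO_apply]
    exact Finset.sum_congr rfl fun i _ => mul_comm _ _
  · set ψ := φ - ∑ i, (pd p i V hV φ).1 x • X.resO hV (coord p i) with hψ
    have h2 : fderiv 𝕜 (written p ψ) (chartAt X.E p x) = 0 := by
      refine fderiv_written_eq_zero_of_pd p hV ψ x fun j => ?_
      rw [hψ]
      simp only [map_sub, map_sum, map_smul, pd_coord]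
      change (pd p j V hV φ).1 x - (∑ i, _ : X.O V).1 x = 0
      rw [sumO_apply, sub_eq_zero, Finset.sum_eq_single j]
      · simp
      · intro i _ hi
        simp [Ne.symm hi]
      · simp
    have h3 : (pull f hf ψ).1 = written p ψ ∘ (fun z : W => chartAt X.E p (f z.1)) :=
      funext fun z => (written_chart p hV ψ ⟨f z.1, hf z.2⟩).symm
    have h4 : MDifferentiableAt 𝓘(𝕜, Y.E) 𝓘(𝕜, X.E) (fun z : W => chartAt X.E p (f z.1)) y := by
      have h5 : ContMDiffAt 𝓘(𝕜, Y.E) 𝓘(𝕜, X.E) n (fun z : Y => chartAt X.E p (f z)) y.1 :=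
        ((contMDiffOn_chart (I := 𝓘(𝕜, X.E)) (x := p)).contMDiffAt
          ((chartDom p).isOpen.mem_nhds (hV x.2))).comp y.1 (f.contMDiff y.1)
      exact (contMDiffAt_subtype_iff.2 h5).mdifferentiableAt (ne_zero_of_fact (n := n))
    rw [h3, mfderiv_comp y (diff_written p hV ψ x).mdifferentiableAt h4, mfderiv_eq_fderiv]
    erw [h2]
    exact ContinuousLinearMap.zero_comp _

/-- Supplies, near every point, one decomposition of df(ξ). Existence of induced sections and
uniqueness of everything characterised through `DfEq` depend on it. -/
theorem DfEq_coord (p : X) {W : Opens Y} {V : Opens X} (hV : V ≤ chartDom p)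
    (hf : W ≤ pre f V) (ξ : VField Y W) :
    DfEq f ξ (fun i => ξ.act (pull f hf (X.resO hV (coord p i))))
      (fun i => VField.res hV (coordField p i)) := by
  intro U' hU' W' hW' hf' φ
  refine (act_pull_eq_sum f p (hU'.trans hV) hf' (VField.res hW' ξ) φ).trans
    (Finset.sum_congr rfl fun i _ => ?_)
  rw [← VField.res_act]
  rfl

variable {f}

theorem DfEq.res {W W' : Opens Y} {U U' : Opens X} {ι : Type} [Fintype ι] {ξ : VField Y W}
    {h : ι → Y.O W} {v : ι → VField X U} (H : DfEq f ξ h v) (hW : W' ≤ W) (hU : U' ≤ U) :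
    DfEq f (VField.res hW ξ) (fun i => Y.resO hW (h i)) (fun i => VField.res hU (v i)) :=
  fun U'' hU'' W'' hW'' hf φ => H U'' (hU''.trans hU) W'' (hW''.trans hW) hf φ

theorem DfEq.act_pull {W : Opens Y} {U : Opens X} {ι : Type} [Fintype ι] {ξ : VField Y W}
    {h : ι → Y.O W} {v : ι → VField X U} (H : DfEq f ξ h v) (hf : W ≤ pre f U) (φ : X.O U) :
    ξ.act (pull f hf φ) = ∑ i, h i * pull f hf ((v i).act φ) :=
  H U le_rfl W le_rfl hf φ

variable (f) in
theorem exists_chart_nhd {V : Opens Y} {U : Opens X} {y : Y} (hy : y ∈ V) (hU : f y ∈ U) :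
    ∃ (W : Opens Y) (U' : Opens X), W ≤ V ∧ U' ≤ U ∧ U' ≤ chartDom (f y) ∧ y ∈ W ∧
      W ≤ pre f U' ∧ f y ∈ U' :=
  ⟨V ⊓ pre f (U ⊓ chartDom (f y)), U ⊓ chartDom (f y), inf_le_left, inf_le_left, inf_le_right,
    ⟨hy, hU, mem_chartDom _⟩, inf_le_right, ⟨hU, mem_chartDom _⟩⟩

end InverseImage

end Geometry

/-! ### Local operations acting on stalks. -/

section Germs

variable {𝕜 K : Type} [RCLike 𝕜] [RCLike K] [NormedAlgebra 𝕜 K] {n : WithTop ℕ∞}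
  [Fact (n = ∞ ∨ n = ω)]

open Mfd PMod

section

variable {Y : Mfd.{u, v} 𝕜 K n}

/-- The exterior derivative of germs of functions. -/
def Mfd.germD (y : Y) : Y.OGerm y →+ (forms Y 1).Germ y :=
  AddMonoidHom.mk' (PMod.map (P₁ := unit Y) (P₂ := forms Y 1) (fun _ φ => Form.d φ)
    fun _ _ _ _ => rfl) fun a b => by
      obtain ⟨U, hU, s, t, rfl, rfl⟩ := og_surj₂ a b
      rw [← og_add]
      exact (congrArg (gm (P := forms Y 1) y hU) (Form.d_add s t)).trans
        (gm_add (P := forms Y 1) hU _ _)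

theorem Mfd.germD_og {y : Y} {U : Opens Y} (hU : y ∈ U) (φ : Y.O U) :
    germD y (og y hU φ) = gm (P := forms Y 1) y hU (Form.d φ) := rfl

theorem PMod.exists_germ {y : Y} {W : Opens Y} (hy : y ∈ W) {P : PMod.{u, v, w} Y}
    (a : P.Germ y) : ∃ (V : Opens Y) (hV : V ≤ W) (hyV : y ∈ V) (s : P.Sec V),
      a = gm y hyV s := by
  obtain ⟨U, hU, s, rfl⟩ := gm_surj a
  exact ⟨U ⊓ W, inf_le_right, ⟨hU, hy⟩, P.res inf_le_left s,
    (gm_res y inf_le_left (show y ∈ U ⊓ W from ⟨hU, hy⟩) s).symm⟩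

theorem Mfd.exists_og {y : Y} {W : Opens Y} (hy : y ∈ W) (a : Y.OGerm y) :
    ∃ (V : Opens Y) (hV : V ≤ W) (hyV : y ∈ V) (s : Y.O V), a = og y hyV s :=
  PMod.exists_germ (P := unit Y) hy a

section germHom

variable {P₁ : PMod.{u, v, w₁} Y} {P₂ : PMod.{u, v, w₂} Y} {P₃ : PMod.{u, v, w₃} Y}
  (F : ∀ U : Opens Y, P₁.Sec U → P₂.Sec U → P₃.Sec U)
  (hF : ∀ (U V : Opens Y) (h : V ≤ U) (s : P₁.Sec U) (t : P₂.Sec U),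
      F V (P₁.res h s) (P₂.res h t) = P₃.res h (F U s t))
  (hadd : ∀ (U : Opens Y) (s : P₁.Sec U) (t t' : P₂.Sec U), F U s (t + t') = F U s t + F U s t')

/-- A local operation with its first argument fixed, as an additive map of stalks. -/
def PMod.germHom {U : Opens Y} (s : P₁.Sec U) {y : Y} (hy : y ∈ U) : P₂.Germ y →+ P₃.Germ y :=
  AddMonoidHom.mk' (PMod.map₂ F hF (gm y hy s)) fun a b => by
    obtain ⟨V, hV, hyV, t, rfl⟩ := PMod.exists_germ hy a
    obtain ⟨V', hV', hyV', t', rfl⟩ := PMod.exists_germ hyV b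
    rw [← gm_res y hV' hyV' t, ← gm_res y (hV'.trans hV) hyV' s, ← gm_add hyV', map₂_gm, map₂_gm,
      map₂_gm, hadd, gm_add]

theorem PMod.germHom_gm {U : Opens Y} (s : P₁.Sec U) (t : P₂.Sec U) {y : Y} (hy : y ∈ U) :
    germHom F hF hadd s hy (gm y hy t) = gm y hy (F U s t) := map₂_gm F hF hy s t

theorem PMod.germHom_res {U V : Opens Y} (h : V ≤ U) (s : P₁.Sec U) {y : Y} (hy : y ∈ V) :
    germHom F hF hadd (P₁.res h s) hy = germHom F hF hadd s (h hy) := by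
  ext a
  exact congrArg (fun g => PMod.map₂ F hF g a) (gm_res y h hy s)

end germHom

/-- The action of a vector field on germs of functions. -/
def VField.germAct {W : Opens Y} (ξ : VField Y W) {y : Y} (hy : y ∈ W) :
    Y.OGerm y →+ Y.OGerm y :=
  PMod.germHom (P₁ := PMod.tangent Y) (P₂ := unit Y) (P₃ := unit Y) (fun _ ξ φ => ξ.act φ)
    (fun _ _ h ξ φ => ξ.res_act h φ) (fun _ ξ φ ψ => map_add ξ.act φ ψ) ξ hy

theorem VField.germAct_og {W : Opens Y} (ξ : VField Y W) {y : Y} (hy : y ∈ W) (φ : Y.O W) :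
    ξ.germAct hy (og y hy φ) = og y hy (ξ.act φ) :=
  PMod.germHom_gm (P₁ := PMod.tangent Y) (P₂ := unit Y) (P₃ := unit Y) (fun _ ξ φ => ξ.act φ)
    _ _ ξ φ hy

theorem VField.germAct_res {W V : Opens Y} (h : V ≤ W) (ξ : VField Y W) {y : Y} (hy : y ∈ V) :
    (VField.res h ξ).germAct hy = ξ.germAct (h hy) :=
  PMod.germHom_res (P₁ := PMod.tangent Y) (P₂ := unit Y) (P₃ := unit Y) (fun _ ξ φ => ξ.act φ)
    _ _ h ξ hy

/-- The operator `α ↦ ι_ξ dα` on germs of `1`-forms. -/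
def VField.germIotaD {W : Opens Y} (ξ : VField Y W) {y : Y} (hy : y ∈ W) :
    (forms Y 1).Germ y →+ (forms Y 1).Germ y :=
  PMod.germHom (P₁ := PMod.tangent Y) (P₂ := forms Y 1) (P₃ := forms Y 1)
    (fun _ ξ α => Form.iotaD ξ α) (fun _ _ h ξ α => (Form.res_iotaD h ξ α).symm)
    (fun _ ξ α β => Form.iotaD_add ξ α β) ξ hy

theorem VField.germIotaD_gm {W : Opens Y} (ξ : VField Y W) {y : Y} (hy : y ∈ W)
    (α : Form Y 1 W) : ξ.germIotaD hy (gm (P := forms Y 1) y hy α) =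
      gm (P := forms Y 1) y hy (Form.iotaD ξ α) :=
  PMod.germHom_gm (P₁ := PMod.tangent Y) (P₂ := forms Y 1) (P₃ := forms Y 1)
    (fun _ ξ α => Form.iotaD ξ α) _ _ ξ α hy

theorem VField.germIotaD_res {W V : Opens Y} (h : V ≤ W) (ξ : VField Y W) {y : Y} (hy : y ∈ V) :
    (VField.res h ξ).germIotaD hy = ξ.germIotaD (h hy) :=
  PMod.germHom_res (P₁ := PMod.tangent Y) (P₂ := forms Y 1) (P₃ := forms Y 1)
    (fun _ ξ α => Form.iotaD ξ α) _ _ h ξ hy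

/-- The contraction of germs of `1`-forms with a vector field. -/
def VField.germAp {W : Opens Y} (ξ : VField Y W) {y : Y} (hy : y ∈ W) :
    (forms Y 1).Germ y →+ Y.OGerm y :=
  PMod.germHom (P₁ := PMod.tangent Y) (P₂ := forms Y 1) (P₃ := unit Y)
    (fun _ ξ α => α.ap ξ) (fun _ _ h ξ α => α.res_ap h ξ) (fun _ ξ α β => Form.add_ap α β ξ) ξ hy

theorem VField.germAp_gm {W : Opens Y} (ξ : VField Y W) {y : Y} (hy : y ∈ W)
    (α : Form Y 1 W) : ξ.germAp hy (gm (P := forms Y 1) y hy α) = og y hy (α.ap ξ) :=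
  PMod.germHom_gm (P₁ := PMod.tangent Y) (P₂ := forms Y 1) (P₃ := unit Y)
    (fun _ ξ α => α.ap ξ) _ _ ξ α hy

theorem VField.germAp_res {W V : Opens Y} (h : V ≤ W) (ξ : VField Y W) {y : Y} (hy : y ∈ V) :
    (VField.res h ξ).germAp hy = ξ.germAp (h hy) :=
  PMod.germHom_res (P₁ := PMod.tangent Y) (P₂ := forms Y 1) (P₃ := unit Y)
    (fun _ ξ α => α.ap ξ) _ _ h ξ hy

theorem VField.eq_of_gm_eq {W : Opens Y} {ξ η : VField Y W}
    (h : ∀ y : W, gm (P := PMod.tangent Y) y.1 y.2 ξ = gm (P := PMod.tangent Y) y.1 y.2 η) : ξ = η :=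
  VField.locality fun x hx => by
    obtain ⟨V, hV, h1, h2, e⟩ := (gm_eq_iff (P := PMod.tangent Y)).1 (h ⟨x, hx⟩)
    exact ⟨V, h1, hV, e⟩

theorem Form.eq_of_gm_eq {k : ℕ} {W : Opens Y} {α β : Form Y k W}
    (h : ∀ y : W, gm (P := forms Y k) y.1 y.2 α = gm (P := forms Y k) y.1 y.2 β) : α = β :=
  Form.locality fun x hx => by
    obtain ⟨V, hV, h1, h2, e⟩ := (gm_eq_iff (P := forms Y k)).1 (h ⟨x, hx⟩)
    exact ⟨V, h1, hV, e⟩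

end

section

variable {X : Mfd.{u, v} 𝕜 K n} {M : SMod.{u, v, w} X} (Q : CourantStr M)

/-- The bracket with a section, on germs. -/
def CourantStr.germBracket {U : Opens X} (p : M.Sec U) {x : X} (hx : x ∈ U) :
    M.toPMod.Germ x →+ M.toPMod.Germ x :=
  PMod.germHom (P₁ := M.toPMod) (P₂ := M.toPMod) (P₃ := M.toPMod)
    (fun U p q => Q.bracket U q p) (fun _ _ h p q => (Q.res_bracket h q p).symm)
    (fun _ p q q' => Q.add_bracket q q' p) p hx

theorem CourantStr.germBracket_gm {U : Opens X} (q p : M.Sec U) {x : X} (hx : x ∈ U) :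
    Q.germBracket p hx (gm (P := M.toPMod) x hx q) =
      gm (P := M.toPMod) x hx (Q.bracket U q p) :=
  PMod.germHom_gm (P₁ := M.toPMod) (P₂ := M.toPMod) (P₃ := M.toPMod)
    (fun U p q => Q.bracket U q p) (fun _ _ h p q => (Q.res_bracket h q p).symm) _ p q hx

theorem CourantStr.germBracket_res {U V : Opens X} (h : V ≤ U) (p : M.Sec U) {x : X}
    (hx : x ∈ V) : Q.germBracket (M.res h p) hx = Q.germBracket p (h hx) :=
  PMod.germHom_res (P₁ := M.toPMod) (P₂ := M.toPMod) (P₃ := M.toPMod)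
    (fun U p q => Q.bracket U q p) (fun _ _ h p q => (Q.res_bracket h q p).symm) _ h p hx

/-- The pairing with a section, on germs. -/
def CourantStr.germPairing {U : Opens X} (p : M.Sec U) {x : X} (hx : x ∈ U) :
    M.toPMod.Germ x →+ X.OGerm x :=
  PMod.germHom (P₁ := M.toPMod) (P₂ := M.toPMod) (P₃ := unit X)
    (fun U p q => Q.pairing U q p) (fun _ _ h p q => (Q.res_pairing h q p).symm)
    (fun U p q q' => by rw [map_add, LinearMap.add_apply]) p hx

theorem CourantStr.germPairing_gm {U : Opens X} (q p : M.Sec U) {x : X} (hx : x ∈ U) :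
    Q.germPairing p hx (gm (P := M.toPMod) x hx q) = og x hx (Q.pairing U q p) :=
  PMod.germHom_gm (P₁ := M.toPMod) (P₂ := M.toPMod) (P₃ := unit X)
    (fun U p q => Q.pairing U q p) (fun _ _ h p q => (Q.res_pairing h q p).symm) _ p q hx

theorem CourantStr.germPairing_res {U V : Opens X} (h : V ≤ U) (p : M.Sec U) {x : X}
    (hx : x ∈ V) : Q.germPairing (M.res h p) hx = Q.germPairing p (h hx) :=
  PMod.germHom_res (P₁ := M.toPMod) (P₂ := M.toPMod) (P₃ := unit X)
    (fun U p q => Q.pairing U q p) (fun _ _ h p q => (Q.res_pairing h q p).symm) _ h p hx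

end

/-! ### Generators of the relations and additive maps out of the quotient. -/

namespace InverseImage

variable {Y : Mfd.{w₁, w₂} 𝕜 K n} {X : Mfd.{u, v} 𝕜 K n} (f : Y.Hom X)
  {M : SMod.{u, v, w} X} (Q : CourantStr M)

theorem pullGerm_og {W : Opens Y} {U : Opens X} (hf : W ≤ pre f U) {y : Y} (hy : y ∈ W)
    (φ : X.O U) : pullGerm f y (og (f y) (mem_of hf hy) φ) = og y hy (pull f hf φ) :=
  (og_res y hf hy (pull f le_rfl φ)).symm

theorem algebra_smul_def (y : Y) (a : X.OGerm (f y)) (b : Y.OGerm y) :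
    a • b = pullGerm f y a * b := rfl

variable {f} in
theorem isPullback_one {U : Opens X} {V : Opens Y} {γ : Form X 1 U} {γ' : Form Y 1 V}
    (H : IsPullback f γ γ') {W : Opens Y} (hW : W ≤ V) {U' : Opens X} (hU : U' ≤ U)
    (hf : W ≤ pre f U') {m : ℕ} {ξ : VField Y W} {h : Fin m → Y.O W} {v : Fin m → VField X U'}
    (hv : DfEq f ξ h v) :
    (Form.res hW γ').ap ξ = ∑ i, h i * pull f hf ((Form.res hU γ).ap (v i)) := by
  have := H W hW U' hU hf m (fun _ => ξ) (fun _ => h) (fun _ => v) (fun _ => hv)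
  refine this.trans ?_
  refine Fintype.sum_equiv (Equiv.funUnique (Fin 1) (Fin m)) _ _ fun I => ?_
  rw [Fintype.prod_unique]
  refine congrArg (_ * ·) (congrArg _ ?_)
  rw [Form.toFun_one]
  rfl

theorem isPullback_d {W : Opens Y} {U : Opens X} (hf : W ≤ pre f U) (ψ : X.O U) :
    IsPullback f (Form.d ψ) (Form.d (pull f hf ψ)) := by
  intro W' hW U' hU hf' m ξ h v H
  refine ((H 0).act_pull hf' (X.resO hU ψ)).trans ?_
  refine (Fintype.sum_equiv (Equiv.funUnique (Fin 1) (Fin m)) _ _ fun I => ?_).symm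
  rw [Fintype.prod_unique]
  refine congrArg (_ * ·) (congrArg _ ?_)
  rw [Form.toFun_one]
  rfl

theorem d_mem_relations {W : Opens Y} {U : Opens X} (hf : W ≤ pre f U) {y : Y} (hy : y ∈ W)
    (ψ : X.O U) : ((gm (P := forms Y 1) y hy (Form.d (pull f hf ψ)),
      -((1 : Y.OGerm y) ⊗ₜ gm (P := M.toPMod) (f y) (mem_of hf hy) (Q.coanchor U (Form.d ψ)))) :
        PreStalk f M y) ∈ relations f Q y :=
  Submodule.subset_span ⟨U, hf hy, W, hy, Form.d ψ, Form.d (pull f hf ψ), hf,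
    isPullback_d f hf ψ, rfl⟩

/-- The relations are generated by those coming from differentials of functions. -/
theorem relations_le_span (y : Y) : relations f Q y ≤ Submodule.span (Y.OGerm y)
    {p | ∃ (W : Opens Y) (U : Opens X) (hf : W ≤ pre f U) (hy : y ∈ W) (ψ : X.O U),
      p = (gm (P := forms Y 1) y hy (Form.d (pull f hf ψ)),
      -((1 : Y.OGerm y) ⊗ₜ gm (P := M.toPMod) (f y) (mem_of hf hy) (Q.coanchor U (Form.d ψ))))} := by
  refine Submodule.span_le.2 ?_
  rintro _ ⟨U, hU, V, hV, γ, γ', hVU, hγ, rfl⟩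
  obtain ⟨W, U', hWV, hU'U, hU', hyW, hWU', hyU'⟩ := exists_chart_nhd f hV hU
  -- The pull-back condition evaluated on the coordinate decomposition of df(ζ) gives γ' = ∑
  -- f^*(γ(∂ᵢ)) d(xᵢ∘f).
  have e1 : Form.res hWV γ' =
      ∑ i, pull f hWU' ((Form.res hU'U γ).ap (VField.res hU' (coordField (f y) i))) •
        Form.d (pull f hWU' (X.resO hU' (coord (f y) i))) := by
    refine Form.ext_ap fun W' hW' ζ => ?_
    have h1 := isPullback_one hγ (hW'.trans hWV) hU'U (hW'.trans hWU')
      (DfEq_coord f (f y) hU' (hW'.trans hWU') ζ)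
    rw [Form.res_res, h1, map_sum, Form.sum_ap]
    refine Finset.sum_congr rfl fun i _ => ?_
    rw [Form.res_smul, Form.smul_ap, mul_comm]
    rfl
  have e2 : Form.res hU'U γ = _ := Form.eq_sum_d_coord (f y) hU' (Form.res hU'U γ)
  have e3 : ((gm (P := forms Y 1) y hV γ',
      -((1 : Y.OGerm y) ⊗ₜ gm (P := M.toPMod) (f y) hU (Q.coanchor U γ))) : PreStalk f M y) =
      ∑ i, og y hyW (pull f hWU' ((Form.res hU'U γ).ap (VField.res hU' (coordField (f y) i)))) •
      ((gm (P := forms Y 1) y hyW (Form.d (pull f hWU' (X.resO hU' (coord (f y) i)))),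
        -((1 : Y.OGerm y) ⊗ₜ gm (P := M.toPMod) (f y) hyU'
          (Q.coanchor U' (Form.d (X.resO hU' (coord (f y) i)))))) : PreStalk f M y) := by
    refine Prod.ext ?_ ?_
    · rw [Prod.fst_sum]
      have h2 := congrArg (gm (P := forms Y 1) y hyW) e1
      refine (gm_res (P := forms Y 1) y hWV hyW γ').symm.trans (h2.trans ?_)
      refine (map_sum (AddMonoidHom.mk' (gm (P := forms Y 1) y hyW)
        (gm_add (P := forms Y 1) hyW)) _ _).trans ?_
      exact Finset.sum_congr rfl fun i _ => gm_smul (P := forms Y 1) hyW _ _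
    · rw [Prod.snd_sum]
      change -((1 : Y.OGerm y) ⊗ₜ[X.OGerm (f y)] _) = _
      rw [← gm_res (P := M.toPMod) (f y) hU'U hyU', Q.res_coanchor, e2, map_sum,
        show ∀ s : Fin _ → M.Sec U', gm (P := M.toPMod) (f y) hyU' (∑ i, s i) =
          ∑ i, gm (P := M.toPMod) (f y) hyU' (s i) from fun s =>
            map_sum (AddMonoidHom.mk' (gm (P := M.toPMod) (f y) hyU')
              (gm_add (P := M.toPMod) hyU')) s Finset.univ, TensorProduct.tmul_sum,
        ← Finset.sum_neg_distrib]
      refine Finset.sum_congr rfl fun i _ => ?_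
      -- The coefficient γ(∂ᵢ) lives on X and crosses the tensor sign as its pull-back, hence agrees
      -- with the coefficient found for γ'.
      rw [map_smul, gm_smul, ← TensorProduct.smul_tmul, algebra_smul_def,
        pullGerm_og f hWU' hyW, ← e2]
      change _ = _ • -((1 : Y.OGerm y) ⊗ₜ[X.OGerm (f y)] _)
      rw [smul_neg, TensorProduct.smul_tmul', smul_eq_mul]
  rw [e3]
  exact Submodule.sum_mem _ fun i _ => Submodule.smul_mem _ _
    (Submodule.subset_span ⟨W, U', hWU', hyW, _, rfl⟩)

section lift

variable {f} {y : Y} {C : Type*} [AddCommGroup C]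

/-- Construction of additive maps on stalks of `Ω¹_Y ⊕ f^*M`. -/
def preLift (a : (forms Y 1).Germ y →+ C) (b : Y.OGerm y →+ M.toPMod.Germ (f y) →+ C)
    (hb : ∀ (r : X.OGerm (f y)) (h : Y.OGerm y) (m : M.toPMod.Germ (f y)),
      b (r • h) m = b h (r • m)) : PreStalk f M y →+ C :=
  a.coprod (TensorProduct.liftAddHom b hb)

theorem preLift_apply (a : (forms Y 1).Germ y →+ C) (b : Y.OGerm y →+ M.toPMod.Germ (f y) →+ C)
    (hb) {ι : Type*} (s : Finset ι) (α : (forms Y 1).Germ y) (h : ι → Y.OGerm y)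
    (m : ι → M.toPMod.Germ (f y)) :
    preLift a b hb (α, ∑ i ∈ s, h i ⊗ₜ m i) = a α + ∑ i ∈ s, b (h i) (m i) := by
  rw [preLift, AddMonoidHom.coprod_apply, map_sum]
  rfl

/-- The operations to be descended are differential operators, so the lift is only additive. The
hypothesis `hr` therefore asks for all multiples c of a generating relation, not just for the
generators. -/
theorem preLift_eq {Q : CourantStr M} (a : (forms Y 1).Germ y →+ C)
    (b : Y.OGerm y →+ M.toPMod.Germ (f y) →+ C)
    (hb) (hr : ∀ (c : Y.OGerm y) (W : Opens Y) (U : Opens X) (hf : W ≤ pre f U) (hy : y ∈ W)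
      (ψ : X.O U), a (c • gm (P := forms Y 1) y hy (Form.d (pull f hf ψ))) =
        b c (gm (P := M.toPMod) (f y) (mem_of hf hy) (Q.coanchor U (Form.d ψ))))
    {p p' : PreStalk f M y} (h : (Submodule.Quotient.mk p : PreStalk f M y ⧸ relations f Q y) =
      Submodule.Quotient.mk p') : preLift a b hb p = preLift a b hb p' := by
  have h1 := relations_le_span f Q y ((Submodule.Quotient.eq _).1 h)
  rw [← sub_eq_zero, ← map_sub]
  -- Quantifying over the multiplier c makes the claim stable under scalar multiplication, which
  -- additivity alone does not give in the span induction.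
  have key : ∀ c : Y.OGerm y, preLift a b hb (c • (p - p')) = 0 := by
    refine Submodule.span_induction (p := fun q _ => ∀ c : Y.OGerm y, preLift a b hb (c • q) = 0)
      ?_ ?_ ?_ ?_ h1
    · rintro _ ⟨W, U, hf, hy, ψ, rfl⟩ c
      rw [preLift, AddMonoidHom.coprod_apply]
      change a (c • _) + TensorProduct.liftAddHom b hb
        (c • -((1 : Y.OGerm y) ⊗ₜ[X.OGerm (f y)] _)) = 0
      rw [hr, smul_neg, TensorProduct.smul_tmul', smul_eq_mul, mul_one, map_neg,
        TensorProduct.liftAddHom_tmul, add_neg_cancel]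
    · intro c
      rw [smul_zero, map_zero]
    · intro q q' _ _ hq hq' c
      rw [smul_add, map_add, hq, hq', add_zero]
    · intro d q _ hq c
      rw [smul_smul]
      exact hq _
  simpa using key 1

end lift

end InverseImage

end Germs

/-! ### Derived rules in a Courant algebroid. -/

section Families

variable {𝕜 K : Type} [RCLike 𝕜] [RCLike K] [NormedAlgebra 𝕜 K] {n : WithTop ℕ∞}
  [Fact (n = ∞ ∨ n = ω)]

open Mfd PMod

namespace CourantStr

variable {X : Mfd.{u, v} 𝕜 K n} {M : SMod.{u, v, w} X} (Q : CourantStr M) {U : Opens X}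

theorem bracket_swap (q p : M.Sec U) :
    Q.bracket U q p = -Q.bracket U p q + Q.coanchor U (Form.d (Q.pairing U q p)) := by
  rw [← Q.bracket_symm]
  abel

/-- Swap the arguments, apply the Leibniz rule in the second slot, and swap back. The summand with
⟨q,p⟩ comes from d(φ⟨q,p⟩) and explains the term g⟨q,p⟩dh in the bracket of the inverse image. -/
theorem smul_bracket (φ : X.O U) (q p : M.Sec U) :
    Q.bracket U (φ • q) p = φ • Q.bracket U q p - (Q.anchor U p).act φ • q +
      Q.pairing U q p • Q.coanchor U (Form.d φ) := by
  rw [Q.bracket_swap, Q.bracket_smul, map_smul, LinearMap.smul_apply, smul_eq_mul, Form.d_mul,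
    map_add, map_smul, map_smul, Q.bracket_swap q p]
  module

/-- Both [p, π†dφ] and the symmetric part equal π†d(π(p)φ), so they cancel. -/
theorem coanchor_d_bracket (φ : X.O U) (p : M.Sec U) :
    Q.bracket U (Q.coanchor U (Form.d φ)) p = 0 := by
  rw [Q.bracket_swap, Q.bracket_coanchor, Form.lie_d, Q.pairing_symm, Q.pairing_coanchor,
    Form.d_ap, neg_add_cancel]

theorem coanchor_d_pairing (φ : X.O U) (p : M.Sec U) :
    Q.pairing U (Q.coanchor U (Form.d φ)) p = (Q.anchor U p).act φ := by
  rw [Q.pairing_symm, Q.pairing_coanchor, Form.d_ap]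

end CourantStr

/-! ### Triples as families of stalk elements. -/

namespace InverseImage

variable {Y : Mfd.{w₁, w₂} 𝕜 K n} {X : Mfd.{u, v} 𝕜 K n} (f : Y.Hom X)
  {M : SMod.{u, v, w} X} (Q : CourantStr M)

/-- The inclusion of germs of `1`-forms in the stalk of the inverse image. -/
noncomputable def omegaAt (y : Y) : (forms Y 1).Germ y →ₗ[Y.OGerm y] Stalk f Q y :=
  LinearMap.inl _ (PreStalk f M y ⧸ relations f Q y) ((tangent Y).Germ y) ∘ₗ
    (relations f Q y).mkQ ∘ₗ LinearMap.inl _ _ _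

/-- The map sending the germ of a section of `M` to the class of its pull-back. -/
noncomputable def tauAt (y : Y) : M.toPMod.Germ (f y) →+ Stalk f Q y :=
  (LinearMap.inl (Y.OGerm y) (PreStalk f M y ⧸ relations f Q y) ((tangent Y).Germ y) ∘ₗ
    (relations f Q y).mkQ ∘ₗ LinearMap.inr _ _ _).toAddMonoidHom.comp
      (TensorProduct.mk (X.OGerm (f y)) (Y.OGerm y) _ 1).toAddMonoidHom

theorem tauAt_smul (y : Y) (a : X.OGerm (f y)) (m : M.toPMod.Germ (f y)) :
    tauAt f Q y (a • m) = pullGerm f y a • tauAt f Q y m := by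
  have : (1 : Y.OGerm y) ⊗ₜ[X.OGerm (f y)] (a • m) = pullGerm f y a • (1 : Y.OGerm y) ⊗ₜ m := by
    rw [← TensorProduct.smul_tmul, TensorProduct.smul_tmul', algebra_smul_def, smul_eq_mul]
  change (LinearMap.inl (Y.OGerm y) (PreStalk f M y ⧸ relations f Q y) ((tangent Y).Germ y) ∘ₗ
    (relations f Q y).mkQ ∘ₗ LinearMap.inr _ _ _) ((1 : Y.OGerm y) ⊗ₜ[X.OGerm (f y)] (a • m)) = _
  rw [this, map_smul]
  rfl

/-- Splits a class into its form, tensor and vector parts, so that identities between triples become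
linear algebra in `omega`, `tau` and `sigma`. -/
theorem mk_eq_sum (y : Y) {ι : Type*} (s : Finset ι) (α : (forms Y 1).Germ y)
    (h : ι → Y.OGerm y) (m : ι → M.toPMod.Germ (f y)) (ζ : (tangent Y).Germ y) :
    ((Submodule.Quotient.mk (α, ∑ i ∈ s, h i ⊗ₜ m i), ζ) : Stalk f Q y) =
      omegaAt f Q y α + ∑ i ∈ s, h i • tauAt f Q y (m i) + (0, ζ) := by
  have e : ∀ i, h i • tauAt f Q y (m i) =
      (LinearMap.inl (Y.OGerm y) (PreStalk f M y ⧸ relations f Q y) ((tangent Y).Germ y) ∘ₗ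
        (relations f Q y).mkQ ∘ₗ LinearMap.inr _ _ _) (h i ⊗ₜ m i) := by
    intro i
    have : h i ⊗ₜ[X.OGerm (f y)] m i = h i • (1 : Y.OGerm y) ⊗ₜ[X.OGerm (f y)] m i := by
      rw [TensorProduct.smul_tmul', smul_eq_mul, mul_one]
    rw [this, map_smul]
    rfl
  simp only [e]
  rw [← map_sum]
  refine Prod.ext ?_ ?_
  · change (relations f Q y).mkQ _ = (relations f Q y).mkQ _ + (relations f Q y).mkQ _ + 0
    rw [add_zero, ← map_add]
    refine congrArg _ (Prod.ext ?_ ?_)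
    · exact (add_zero _).symm
    · exact (zero_add _).symm
  · change ζ = 0 + 0 + ζ
    rw [add_zero, zero_add]

/-- Restriction of families. -/
def Fam.res {V V' : Opens Y} (h : V' ≤ V) : Fam f Q V →+ Fam f Q V' where
  toFun s := fun y => s ⟨y.1, h y.2⟩
  map_zero' := rfl
  map_add' _ _ := rfl

theorem fam_add {V : Opens Y} (s t : Fam f Q V) (y : V) : (s + t) y = s y + t y := rfl

theorem fam_sum {V : Opens Y} {ι : Type*} (I : Finset ι) (s : ι → Fam f Q V) (y : V) :
    (∑ i ∈ I, s i) y = ∑ i ∈ I, s i y :=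
  map_sum (⟨⟨fun s => s y, rfl⟩, fun _ _ => rfl⟩ : Fam f Q V →+ Stalk f Q y.1) s I

/-- The family of classes of a `1`-form. -/
noncomputable def omega {W : Opens Y} : Form Y 1 W →ₗ[Y.O W] Fam f Q W where
  toFun α := fun y => omegaAt f Q y.1 (gm (P := forms Y 1) y.1 y.2 α)
  map_add' α β := funext fun y => by rw [gm_add, map_add]; rfl
  map_smul' φ α := funext fun y => by rw [gm_smul, map_smul]; rfl

/-- The family of classes of the pull-back of a section. -/
noncomputable def tau {W : Opens Y} {U : Opens X} (hf : W ≤ pre f U) : M.Sec U →+ Fam f Q W where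
  toFun q := fun y => tauAt f Q y.1 (gm (P := M.toPMod) (f y.1) (mem_of hf y.2) q)
  map_zero' := funext fun y => by rw [gm_zero, map_zero]; rfl
  map_add' α β := funext fun y => by rw [gm_add, map_add]; rfl

/-- The family of germs of a vector field. -/
noncomputable def sigma {W : Opens Y} : VField Y W →ₗ[Y.O W] Fam f Q W where
  toFun ξ := fun y => (0, gm (P := tangent Y) y.1 y.2 ξ)
  map_add' α β := funext fun y => by
    refine Prod.ext (add_zero _).symm ?_
    exact gm_add (P := tangent Y) y.2 α β
  map_smul' φ α := funext fun y => by
    refine Prod.ext (smul_zero (og y.1 y.2 φ)).symm ?_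
    exact gm_smul (P := tangent Y) y.2 φ α

theorem omega_apply {W : Opens Y} (α : Form Y 1 W) (y : W) :
    omega f Q α y = omegaAt f Q y.1 (gm (P := forms Y 1) y.1 y.2 α) := rfl

theorem tau_apply {W : Opens Y} {U : Opens X} (hf : W ≤ pre f U) (q : M.Sec U) (y : W) :
    tau f Q hf q y = tauAt f Q y.1 (gm (P := M.toPMod) (f y.1) (mem_of hf y.2) q) := rfl

theorem tau_smul {W : Opens Y} {U : Opens X} (hf : W ≤ pre f U) (φ : X.O U) (q : M.Sec U) :
    tau f Q hf (φ • q) = pull f hf φ • tau f Q hf q := funext fun y => by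
  rw [fam_smul, tau_apply, tau_apply, gm_smul, tauAt_smul, pullGerm_og f hf y.2]

/-- The defining relation of the quotient in the form in which it is used: every passage between
tensor terms and form terms in the later identities goes through it. -/
theorem tau_coanchor_d {W : Opens Y} {U : Opens X} (hf : W ≤ pre f U) (φ : X.O U) :
    tau f Q hf (Q.coanchor U (Form.d φ)) = omega f Q (Form.d (pull f hf φ)) := funext fun y => by
  refine Eq.symm (Prod.ext ((Submodule.Quotient.eq _).2 ?_) rfl)
  have := d_mem_relations f Q hf y.2 φ
  convert this using 1
  refine Prod.ext (sub_zero _) (zero_sub _)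

theorem res_omega {W W' : Opens Y} (h : W' ≤ W) (α : Form Y 1 W) :
    Fam.res f Q h (omega f Q α) = omega f Q (Form.res h α) :=
  funext fun y => congrArg (omegaAt f Q y.1) (gm_res (P := forms Y 1) y.1 h y.2 α).symm

theorem res_tau {W W' : Opens Y} {U U' : Opens X} (hf : W ≤ pre f U) (hf' : W' ≤ pre f U')
    (h : W' ≤ W) (hU : U' ≤ U) (q : M.Sec U) :
    Fam.res f Q h (tau f Q hf q) = tau f Q hf' (M.res hU q) :=
  funext fun y => congrArg (tauAt f Q y.1) (gm_res (P := M.toPMod) (f y.1) hU (mem_of hf' y.2) q).symm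

theorem res_sigma {W W' : Opens Y} (h : W' ≤ W) (ξ : VField Y W) :
    Fam.res f Q h (sigma f Q ξ) = sigma f Q (VField.res h ξ) :=
  funext fun y => Prod.ext rfl (gm_res (P := tangent Y) y.1 h y.2 ξ).symm

namespace Rep

variable {f} {W W' : Opens Y} {U U' : Opens X}

/-- The class of the pair `(α, ∑ᵢ hᵢ ⊗ qᵢ)`. -/
noncomputable def fst (hf : W ≤ pre f U) (r : Rep M W U) : Fam f Q W :=
  omega f Q r.α + ∑ i, r.h i • tau f Q hf (r.q i)

/-- The class of the triple `(α, ∑ᵢ hᵢ ⊗ qᵢ, ξ)`. -/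
noncomputable def val (hf : W ≤ pre f U) (r : Rep M W U) (ξ : VField Y W) : Fam f Q W :=
  fst Q hf r + sigma f Q ξ

/-- The condition `df(ξ) = ∑ᵢ hᵢ ⊗ π(qᵢ)`. -/
def Compat (f : Y.Hom X) (r : Rep M W U) (ξ : VField Y W) : Prop :=
  DfEq f ξ r.h (fun i => Q.anchor U (r.q i))

theorem val_apply (hf : W ≤ pre f U) (r : Rep M W U) (ξ : VField Y W) (y : W) :
    val Q hf r ξ y = (r.cls Q hf y, gm (P := tangent Y) y.1 y.2 ξ) := by
  rw [cls, mk_eq_sum, val, fst, fam_add, fam_add, fam_sum]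
  rfl

/-- Separates the fibre-product condition on df(ξ) from the equality of families, so each can be
verified on its own. -/
theorem represents_iff {hf : W ≤ pre f U} {r : Rep M W U} {ξ : VField Y W} {s : Fam f Q W} :
    r.Represents hf ξ s ↔ r.Compat Q f ξ ∧ s = r.val Q hf ξ := by
  refine and_congr Iff.rfl ⟨fun h => funext fun y => (h y).trans (val_apply Q hf r ξ y).symm,
    fun h y => ?_⟩
  rw [h]
  exact val_apply Q hf r ξ y

theorem Compat.res {r : Rep M W U} {ξ : VField Y W} (H : r.Compat Q f ξ) (hW : W' ≤ W)
    (hU : U' ≤ U) : (r.res hW hU).Compat Q f (VField.res hW ξ) := by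
  have := DfEq.res H hW hU
  simp only [Q.res_anchor] at this
  exact this

theorem res_val (hf : W ≤ pre f U) (hf' : W' ≤ pre f U') (hW : W' ≤ W) (hU : U' ≤ U)
    (r : Rep M W U) (ξ : VField Y W) :
    Fam.res f Q hW (r.val Q hf ξ) = (r.res hW hU).val Q hf' (VField.res hW ξ) := by
  rw [val, val, map_add, res_sigma, fst, fst, map_add, res_omega, map_sum]
  congr 2
  refine Finset.sum_congr rfl fun i _ => ?_
  change _ = Y.resO hW (r.h i) • tau f Q hf' (M.res hU (r.q i))
  rw [← res_tau f Q hf hf' hW hU]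
  funext y
  rw [fam_smul, og_res]
  rfl

theorem cls_eq_of_val_eq {W₂ : Opens Y} {U₂ : Opens X} {hf : W ≤ pre f U} {hf₂ : W₂ ≤ pre f U₂}
    {r : Rep M W U} {r₂ : Rep M W₂ U₂} {ξ : VField Y W} {ξ₂ : VField Y W₂} {y : Y} {hy : y ∈ W}
    {hy₂ : y ∈ W₂} (h : r.val Q hf ξ ⟨y, hy⟩ = r₂.val Q hf₂ ξ₂ ⟨y, hy₂⟩) :
    r.cls Q hf ⟨y, hy⟩ = r₂.cls Q hf₂ ⟨y, hy₂⟩ ∧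
      gm (P := tangent Y) y hy ξ = gm (P := tangent Y) y hy₂ ξ₂ := by
  rw [val_apply, val_apply] at h
  exact Prod.ext_iff.1 h

end Rep

section lift

variable {f} {y : Y} {C : Type*} [AddCommGroup C]

/-- Construction of additive maps on stalks of `(Ω¹_Y ⊕ f^*M) / f^*Ω¹_X`, the conditions being
checked on sections. -/
theorem exists_lift {W : Opens Y} {U : Opens X} (hf : W ≤ pre f U) (hy : y ∈ W)
    (a : (forms Y 1).Germ y →+ C) (b : Y.OGerm y →+ M.toPMod.Germ (f y) →+ C)
    (hb : ∀ (W' : Opens Y) (hW : W' ≤ W) (U' : Opens X) (hU : U' ≤ U) (hf' : W' ≤ pre f U')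
      (hy : y ∈ W') (φ : X.O U') (h : Y.O W') (q : M.Sec U'),
      b (og y hy (pull f hf' φ * h)) (gm (P := M.toPMod) (f y) (mem_of hf' hy) q) =
        b (og y hy h) (gm (P := M.toPMod) (f y) (mem_of hf' hy) (φ • q)))
    (hr : ∀ (W' : Opens Y) (hW : W' ≤ W) (U' : Opens X) (hU : U' ≤ U) (hf' : W' ≤ pre f U')
      (hy : y ∈ W') (c : Y.O W') (ψ : X.O U'),
      a (gm (P := forms Y 1) y hy (c • Form.d (pull f hf' ψ))) =
        b (og y hy c) (gm (P := M.toPMod) (f y) (mem_of hf' hy) (Q.coanchor U' (Form.d ψ)))) :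
    ∃ F : PreStalk f M y →+ C,
      (∀ (ι : Type) (s : Finset ι) (α : (forms Y 1).Germ y) (h : ι → Y.OGerm y)
        (m : ι → M.toPMod.Germ (f y)),
          F (α, ∑ i ∈ s, h i ⊗ₜ m i) = a α + ∑ i ∈ s, b (h i) (m i)) ∧
      ∀ p p' : PreStalk f M y, (Submodule.Quotient.mk p : PreStalk f M y ⧸ relations f Q y) =
        Submodule.Quotient.mk p' → F p = F p' := by
  have hb' : ∀ (r : X.OGerm (f y)) (h : Y.OGerm y) (m : M.toPMod.Germ (f y)),
      b (r • h) m = b h (r • m) := by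
    intro r h m
    -- The three germs are realised one after another on shrinking neighbourhoods, ending with φ and
    -- q on U₂ and h on an open set mapped into U₂.
    obtain ⟨U₁, hU₁, hx₁, φ, rfl⟩ := Mfd.exists_og (mem_of hf hy) r
    obtain ⟨U₂, hU₂, hx₂, q, rfl⟩ := PMod.exists_germ (P := M.toPMod) hx₁ m
    obtain ⟨W', hW', hy', h, rfl⟩ := Mfd.exists_og
      (show y ∈ W ⊓ pre f U₂ from ⟨hy, hx₂⟩) h
    rw [← og_res (f y) hU₂ hx₂ φ]
    have := hb W' (hW'.trans inf_le_left) U₂ (hU₂.trans hU₁) (hW'.trans inf_le_right) hy'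
      (X.resO hU₂ φ) h q
    rw [gm_smul] at this
    refine Eq.trans (congrArg (fun c => b c _) ?_) this
    rw [og_mul, ← pullGerm_og]
    rfl
  refine ⟨preLift a b hb', fun ι s α h m => preLift_apply a b hb' s α h m,
    fun p p' e => preLift_eq (Q := Q) a b hb' ?_ e⟩
  intro c W₁ U₁ hf₁ hy₁ ψ
  obtain ⟨W', hW', hy', c, rfl⟩ := Mfd.exists_og
    (show y ∈ W ⊓ pre f (U ⊓ U₁) ⊓ W₁ from ⟨⟨hy, hf hy, hf₁ hy₁⟩, hy₁⟩) c
  have h1 : W' ≤ pre f (U ⊓ U₁) := hW'.trans (inf_le_left.trans inf_le_right)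
  have := hr W' (hW'.trans (inf_le_left.trans inf_le_left)) (U ⊓ U₁) inf_le_left h1 hy' c
    (X.resO inf_le_right ψ)
  rw [gm_smul] at this
  refine Eq.trans (congrArg (fun g => a (_ • g)) ?_) (this.trans (congrArg (b _) ?_))
  · exact (gm_res (P := forms Y 1) y (hW'.trans inf_le_right) hy' (Form.d (pull f hf₁ ψ))).symm
  · rw [← Form.res_d, ← Q.res_coanchor]
    exact gm_res (P := M.toPMod) (f y) inf_le_right (mem_of h1 hy') _

end lift

end InverseImage

end Families

/-! ### Bracket and pairing depend only on classes. -/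

section WellDefined

variable {𝕜 K : Type} [RCLike 𝕜] [RCLike K] [NormedAlgebra 𝕜 K] {n : WithTop ℕ∞}
  [Fact (n = ∞ ∨ n = ω)]

open Mfd PMod

namespace InverseImage

variable {Y : Mfd.{w₁, w₂} 𝕜 K n} {X : Mfd.{u, v} 𝕜 K n} {f : Y.Hom X}
  {M : SMod.{u, v, w} X} (Q : CourantStr M)

namespace Rep

variable {W W' : Opens Y} {U U' : Opens X}

/-- The part of the bracket of `h ⊗ q` with `(β, ∑ⱼ gⱼ ⊗ pⱼ, η)` which depends on `h ⊗ q`. -/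
noncomputable def tensorBracket (hf : W ≤ pre f U) (r' : Rep M W U) (η : VField Y W) (h : Y.O W)
    (q : M.Sec U) : Fam f Q W :=
  ∑ j, ((r'.h j * pull f hf (Q.pairing U q (r'.q j))) • omega f Q (Form.d h) +
    (h * r'.h j) • tau f Q hf (Q.bracket U q (r'.q j))) - η.act h • tau f Q hf q

/-- Sorts the bracket into the part additive in (α, ∑ hᵢ⊗qᵢ) and the part involving only ξ and the
second triple. For fixed ξ only the former has to be descended to classes. -/
theorem fst_bracket (hf : W ≤ pre f U) (r : Rep M W U) (ξ : VField Y W) (r' : Rep M W U)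
    (η : VField Y W) : (r.bracket Q hf ξ r' η).fst Q hf =
      -omega f Q (Form.iotaD η r.α) + ∑ i, tensorBracket Q hf r' η (r.h i) (r.q i) +
        (omega f Q (Form.lie ξ r'.α) + ∑ j, ξ.act (r'.h j) • tau f Q hf (r'.q j)) := by
  have h1 : (r.bracket Q hf ξ r' η).fst Q hf =
      omega f Q (-Form.iotaD η r.α + Form.lie ξ r'.α +
        ∑ i, ∑ j, (r'.h j * pull f hf (Q.pairing U (r.q i) (r'.q j))) • Form.d (r.h i)) +
      ∑ a : (r.ι × r'.ι) ⊕ (r.ι ⊕ r'.ι), (Sum.elim (fun a => r.h a.1 * r'.h a.2)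
        (Sum.elim (fun i => -η.act (r.h i)) (fun j => ξ.act (r'.h j))) a : Y.O W) •
        tau f Q hf (Sum.elim (fun a => Q.bracket U (r.q a.1) (r'.q a.2))
          (Sum.elim r.q r'.q) a) := rfl
  rw [h1, Fintype.sum_sum_type, Fintype.sum_sum_type, Fintype.sum_prod_type]
  simp only [Sum.elim_inl, Sum.elim_inr, map_add, map_neg, map_sum, map_smul, tensorBracket,
    Finset.sum_sub_distrib, Finset.sum_add_distrib, neg_smul, Finset.sum_neg_distrib]
  abel

/-- Balancedness of the bracket. The two error terms of [φq,p] are matched as follows: π†dφ becomes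
d(φ∘f) by the relation, and η(φ∘f) = ∑ gⱼ f^*(π(pⱼ)φ) by compatibility of the second triple. -/
theorem tensorBracket_smul (hf : W ≤ pre f U) {r' : Rep M W U} {η : VField Y W}
    (H : r'.Compat Q f η) (φ : X.O U) (h : Y.O W) (q : M.Sec U) :
    tensorBracket Q hf r' η (pull f hf φ * h) q = tensorBracket Q hf r' η h (φ • q) := by
  have e := DfEq.act_pull H hf φ
  rw [tensorBracket, tensorBracket, VField.act_mul, e, tau_smul, add_smul, Finset.mul_sum,
    Finset.sum_smul, add_comm, ← sub_sub, ← Finset.sum_sub_distrib]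
  congr 1
  swap
  · module
  refine Finset.sum_congr rfl fun j _ => ?_
  rw [Q.smul_bracket, map_smul, LinearMap.smul_apply, smul_eq_mul, map_mul, map_add, map_sub,
    tau_smul, tau_smul, tau_smul, tau_coanchor_d, Form.d_mul, map_add, map_smul, map_smul]
  module

/-- The bracket kills the relations. Since [π†dψ,p] = 0 and ⟨π†dψ,p⟩ = π(p)ψ, compatibility leaves
η(ψ∘f)dc - η(c)d(ψ∘f), which is -ι_η d(c d(ψ∘f)). -/
theorem tensorBracket_coanchor_d (hf : W ≤ pre f U) {r' : Rep M W U} {η : VField Y W}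
    (H : r'.Compat Q f η) (c : Y.O W) (ψ : X.O U) :
    tensorBracket Q hf r' η c (Q.coanchor U (Form.d ψ)) =
      -omega f Q (Form.iotaD η (c • Form.d (pull f hf ψ))) := by
  have e := DfEq.act_pull H hf ψ
  rw [tensorBracket, Form.iotaD_smul_d, tau_coanchor_d, map_sub, map_smul, map_smul, e,
    Finset.sum_smul]
  simp only [Q.coanchor_d_bracket, Q.coanchor_d_pairing, map_zero, smul_zero, add_zero]
  abel

theorem res_self (r : Rep M W U) : r.res le_rfl le_rfl = r := by
  obtain ⟨α, ι, h, q⟩ := r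
  simp only [res, M.res_self]
  rfl

/-- The germ version of `tensorBracket`. -/
noncomputable def germTensorBracket (hf : W ≤ pre f U) (r' : Rep M W U) (η : VField Y W) {y : Y}
    (hy : y ∈ W) : Y.OGerm y →+ M.toPMod.Germ (f y) →+ Stalk f Q y :=
  AddMonoidHom.mk' (fun h => AddMonoidHom.mk' (fun m =>
      ∑ j, ((og y hy (r'.h j) * pullGerm f y (Q.germPairing (r'.q j) (mem_of hf hy) m)) •
        omegaAt f Q y (germD y h) + (h * og y hy (r'.h j)) •
          tauAt f Q y (Q.germBracket (r'.q j) (mem_of hf hy) m)) -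
            η.germAct hy h • tauAt f Q y m)
      (fun m m' => by
        simp only [map_add, mul_add, smul_add, add_smul, Finset.sum_add_distrib]
        abel))
    (fun h h' => by
      refine AddMonoidHom.ext fun m => ?_
      simp only [map_add, add_mul, smul_add, add_smul, Finset.sum_add_distrib,
        AddMonoidHom.add_apply, AddMonoidHom.mk'_apply]
      abel)

theorem germTensorBracket_gm (hf : W ≤ pre f U) (r' : Rep M W U) (η : VField Y W) {y : Y}
    (hW : W' ≤ W) (hU : U' ≤ U) (hf' : W' ≤ pre f U') (hy : y ∈ W') (h : Y.O W')
    (q : M.Sec U') :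
    germTensorBracket Q hf r' η (hW hy) (og y hy h) (gm (P := M.toPMod) (f y) (mem_of hf' hy) q) =
      tensorBracket Q hf' (r'.res hW hU) (VField.res hW η) h q ⟨y, hy⟩ := by
  have e : ∀ j, (og y (hW hy) (r'.h j) * pullGerm f y (Q.germPairing (r'.q j)
      (mem_of hf (hW hy)) (gm (P := M.toPMod) (f y) (mem_of hf' hy) q))) •
        omegaAt f Q y (germD y (og y hy h)) + (og y hy h * og y (hW hy) (r'.h j)) •
          tauAt f Q y (Q.germBracket (r'.q j) (mem_of hf (hW hy))
            (gm (P := M.toPMod) (f y) (mem_of hf' hy) q)) =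
      (((Y.resO hW (r'.h j) * pull f hf' (Q.pairing U' q (M.res hU (r'.q j)))) •
        omega f Q (Form.d h) + (h * Y.resO hW (r'.h j)) •
          tau f Q hf' (Q.bracket U' q (M.res hU (r'.q j)))) : Fam f Q W') ⟨y, hy⟩ := by
    intro j
    rw [fam_add, fam_smul, fam_smul, og_mul, og_mul,
      ← Q.germBracket_res hU (r'.q j) (mem_of hf' hy),
      ← Q.germPairing_res hU (r'.q j) (mem_of hf' hy), Q.germBracket_gm, Q.germPairing_gm,
      pullGerm_og f hf' hy, germD_og, og_res y hW hy, omega_apply, tau_apply]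
  have e' : η.germAct (hW hy) (og y hy h) = og y hy ((VField.res hW η).act h) := by
    rw [← VField.germAct_res hW η hy, VField.germAct_og]
  have e'' : ((VField.res hW η).act h • tau f Q hf' q) ⟨y, hy⟩ =
      og y hy ((VField.res hW η).act h) •
        tauAt f Q y (gm (P := M.toPMod) (f y) (mem_of hf' hy) q) := fam_smul f Q _ _ _
  have e3 : tensorBracket Q hf' (r'.res hW hU) (VField.res hW η) h q ⟨y, hy⟩ =
      (∑ j, ((Y.resO hW (r'.h j) * pull f hf' (Q.pairing U' q (M.res hU (r'.q j)))) •
        omega f Q (Form.d h) + (h * Y.resO hW (r'.h j)) •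
          tau f Q hf' (Q.bracket U' q (M.res hU (r'.q j)))) : Fam f Q W') ⟨y, hy⟩ -
        ((VField.res hW η).act h • tau f Q hf' q) ⟨y, hy⟩ := rfl
  rw [e3, e'', fam_sum, ← e']
  exact congrArg₂ (· - ·) (Finset.sum_congr rfl fun j _ => e j) rfl

/-- The bracket depends only on the class of its first argument. -/
theorem fst_bracket_congr_left (hf : W ≤ pre f U) (r r₂ : Rep M W U) (ξ : VField Y W)
    {r' : Rep M W U} {η : VField Y W} (H : r'.Compat Q f η) (y : W)
    (h : r.cls Q hf y = r₂.cls Q hf y) :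
    (r.bracket Q hf ξ r' η).fst Q hf y = (r₂.bracket Q hf ξ r' η).fst Q hf y := by
  obtain ⟨y, hy⟩ := y
  -- Form germs go to the class of -ι_η dα and tensors to `tensorBracket`. The two preceding lemmas
  -- are exactly the conditions for this pair to descend.
  obtain ⟨F, hF, hF'⟩ := exists_lift Q hf hy
    (-(omegaAt f Q y).toAddMonoidHom.comp (η.germIotaD hy)) (germTensorBracket Q hf r' η hy)
    (fun W' hW U' hU hf' hy' φ h q => by
      rw [germTensorBracket_gm Q hf r' η hW hU hf', germTensorBracket_gm Q hf r' η hW hU hf',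
        tensorBracket_smul Q hf' (H.res Q hW hU)])
    (fun W' hW U' hU hf' hy' c ψ => by
      rw [germTensorBracket_gm Q hf r' η hW hU hf',
        tensorBracket_coanchor_d Q hf' (H.res Q hW hU), ← map_neg, omega_apply,
        gm_neg (P := forms Y 1) hy', map_neg]
      change -omegaAt f Q y (η.germIotaD (hW hy') _) = _
      rw [← VField.germIotaD_res hW η hy', VField.germIotaD_gm])
  have key : ∀ r : Rep M W U, (r.bracket Q hf ξ r' η).fst Q hf ⟨y, hy⟩ =
      F (gm (P := forms Y 1) y hy r.α,
        ∑ i, og y hy (r.h i) ⊗ₜ gm (P := M.toPMod) (f y) (mem_of hf hy) (r.q i)) +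
      (omega f Q (Form.lie ξ r'.α) + ∑ j, ξ.act (r'.h j) • tau f Q hf (r'.q j)) ⟨y, hy⟩ := by
    intro r
    rw [fst_bracket, fam_add, hF, fam_add, fam_sum]
    congr 2
    · rw [← map_neg, omega_apply, gm_neg (P := forms Y 1) hy, map_neg]
      change _ = -(omegaAt f Q y (η.germIotaD hy _))
      rw [VField.germIotaD_gm]
    · refine Finset.sum_congr rfl fun i _ => ?_
      rw [germTensorBracket_gm Q hf r' η le_rfl le_rfl hf, res_self]
      rfl
  rw [key, key, hF' _ _ h]

theorem pair_comm (hf : W ≤ pre f U) (r : Rep M W U) (ξ : VField Y W) (r' : Rep M W U)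
    (η : VField Y W) : r.pair Q hf ξ r' η = r'.pair Q hf η r ξ := by
  rw [pair, pair, Finset.sum_comm, add_right_comm]
  congr 2
  refine Finset.sum_congr rfl fun j _ => Finset.sum_congr rfl fun i _ => ?_
  rw [Q.pairing_symm]
  ring

/-- The pairing depends only on the class of its first argument. -/
theorem og_pair_congr_left (hf : W ≤ pre f U) (r r₂ : Rep M W U) (ξ : VField Y W)
    {r' : Rep M W U} {η : VField Y W} (H : r'.Compat Q f η) (y : W)
    (h : r.cls Q hf y = r₂.cls Q hf y) :
    og y.1 y.2 (r.pair Q hf ξ r' η) = og y.1 y.2 (r₂.pair Q hf ξ r' η) := by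
  obtain ⟨y, hy⟩ := y
  let b : Y.OGerm y →+ M.toPMod.Germ (f y) →+ Y.OGerm y :=
    AddMonoidHom.mk' (fun h => AddMonoidHom.mk' (fun m =>
      ∑ j, h * (og y hy (r'.h j) * pullGerm f y (Q.germPairing (r'.q j) (mem_of hf hy) m)))
      (fun m m' => by simp only [map_add, mul_add, Finset.sum_add_distrib]))
      (fun h h' => by
        refine AddMonoidHom.ext fun m => ?_
        simp only [add_mul, Finset.sum_add_distrib, AddMonoidHom.add_apply, AddMonoidHom.mk'_apply])
  have hab : ∀ (W' : Opens Y) (hW : W' ≤ W) (U' : Opens X) (hU : U' ≤ U) (hf' : W' ≤ pre f U')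
      (hy' : y ∈ W') (h : Y.O W') (q : M.Sec U'),
      b (og y hy' h) (gm (P := M.toPMod) (f y) (mem_of hf' hy') q) =
        og y hy' (∑ j, h * (Y.resO hW (r'.h j) *
          pull f hf' (Q.pairing U' q (M.res hU (r'.q j))))) := by
    intro W' hW U' hU hf' hy' h q
    refine Eq.trans ?_ (map_sum (ogHom y hy') _ _).symm
    refine Finset.sum_congr rfl fun j _ => ?_
    change _ = og y hy' _
    rw [og_mul, og_mul, og_res, ← Q.germPairing_res hU (r'.q j) (mem_of hf' hy'),
      Q.germPairing_gm, pullGerm_og f hf' hy']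
  -- The relations are respected because contracting c d(ψ∘f) with η gives ∑ c gⱼ f^*(π(pⱼ)ψ), which
  -- is the pairing of c⊗π†dψ with the second triple.
  obtain ⟨F, hF, hF'⟩ := exists_lift Q hf hy (η.germAp hy) b
    (fun W' hW U' hU hf' hy' φ h q => by
      rw [hab W' hW U' hU hf', hab W' hW U' hU hf']
      refine congrArg _ (Finset.sum_congr rfl fun j _ => ?_)
      rw [map_smul, LinearMap.smul_apply, smul_eq_mul, map_mul]
      ring)
    (fun W' hW U' hU hf' hy' c ψ => by
      rw [hab W' hW U' hU hf', ← VField.germAp_res hW η hy', VField.germAp_gm, Form.smul_ap,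
        Form.d_ap, DfEq.act_pull (H.res Q hW hU) hf', Finset.mul_sum]
      refine congrArg _ (Finset.sum_congr rfl fun j _ => ?_)
      rw [Q.coanchor_d_pairing]
      rfl)
  have key : ∀ r : Rep M W U, og y hy (r.pair Q hf ξ r' η) =
      F (gm (P := forms Y 1) y hy r.α,
        ∑ i, og y hy (r.h i) ⊗ₜ gm (P := M.toPMod) (f y) (mem_of hf hy) (r.q i)) +
      og y hy (r'.α.ap ξ) := by
    intro r
    rw [hF, VField.germAp_gm, pair, og_add, og_add, add_comm, ← add_assoc]
    congr 2
    refine (map_sum (ogHom y hy) _ _).trans ?_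
    refine Finset.sum_congr rfl fun i _ => ?_
    refine Eq.trans ?_ (hab W le_rfl U le_rfl hf hy (r.h i) (r.q i)).symm
    refine congrArg (og y hy) (Finset.sum_congr rfl fun j _ => ?_)
    rw [M.res_self, mul_assoc]
    rfl
  rw [key, key, hF' _ _ h]

theorem fst_bracket_eq_sum (hf : W ≤ pre f U) (r : Rep M W U) (ξ : VField Y W) (r' : Rep M W U)
    (η : VField Y W) : (r.bracket Q hf ξ r' η).fst Q hf =
      -omega f Q (Form.iotaD η r.α) + omega f Q (Form.lie ξ r'.α) +
      ∑ i, ∑ j, ((r'.h j * pull f hf (Q.pairing U (r.q i) (r'.q j))) •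
        omega f Q (Form.d (r.h i)) +
        (r.h i * r'.h j) • tau f Q hf (Q.bracket U (r.q i) (r'.q j))) -
      ∑ i, η.act (r.h i) • tau f Q hf (r.q i) + ∑ j, ξ.act (r'.h j) • tau f Q hf (r'.q j) := by
  rw [fst_bracket]
  simp only [tensorBracket, Finset.sum_sub_distrib]
  abel

/-- The symmetric part of the bracket is the differential of the pairing. -/
theorem fst_bracket_add_fst_bracket (hf : W ≤ pre f U) (r : Rep M W U) (ξ : VField Y W)
    (r' : Rep M W U) (η : VField Y W) :
    (r.bracket Q hf ξ r' η).fst Q hf + (r'.bracket Q hf η r ξ).fst Q hf =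
      omega f Q (Form.d (r.pair Q hf ξ r' η)) := by
  rw [fst_bracket_eq_sum, fst_bracket_eq_sum, pair, Form.d_add, Form.d_add, map_add, map_add,
    Form.d_sum, map_sum]
  rw [Finset.sum_comm (s := (Finset.univ : Finset r'.ι))]
  -- The product rule gives three terms. Those in dhᵢ and dgⱼ occur in the two brackets, and the one
  -- in d⟨qᵢ,pⱼ⟩ is the class of [qᵢ,pⱼ] + [pⱼ,qᵢ] by the relation.
  have e : ∑ i, omega f Q (Form.d (∑ j, r.h i * r'.h j * pull f hf (Q.pairing U (r.q i) (r'.q j))))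
      = (∑ i, ∑ j, ((r'.h j * pull f hf (Q.pairing U (r.q i) (r'.q j))) •
        omega f Q (Form.d (r.h i)) +
        (r.h i * r'.h j) • tau f Q hf (Q.bracket U (r.q i) (r'.q j)))) +
      ∑ i, ∑ j, ((r.h i * pull f hf (Q.pairing U (r'.q j) (r.q i))) •
        omega f Q (Form.d (r'.h j)) +
        (r'.h j * r.h i) • tau f Q hf (Q.bracket U (r'.q j) (r.q i))) := by
    rw [← Finset.sum_add_distrib]
    refine Finset.sum_congr rfl fun i _ => ?_
    rw [← Finset.sum_add_distrib, Form.d_sum, map_sum]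
    refine Finset.sum_congr rfl fun j _ => ?_
    rw [Form.d_mul, Form.d_mul, map_add, map_smul, map_smul, map_add, map_smul, map_smul,
      Q.bracket_swap (r'.q j), map_add, map_neg, tau_coanchor_d, Q.pairing_symm (r'.q j)]
    module
  rw [e]
  simp only [Form.iotaD, map_sub]
  abel

theorem val_bracket_add_val_bracket (hf : W ≤ pre f U) (r : Rep M W U) (ξ : VField Y W)
    (r' : Rep M W U) (η : VField Y W) :
    (r.bracket Q hf ξ r' η).val Q hf ⁅ξ, η⁆ + (r'.bracket Q hf η r ξ).val Q hf ⁅η, ξ⁆ =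
      omega f Q (Form.d (r.pair Q hf ξ r' η)) := by
  rw [val, val, ← fst_bracket_add_fst_bracket, VField.bracket_swap η ξ, map_neg]
  abel

theorem bracket_res (hf : W ≤ pre f U) (hf' : W' ≤ pre f U') (hW : W' ≤ W) (hU : U' ≤ U)
    (r : Rep M W U) (ξ : VField Y W) (r' : Rep M W U) (η : VField Y W) :
    (r.bracket Q hf ξ r' η).res hW hU =
      (r.res hW hU).bracket Q hf' (VField.res hW ξ) (r'.res hW hU) (VField.res hW η) := by
  have e1 : ((r.bracket Q hf ξ r' η).res hW hU).α =
      ((r.res hW hU).bracket Q hf' (VField.res hW ξ) (r'.res hW hU) (VField.res hW η)).α := by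
    change Form.res hW (_ + _ + _) = _ + _ + _
    rw [map_add, map_add, map_neg, Form.res_lie, Form.res_iotaD, map_sum]
    refine congrArg₂ (· + ·) rfl (Finset.sum_congr rfl fun i _ => ?_)
    rw [map_sum]
    refine Finset.sum_congr rfl fun j _ => ?_
    change Form.res hW (_ • _) =
      (Y.resO hW (r'.h j) * pull f hf' (Q.pairing U' (M.res hU (r.q i)) (M.res hU (r'.q j)))) •
        Form.d (Y.resO hW (r.h i))
    rw [← Q.res_pairing, Form.res_smul, map_mul]
    rfl
  have e2 : ((r.bracket Q hf ξ r' η).res hW hU).h =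
      ((r.res hW hU).bracket Q hf' (VField.res hW ξ) (r'.res hW hU) (VField.res hW η)).h := by
    funext a
    rcases a with ⟨i, j⟩ | i | j
    · exact map_mul (Y.resO hW) _ _
    · exact (map_neg (Y.resO hW) _).trans (congrArg Neg.neg (VField.res_act hW η (r.h i)).symm)
    · exact (VField.res_act hW ξ (r'.h j)).symm
  have e3 : ((r.bracket Q hf ξ r' η).res hW hU).q =
      ((r.res hW hU).bracket Q hf' (VField.res hW ξ) (r'.res hW hU) (VField.res hW η)).q := by
    funext a
    rcases a with ⟨i, j⟩ | i | j
    · exact Q.res_bracket hU _ _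
    · rfl
    · rfl
  have key : ∀ (a b : Rep M W' U') (hι : a.ι = b.ι) (hfin : HEq a.fin b.fin),
      a.α = b.α → HEq a.h b.h → HEq a.q b.q → a = b := by
    rintro ⟨α, ι, h, q⟩ ⟨α', ι', h', q'⟩ hι hfin hα hh hq
    dsimp only at hι
    subst hι
    obtain rfl := eq_of_heq hfin
    obtain rfl := eq_of_heq hh
    obtain rfl := eq_of_heq hq
    obtain rfl := hα
    rfl
  exact key _ _ rfl HEq.rfl e1 (heq_of_eq e2) (heq_of_eq e3)

theorem resO_pair (hf : W ≤ pre f U) (hf' : W' ≤ pre f U') (hW : W' ≤ W) (hU : U' ≤ U)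
    (r : Rep M W U) (ξ : VField Y W) (r' : Rep M W U) (η : VField Y W) :
    Y.resO hW (r.pair Q hf ξ r' η) =
      (r.res hW hU).pair Q hf' (VField.res hW ξ) (r'.res hW hU) (VField.res hW η) := by
  rw [pair, pair, map_add, map_add, ← Form.res_ap, ← Form.res_ap, map_sum]
  refine congrArg₂ (· + ·) (congrArg₂ (· + ·) (Finset.sum_congr rfl fun i _ => ?_) rfl) rfl
  rw [map_sum]
  refine Finset.sum_congr rfl fun j _ => ?_
  rw [map_mul, map_mul]
  change _ = _ * pull f hf' (Q.pairing U' (M.res hU (r.q i)) (M.res hU (r'.q j)))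
  rw [← Q.res_pairing]
  rfl

theorem exists_common {W W₂ : Opens Y} {y : Y} (hy : y ∈ W) (hy₂ : y ∈ W₂) {ξ η : VField Y W}
    {ξ₂ η₂ : VField Y W₂} (h : gm (P := tangent Y) y hy ξ = gm (P := tangent Y) y hy₂ ξ₂)
    (h' : gm (P := tangent Y) y hy η = gm (P := tangent Y) y hy₂ η₂) :
    ∃ (V : Opens Y) (hV : V ≤ W) (hV₂ : V ≤ W₂), y ∈ V ∧ VField.res hV ξ = VField.res hV₂ ξ₂ ∧
      VField.res hV η = VField.res hV₂ η₂ := by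
  obtain ⟨V, hV, h1, h2, e⟩ := (gm_eq_iff (P := tangent Y)).1 h
  obtain ⟨V', hV', h1', h2', e'⟩ := (gm_eq_iff (P := tangent Y)).1 h'
  exact ⟨V ⊓ V', inf_le_left.trans h1, inf_le_left.trans h2, ⟨hV, hV'⟩,
    congrArg (VField.res (inf_le_left : V ⊓ V' ≤ V)) e,
    congrArg (VField.res (inf_le_right : V ⊓ V' ≤ V')) e'⟩

/-- After shrinking, the two pairs of triples live on the same open sets with the same vector
fields. The arguments are then replaced one at a time: the first by the results above, the second by
symmetry. -/
theorem bracket_pair_congr {W₂ : Opens Y} {U₂ : Opens X} {hf : W ≤ pre f U} {hf₂ : W₂ ≤ pre f U₂}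
    {r r' : Rep M W U} {r₂ r₂' : Rep M W₂ U₂} {ξ η : VField Y W} {ξ₂ η₂ : VField Y W₂}
    (H : r.Compat Q f ξ) (H' : r'.Compat Q f η) (H₂ : r₂.Compat Q f ξ₂) (H₂' : r₂'.Compat Q f η₂)
    {y : Y} (hy : y ∈ W) (hy₂ : y ∈ W₂) (h : r.val Q hf ξ ⟨y, hy⟩ = r₂.val Q hf₂ ξ₂ ⟨y, hy₂⟩)
    (h' : r'.val Q hf η ⟨y, hy⟩ = r₂'.val Q hf₂ η₂ ⟨y, hy₂⟩) :
    (r.bracket Q hf ξ r' η).val Q hf ⁅ξ, η⁆ ⟨y, hy⟩ =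
      (r₂.bracket Q hf₂ ξ₂ r₂' η₂).val Q hf₂ ⁅ξ₂, η₂⁆ ⟨y, hy₂⟩ ∧
    og y hy (r.pair Q hf ξ r' η) = og y hy₂ (r₂.pair Q hf₂ ξ₂ r₂' η₂) := by
  -- The third components of equal stalk elements are equal germs of vector fields, so the fields
  -- themselves coincide on a smaller neighbourhood.
  obtain ⟨V, hV, hV₂, hyV, e, e'⟩ := exists_common hy hy₂ (cls_eq_of_val_eq Q h).2
    (cls_eq_of_val_eq Q h').2
  let U₃ := U ⊓ U₂
  have hU : U₃ ≤ U := inf_le_left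
  have hU₂ : U₃ ≤ U₂ := inf_le_right
  have hfV : V ≤ pre f U₃ := fun z hz => ⟨hf (hV hz), hf₂ (hV₂ hz)⟩
  have K : ∀ {s : Rep M W U} {ζ : VField Y W}, s.val Q hf ζ ⟨y, hy⟩ =
      (s.res hV hU).val Q hfV (VField.res hV ζ) ⟨y, hyV⟩ := fun {s ζ} =>
    congrFun (res_val Q hf hfV hV hU s ζ) ⟨y, hyV⟩
  have K₂ : ∀ {s : Rep M W₂ U₂} {ζ : VField Y W₂}, s.val Q hf₂ ζ ⟨y, hy₂⟩ =
      (s.res hV₂ hU₂).val Q hfV (VField.res hV₂ ζ) ⟨y, hyV⟩ := fun {s ζ} =>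
    congrFun (res_val Q hf₂ hfV hV₂ hU₂ s ζ) ⟨y, hyV⟩
  have L := H.res Q hV hU
  have L' := H'.res Q hV hU
  have L₂ := H₂.res Q hV₂ hU₂
  have L₂' := H₂'.res Q hV₂ hU₂
  rw [K, K₂] at h h'
  rw [K, K₂, bracket_res Q hf hfV, bracket_res Q hf₂ hfV, VField.res_bracket, VField.res_bracket,
    ← og_res y hV hyV, ← og_res y hV₂ hyV, resO_pair Q hf hfV hV hU, resO_pair Q hf₂ hfV hV₂ hU₂]
  rw [← e] at h L₂ ⊢
  rw [← e'] at h' L₂' ⊢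
  have c := (cls_eq_of_val_eq Q h).1
  have c' := (cls_eq_of_val_eq Q h').1
  generalize r.res hV hU = a at *
  generalize r'.res hV hU = a' at *
  generalize r₂.res hV₂ hU₂ = a₂ at *
  generalize r₂'.res hV₂ hU₂ = a₂' at *
  generalize VField.res hV ξ = ξ at *
  generalize VField.res hV η = η at *
  have p1 := og_pair_congr_left Q hfV a a₂ ξ L' ⟨y, hyV⟩ c
  have p2 := og_pair_congr_left Q hfV a' a₂' η L₂ ⟨y, hyV⟩ c'
  rw [pair_comm, pair_comm Q hfV a₂'] at p2
  refine ⟨?_, p1.trans p2⟩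
  have b1 : (a.bracket Q hfV ξ a' η).val Q hfV ⁅ξ, η⁆ ⟨y, hyV⟩ =
      (a₂.bracket Q hfV ξ a' η).val Q hfV ⁅ξ, η⁆ ⟨y, hyV⟩ := by
    rw [val, val, fam_add, fam_add, fst_bracket_congr_left Q hfV a a₂ ξ L' ⟨y, hyV⟩ c]
  have b2 : (a'.bracket Q hfV η a₂ ξ).val Q hfV ⁅η, ξ⁆ ⟨y, hyV⟩ =
      (a₂'.bracket Q hfV η a₂ ξ).val Q hfV ⁅η, ξ⁆ ⟨y, hyV⟩ := by
    rw [val, val, fam_add, fam_add, fst_bracket_congr_left Q hfV a' a₂' η L₂ ⟨y, hyV⟩ c']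
  -- With a₂ as first argument, the symmetric part is the differential of the pairing, and both the
  -- pairing and the reversed bracket are unchanged when a' is replaced by a₂'. Hence so is the
  -- bracket itself.
  have s1 := congrFun (val_bracket_add_val_bracket Q hfV a₂ ξ a' η) ⟨y, hyV⟩
  have s2 := congrFun (val_bracket_add_val_bracket Q hfV a₂ ξ a₂' η) ⟨y, hyV⟩
  have s3 : omega f Q (Form.d (a₂.pair Q hfV ξ a' η)) ⟨y, hyV⟩ =
      omega f Q (Form.d (a₂.pair Q hfV ξ a₂' η)) ⟨y, hyV⟩ :=
    congrArg (fun g => omegaAt f Q y (germD y g)) p2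
  rw [fam_add] at s1 s2
  rw [b1, ← add_left_inj ((a'.bracket Q hfV η a₂ ξ).val Q hfV ⁅η, ξ⁆ ⟨y, hyV⟩), s1, s3, ← s2, b2]

end Rep

end InverseImage

end WellDefined

/-! ### The Courant algebroid identities on triples. -/

section Axioms

variable {𝕜 K : Type} [RCLike 𝕜] [RCLike K] [NormedAlgebra 𝕜 K] {n : WithTop ℕ∞}
  [Fact (n = ∞ ∨ n = ω)]

open Mfd PMod

theorem Mfd.O_neg_mul {X : Mfd.{u, v} 𝕜 K n} {U : Opens X} (a b : X.O U) : -a * b = -(a * b) :=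
  neg_mul a b

theorem Mfd.O_mul_neg {X : Mfd.{u, v} 𝕜 K n} {U : Opens X} (a b : X.O U) : a * -b = -(a * b) :=
  mul_neg a b

namespace InverseImage

variable {Y : Mfd.{w₁, w₂} 𝕜 K n} {X : Mfd.{u, v} 𝕜 K n} {f : Y.Hom X}
  {M : SMod.{u, v, w} X} (Q : CourantStr M)

namespace Rep

variable {W : Opens Y} {U : Opens X}

/-- Apply ξη - ηξ to φ∘f using the two decompositions. The hᵢgⱼ terms assemble to the anchor of
[qᵢ,pⱼ], and the derivatives of the coefficients give the two remaining tensor terms of the bracket.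
-/
theorem compat_bracket {r r' : Rep M W U} {ξ η : VField Y W} (hf : W ≤ pre f U)
    (H : r.Compat Q f ξ) (H' : r'.Compat Q f η) :
    (r.bracket Q hf ξ r' η).Compat Q f ⁅ξ, η⁆ := by
  intro U' hU W' hW hf' φ
  have key : ∀ {s s' : Rep M W U} {σ τ : VField Y W}, s.Compat Q f σ → s'.Compat Q f τ →
      σ.toFun W' hW (τ.toFun W' hW (pull f hf' φ)) =
        ∑ j, (Y.resO hW (s'.h j) * ∑ i, Y.resO hW (s.h i) * pull f hf'
          ((Q.anchor U (s.q i)).toFun U' hU ((Q.anchor U (s'.q j)).toFun U' hU φ)) +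
        pull f hf' ((Q.anchor U (s'.q j)).toFun U' hU φ) * Y.resO hW (σ.act (s'.h j))) := by
    intro s s' σ τ hs hs'
    rw [hs' U' hU W' hW hf' φ, map_sum]
    refine Finset.sum_congr rfl fun j _ => ?_
    rw [σ.leibniz, hs U' hU W' hW hf']
    exact congrArg (_ + _ * ·) (σ.natural W W' le_rfl hW _)
  change ξ.toFun W' hW (η.toFun W' hW (pull f hf' φ)) -
      η.toFun W' hW (ξ.toFun W' hW (pull f hf' φ)) =
    ∑ a : (r.ι × r'.ι) ⊕ (r.ι ⊕ r'.ι), Y.resO hW (Sum.elim (fun a => r.h a.1 * r'.h a.2)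
        (Sum.elim (fun i => -η.act (r.h i)) (fun j => ξ.act (r'.h j))) a) *
      pull f hf' ((Q.anchor U (Sum.elim (fun a => Q.bracket U (r.q a.1) (r'.q a.2))
        (Sum.elim r.q r'.q) a)).toFun U' hU φ)
  rw [key H H', key H' H, Fintype.sum_sum_type, Fintype.sum_sum_type, Fintype.sum_prod_type]
  have e : ∀ i j, pull f hf' ((Q.anchor U (Q.bracket U (r.q i) (r'.q j))).toFun U' hU φ) =
      pull f hf' ((Q.anchor U (r.q i)).toFun U' hU ((Q.anchor U (r'.q j)).toFun U' hU φ)) -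
      pull f hf' ((Q.anchor U (r'.q j)).toFun U' hU ((Q.anchor U (r.q i)).toFun U' hU φ)) := by
    intro i j
    rw [Q.anchor_bracket, ← map_sub]
    rfl
  simp only [Sum.elim_inl, Sum.elim_inr, e, mul_sub, Finset.sum_sub_distrib,
    Finset.sum_add_distrib, map_neg, map_mul, O_neg_mul, Finset.sum_neg_distrib, Finset.mul_sum]
  rw [Finset.sum_comm (s := (Finset.univ : Finset r'.ι))]
  have e1 : ∀ i j, Y.resO hW (r'.h j) * (Y.resO hW (r.h i) * pull f hf'
      ((Q.anchor U (r.q i)).toFun U' hU ((Q.anchor U (r'.q j)).toFun U' hU φ))) =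
    Y.resO hW (r.h i) * Y.resO hW (r'.h j) * pull f hf'
      ((Q.anchor U (r.q i)).toFun U' hU ((Q.anchor U (r'.q j)).toFun U' hU φ)) :=
    fun i j => by ring
  simp only [e1, ← mul_assoc]
  simp only [mul_comm (pull f hf' _)]
  ring

theorem val_add_bracket (hf : W ≤ pre f U) (r₁ r₂ : Rep M W U) (ξ₁ ξ₂ : VField Y W)
    (r' : Rep M W U) (η : VField Y W) :
    ((r₁.add r₂).bracket Q hf (ξ₁ + ξ₂) r' η).val Q hf ⁅ξ₁ + ξ₂, η⁆ =
      (r₁.bracket Q hf ξ₁ r' η).val Q hf ⁅ξ₁, η⁆ + (r₂.bracket Q hf ξ₂ r' η).val Q hf ⁅ξ₂, η⁆ := by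
  have e : ∑ a, tensorBracket Q hf r' η ((r₁.add r₂).h a) ((r₁.add r₂).q a) =
      ∑ i, tensorBracket Q hf r' η (r₁.h i) (r₁.q i) +
        ∑ i, tensorBracket Q hf r' η (r₂.h i) (r₂.q i) := Fintype.sum_sum_type _
  rw [val, val, val, fst_bracket, fst_bracket, fst_bracket, e, VField.add_bracket, map_add,
    show (r₁.add r₂).α = r₁.α + r₂.α from rfl, Form.iotaD_add, Form.add_lie, map_add, map_add]
  simp only [VField.add_act, add_smul, Finset.sum_add_distrib]
  abel

theorem val_bracket_smul (hf : W ≤ pre f U) (r : Rep M W U) (ξ : VField Y W)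
    (r' : Rep M W U) (η : VField Y W) (φ : Y.O W) :
    (r.bracket Q hf ξ (r'.smul φ) (φ • η)).val Q hf ⁅ξ, φ • η⁆ =
      φ • (r.bracket Q hf ξ r' η).val Q hf ⁅ξ, η⁆ + ξ.act φ • r'.val Q hf η := by
  have e : ∀ (h : Y.O W) (q : M.Sec U), tensorBracket Q hf (r'.smul φ) (φ • η) h q =
      φ • tensorBracket Q hf r' η h q := by
    intro h q
    rw [tensorBracket, tensorBracket, smul_sub, Finset.smul_sum, VField.smul_act, mul_smul]
    congr 1
    refine Finset.sum_congr rfl fun j _ => ?_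
    change ((φ * r'.h j) * pull f hf (Q.pairing U q (r'.q j))) • omega f Q (Form.d h) +
      (h * (φ * r'.h j)) • tau f Q hf (Q.bracket U q (r'.q j)) = _
    module
  have e' : ∑ j, ξ.act ((r'.smul φ).h j) • tau f Q hf ((r'.smul φ).q j) =
      φ • ∑ j, ξ.act (r'.h j) • tau f Q hf (r'.q j) +
        ξ.act φ • ∑ j, r'.h j • tau f Q hf (r'.q j) := by
    rw [Finset.smul_sum, Finset.smul_sum, ← Finset.sum_add_distrib]
    refine Finset.sum_congr rfl fun j _ => ?_
    change ξ.act (φ * r'.h j) • tau f Q hf (r'.q j) = _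
    rw [VField.act_mul]
    module
  rw [val, val, fst_bracket, fst_bracket, val, fst, e', VField.bracket_smul, map_add, map_smul,
    map_smul, show (r'.smul φ).α = φ • r'.α from rfl, Form.smul_iotaD, Form.lie_smul, map_add,
    map_smul, map_smul, map_smul]
  simp only [e, ← Finset.smul_sum]
  module

/-- Allows a bracket to be nested inside another: any sum over its tensor terms splits into the
three kinds of terms in the formula. -/
theorem sum_bracket {N : Type*} [AddCommMonoid N] (hf : W ≤ pre f U) (r : Rep M W U)
    (ξ : VField Y W) (r' : Rep M W U) (η : VField Y W) (F : Y.O W → M.Sec U → N) :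
    ∑ a, F ((r.bracket Q hf ξ r' η).h a) ((r.bracket Q hf ξ r' η).q a) =
      ∑ i, ∑ j, F (r.h i * r'.h j) (Q.bracket U (r.q i) (r'.q j)) +
        (∑ i, F (-η.act (r.h i)) (r.q i) + ∑ j, F (ξ.act (r'.h j)) (r'.q j)) := by
  refine (Fintype.sum_sum_type _).trans ?_
  refine congrArg₂ (· + ·) ?_ ?_
  · exact Fintype.sum_prod_type _
  · exact Fintype.sum_sum_type _

theorem bracket_α (hf : W ≤ pre f U) (r : Rep M W U)
    (ξ : VField Y W) (r' : Rep M W U) (η : VField Y W) : (r.bracket Q hf ξ r' η).α =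
      -Form.iotaD η r.α + Form.lie ξ r'.α +
    ∑ i, ∑ j, (r'.h j * pull f hf (Q.pairing U (r.q i) (r'.q j))) • Form.d (r.h i) := rfl

/-- The expansion is sorted by which tensor factors (i, j, l from the three triples) occur: none,
one, two or three. The Leibniz identity is then compared group by group with the analogous expansion
of the other nesting. -/
theorem fst_bracket_bracket_right (hf : W ≤ pre f U) (r r' r'' : Rep M W U)
    (ξ η ζ : VField Y W) :
    (r.bracket Q hf ξ (r'.bracket Q hf η r'' ζ) ⁅η, ζ⁆).fst Q hf =
      omega f Q (-Form.iotaD ⁅η, ζ⁆ r.α - Form.lie ξ (Form.iotaD ζ r'.α) +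
        Form.lie ξ (Form.lie η r''.α)) -
      ∑ i, (⁅η, ζ⁆ : VField Y W).act (r.h i) • tau f Q hf (r.q i) -
      ∑ j, ξ.act (ζ.act (r'.h j)) • tau f Q hf (r'.q j) +
      ∑ l, ξ.act (η.act (r''.h l)) • tau f Q hf (r''.q l) -
      ∑ i, ∑ j, ((r.h i * ζ.act (r'.h j)) • tau f Q hf (Q.bracket U (r.q i) (r'.q j)) +
        (ζ.act (r'.h j) * pull f hf (Q.pairing U (r.q i) (r'.q j))) •
          omega f Q (Form.d (r.h i))) +
      ∑ i, ∑ l, ((r.h i * η.act (r''.h l)) • tau f Q hf (Q.bracket U (r.q i) (r''.q l)) +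
        (η.act (r''.h l) * pull f hf (Q.pairing U (r.q i) (r''.q l))) •
          omega f Q (Form.d (r.h i))) +
      ∑ j, ∑ l, (ξ.act (r'.h j * r''.h l) • tau f Q hf (Q.bracket U (r'.q j) (r''.q l)) +
        omega f Q (Form.lie ξ ((r''.h l * pull f hf (Q.pairing U (r'.q j) (r''.q l))) •
          Form.d (r'.h j)))) +
      ∑ i, ∑ j, ∑ l, ((r.h i * (r'.h j * r''.h l)) •
          tau f Q hf (Q.bracket U (r.q i) (Q.bracket U (r'.q j) (r''.q l))) +
        (r'.h j * r''.h l * pull f hf (Q.pairing U (r.q i) (Q.bracket U (r'.q j) (r''.q l)))) •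
          omega f Q (Form.d (r.h i))) := by
  rw [fst_bracket_eq_sum, sum_bracket Q hf r' η r'' ζ (fun h q => ξ.act h • tau f Q hf q),
    Finset.sum_congr rfl fun i _ => sum_bracket Q hf r' η r'' ζ (fun h q =>
      (h * pull f hf (Q.pairing U (r.q i) q)) • omega f Q (Form.d (r.h i)) +
        (r.h i * h) • tau f Q hf (Q.bracket U (r.q i) q)), bracket_α]
  simp only [Form.lie_add, Form.lie_neg, Form.lie_sum, map_add, map_neg, map_sub, map_sum,
    Finset.sum_add_distrib, O_neg_mul, O_mul_neg, neg_smul, Finset.sum_neg_distrib]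
  abel

theorem fst_bracket_bracket_left (hf : W ≤ pre f U) (r r' r'' : Rep M W U)
    (ξ η ζ : VField Y W) :
    ((r.bracket Q hf ξ r' η).bracket Q hf ⁅ξ, η⁆ r'' ζ).fst Q hf =
      omega f Q (Form.iotaD ζ (Form.iotaD η r.α) - Form.iotaD ζ (Form.lie ξ r'.α) +
        Form.lie ⁅ξ, η⁆ r''.α) +
      ∑ i, ζ.act (η.act (r.h i)) • tau f Q hf (r.q i) -
      ∑ j, ζ.act (ξ.act (r'.h j)) • tau f Q hf (r'.q j) +
      ∑ l, (⁅ξ, η⁆ : VField Y W).act (r''.h l) • tau f Q hf (r''.q l) -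
      ∑ i, ∑ j, (ζ.act (r.h i * r'.h j) • tau f Q hf (Q.bracket U (r.q i) (r'.q j)) +
        omega f Q (Form.iotaD ζ ((r'.h j * pull f hf (Q.pairing U (r.q i) (r'.q j))) •
          Form.d (r.h i)))) -
      ∑ i, ∑ l, ((η.act (r.h i) * r''.h l) • tau f Q hf (Q.bracket U (r.q i) (r''.q l)) +
        (r''.h l * pull f hf (Q.pairing U (r.q i) (r''.q l))) •
          omega f Q (Form.d (η.act (r.h i)))) +
      ∑ j, ∑ l, ((ξ.act (r'.h j) * r''.h l) • tau f Q hf (Q.bracket U (r'.q j) (r''.q l)) +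
        (r''.h l * pull f hf (Q.pairing U (r'.q j) (r''.q l))) •
          omega f Q (Form.d (ξ.act (r'.h j)))) +
      ∑ i, ∑ j, ∑ l, ((r.h i * r'.h j * r''.h l) •
          tau f Q hf (Q.bracket U (Q.bracket U (r.q i) (r'.q j)) (r''.q l)) +
        (r''.h l * pull f hf (Q.pairing U (Q.bracket U (r.q i) (r'.q j)) (r''.q l))) •
          omega f Q (Form.d (r.h i * r'.h j))) := by
  rw [fst_bracket_eq_sum, sum_bracket Q hf r ξ r' η (fun h q => ζ.act h • tau f Q hf q),
    sum_bracket Q hf r ξ r' η (fun h q => ∑ l,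
      ((r''.h l * pull f hf (Q.pairing U q (r''.q l))) • omega f Q (Form.d h) +
        (h * r''.h l) • tau f Q hf (Q.bracket U q (r''.q l)))), bracket_α]
  simp only [Form.iotaD_add, Form.iotaD_neg, Form.iotaD_sum, map_add, map_neg, map_sub, map_sum,
    Finset.sum_add_distrib, O_neg_mul, neg_smul, smul_neg, Finset.sum_neg_distrib,
    Form.d_neg]
  abel

/-- The terms `∑ gⱼ kₗ π(rₗ)⟨qᵢ, pⱼ⟩ dhᵢ` which enter the verification of the Leibniz identity. -/
noncomputable def anchorSum (hf : W ≤ pre f U) (r r' r'' : Rep M W U) : Fam f Q W :=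
  ∑ i, ∑ j, ∑ l, (r'.h j * (r''.h l * pull f hf ((Q.anchor U (r''.q l)).act
    (Q.pairing U (r.q i) (r'.q j))))) • omega f Q (Form.d (r.h i))

theorem sum_bracket_act_smul_tau (hf : W ≤ pre f U) (r : Rep M W U) (ξ η : VField Y W) :
    ∑ i, (⁅ξ, η⁆ : VField Y W).act (r.h i) • tau f Q hf (r.q i) =
      ∑ i, ξ.act (η.act (r.h i)) • tau f Q hf (r.q i) -
        ∑ i, η.act (ξ.act (r.h i)) • tau f Q hf (r.q i) := by
  rw [← Finset.sum_sub_distrib]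
  exact Finset.sum_congr rfl fun i _ => by rw [VField.bracket_act, sub_smul]

/-- The groups indexed by (i, j) match except where ζ differentiates f^*⟨qᵢ,pⱼ⟩. Compatibility of
the third triple turns this defect into an `anchorSum`. -/
theorem sum_act_right_iotaD (hf : W ≤ pre f U) (r r' : Rep M W U) {r'' : Rep M W U}
    {ζ : VField Y W} (H'' : r''.Compat Q f ζ) :
    ∑ i, ∑ j, ((r.h i * ζ.act (r'.h j)) • tau f Q hf (Q.bracket U (r.q i) (r'.q j)) +
        (ζ.act (r'.h j) * pull f hf (Q.pairing U (r.q i) (r'.q j))) •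
          omega f Q (Form.d (r.h i))) =
      ∑ i, ∑ j, (ζ.act (r.h i * r'.h j) • tau f Q hf (Q.bracket U (r.q i) (r'.q j)) +
        omega f Q (Form.iotaD ζ ((r'.h j * pull f hf (Q.pairing U (r.q i) (r'.q j))) •
          Form.d (r.h i)))) +
      ∑ j, ∑ i, ((r'.h j * ζ.act (r.h i)) • tau f Q hf (Q.bracket U (r'.q j) (r.q i)) +
        (ζ.act (r.h i) * pull f hf (Q.pairing U (r'.q j) (r.q i))) •
          omega f Q (Form.d (r'.h j))) -
      anchorSum Q hf r r' r'' := by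
  rw [Finset.sum_comm (s := (Finset.univ : Finset r'.ι)), ← Finset.sum_add_distrib, anchorSum,
    ← Finset.sum_sub_distrib]
  refine Finset.sum_congr rfl fun i _ => ?_
  rw [← Finset.sum_add_distrib, ← Finset.sum_sub_distrib]
  refine Finset.sum_congr rfl fun j _ => ?_
  rw [← Finset.sum_smul, ← Finset.mul_sum, ← DfEq.act_pull H'' hf, Form.iotaD_smul_d, map_sub,
    map_smul, map_smul, Form.d_mul, map_add, map_smul, map_smul, VField.act_mul, VField.act_mul,
    Q.bracket_swap (r'.q j), map_add, map_neg, tau_coanchor_d, Q.pairing_symm (r'.q j)]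
  module

/-- Expand the product rule on the right. The only surplus is η applied to f^*⟨qᵢ,rₗ⟩, again an
`anchorSum` by compatibility. The lemma serves the groups (i, l) and, with the roles changed, (j,
l). -/
theorem sum_act_right_lie (hf : W ≤ pre f U) (r : Rep M W U) {r' : Rep M W U} (r'' : Rep M W U)
    {η : VField Y W} (H' : r'.Compat Q f η) :
    ∑ i, ∑ l, ((r.h i * η.act (r''.h l)) • tau f Q hf (Q.bracket U (r.q i) (r''.q l)) +
        (η.act (r''.h l) * pull f hf (Q.pairing U (r.q i) (r''.q l))) •
          omega f Q (Form.d (r.h i))) =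
      ∑ i, ∑ l, (η.act (r.h i * r''.h l) • tau f Q hf (Q.bracket U (r.q i) (r''.q l)) +
        omega f Q (Form.lie η ((r''.h l * pull f hf (Q.pairing U (r.q i) (r''.q l))) •
          Form.d (r.h i)))) -
      ∑ i, ∑ l, ((η.act (r.h i) * r''.h l) • tau f Q hf (Q.bracket U (r.q i) (r''.q l)) +
        (r''.h l * pull f hf (Q.pairing U (r.q i) (r''.q l))) •
          omega f Q (Form.d (η.act (r.h i)))) -
      anchorSum Q hf r r'' r' := by
  rw [anchorSum, ← Finset.sum_sub_distrib, ← Finset.sum_sub_distrib]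
  refine Finset.sum_congr rfl fun i _ => ?_
  rw [← Finset.sum_sub_distrib, ← Finset.sum_sub_distrib]
  refine Finset.sum_congr rfl fun l _ => ?_
  rw [← Finset.sum_smul, ← Finset.mul_sum, ← DfEq.act_pull H' hf, Form.lie_smul_d, map_add,
    map_smul, map_smul, VField.act_mul, VField.act_mul]
  module

/-- The tensor parts match by the Leibniz identity in Q. The coefficients of the dhᵢ and dgⱼ are
compared by invariance of the pairing and by the symmetric part of the bracket; what is left over is
the three anchor sums. -/
theorem sum_bracket_bracket (hf : W ≤ pre f U) (r r' r'' : Rep M W U) :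
    ∑ i, ∑ j, ∑ l, ((r.h i * (r'.h j * r''.h l)) •
          tau f Q hf (Q.bracket U (r.q i) (Q.bracket U (r'.q j) (r''.q l))) +
        (r'.h j * r''.h l * pull f hf (Q.pairing U (r.q i) (Q.bracket U (r'.q j) (r''.q l)))) •
          omega f Q (Form.d (r.h i))) =
      ∑ i, ∑ j, ∑ l, ((r.h i * r'.h j * r''.h l) •
          tau f Q hf (Q.bracket U (Q.bracket U (r.q i) (r'.q j)) (r''.q l)) +
        (r''.h l * pull f hf (Q.pairing U (Q.bracket U (r.q i) (r'.q j)) (r''.q l))) •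
          omega f Q (Form.d (r.h i * r'.h j))) +
      ∑ j, ∑ i, ∑ l, ((r'.h j * (r.h i * r''.h l)) •
          tau f Q hf (Q.bracket U (r'.q j) (Q.bracket U (r.q i) (r''.q l))) +
        (r.h i * r''.h l * pull f hf (Q.pairing U (r'.q j) (Q.bracket U (r.q i) (r''.q l)))) •
          omega f Q (Form.d (r'.h j))) -
      anchorSum Q hf r r' r'' + anchorSum Q hf r r'' r' - anchorSum Q hf r' r'' r := by
  -- Pair π†d⟨q,p⟩ = [q,p] + [p,q] with r.
  have e : ∀ i j l, (Q.anchor U (r''.q l)).act (Q.pairing U (r.q i) (r'.q j)) =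
      Q.pairing U (Q.bracket U (r.q i) (r'.q j)) (r''.q l) +
        Q.pairing U (Q.bracket U (r'.q j) (r.q i)) (r''.q l) := fun i j l => by
    rw [← LinearMap.add_apply, ← map_add, Q.bracket_symm, Q.coanchor_d_pairing]
  have s1 : anchorSum Q hf r r'' r' = ∑ i, ∑ j, ∑ l, (r''.h l * (r'.h j * pull f hf
      ((Q.anchor U (r'.q j)).act (Q.pairing U (r.q i) (r''.q l))))) • omega f Q (Form.d (r.h i)) :=
    Finset.sum_congr rfl fun i _ => Finset.sum_comm
  have s2 : anchorSum Q hf r' r'' r = ∑ i, ∑ j, ∑ l, (r''.h l * (r.h i * pull f hf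
      ((Q.anchor U (r.q i)).act (Q.pairing U (r'.q j) (r''.q l))))) •
        omega f Q (Form.d (r'.h j)) :=
    (Finset.sum_congr rfl fun j _ => Finset.sum_comm).trans Finset.sum_comm
  rw [Finset.sum_comm (s := (Finset.univ : Finset r'.ι)) (t := (Finset.univ : Finset r.ι)),
    s1, s2, anchorSum]
  simp only [← Finset.sum_add_distrib, ← Finset.sum_sub_distrib]
  refine Finset.sum_congr rfl fun i _ => Finset.sum_congr rfl fun j _ =>
    Finset.sum_congr rfl fun l _ => ?_
  rw [Q.jacobi, map_add, e, ← Q.pairing_bracket, ← Q.pairing_bracket, map_add, map_add, map_add,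
    Form.d_mul, map_add, map_smul, map_smul]
  module

theorem fst_jacobi (hf : W ≤ pre f U) {r r' r'' : Rep M W U}
    {ξ η ζ : VField Y W} (H : r.Compat Q f ξ) (H' : r'.Compat Q f η) (H'' : r''.Compat Q f ζ) :
    (r.bracket Q hf ξ (r'.bracket Q hf η r'' ζ) ⁅η, ζ⁆).fst Q hf =
      ((r.bracket Q hf ξ r' η).bracket Q hf ⁅ξ, η⁆ r'' ζ).fst Q hf +
        (r'.bracket Q hf η (r.bracket Q hf ξ r'' ζ) ⁅ξ, ζ⁆).fst Q hf := by
  rw [fst_bracket_bracket_right, fst_bracket_bracket_left, fst_bracket_bracket_right]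
  -- The part without tensor factors is pure Cartan calculus: commutators of Lie derivatives with
  -- each other and with ι d, and d² = 0.
  have c0 : omega f Q (-Form.iotaD ⁅η, ζ⁆ r.α - Form.lie ξ (Form.iotaD ζ r'.α) +
        Form.lie ξ (Form.lie η r''.α)) =
      omega f Q (Form.iotaD ζ (Form.iotaD η r.α) - Form.iotaD ζ (Form.lie ξ r'.α) +
        Form.lie ⁅ξ, η⁆ r''.α) +
      omega f Q (-Form.iotaD ⁅ξ, ζ⁆ r'.α - Form.lie η (Form.iotaD ζ r.α) +
        Form.lie η (Form.lie ξ r''.α)) := by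
    rw [← map_add, Form.lie_lie ξ η, Form.lie_iotaD, Form.lie_iotaD, Form.iotaD_iotaD]
    congr 1
    abel
  -- Bookkeeping by group: o for forms, i, j, l for single sums, a, b, c for double sums, d for
  -- triple sums. The defects x, y, z of the double sums cancel those of the triple sum.
  have combine : ∀ {A : Type _} [AddCommGroup A] {o₁ o₂ o₃ i₁ i₂ i₃ j₁ j₂ j₃ l₁ l₂ l₃ a₁ a₂ a₃
      b₁ b₂ b₃ c₁ c₂ c₃ d₁ d₂ d₃ x y z : A}, o₁ = o₂ + o₃ → i₁ = i₃ - i₂ → j₃ = j₁ - j₂ →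
      l₂ = l₁ - l₃ → a₁ = a₂ + a₃ - x → b₁ = b₃ - b₂ - y → c₃ = c₁ - c₂ - z →
      d₁ = d₂ + d₃ - x + y - z →
      o₁ - i₁ - j₁ + l₁ - a₁ + b₁ + c₁ + d₁ =
        o₂ + i₂ - j₂ + l₂ - a₂ - b₂ + c₂ + d₂ + (o₃ - j₃ - i₃ + l₃ - a₃ + c₃ + b₃ + d₃) := by
    intros
    subst_vars
    abel
  exact combine c0 (sum_bracket_act_smul_tau Q hf r η ζ) (sum_bracket_act_smul_tau Q hf r' ξ ζ)
    (sum_bracket_act_smul_tau Q hf r'' ξ η) (sum_act_right_iotaD Q hf r r' H'')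
    (sum_act_right_lie Q hf r r'' H') (sum_act_right_lie Q hf r' r'' H)
    (sum_bracket_bracket Q hf r r' r'')

theorem val_jacobi (hf : W ≤ pre f U) {r r' r'' : Rep M W U}
    {ξ η ζ : VField Y W} (H : r.Compat Q f ξ) (H' : r'.Compat Q f η) (H'' : r''.Compat Q f ζ) :
    (r.bracket Q hf ξ (r'.bracket Q hf η r'' ζ) ⁅η, ζ⁆).val Q hf ⁅ξ, ⁅η, ζ⁆⁆ =
      ((r.bracket Q hf ξ r' η).bracket Q hf ⁅ξ, η⁆ r'' ζ).val Q hf ⁅⁅ξ, η⁆, ζ⁆ +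
        (r'.bracket Q hf η (r.bracket Q hf ξ r'' ζ) ⁅ξ, ζ⁆).val Q hf ⁅η, ⁅ξ, ζ⁆⁆ := by
  rw [val, val, val, fst_jacobi Q hf H H' H'', VField.jacobi, map_add]
  abel

theorem pair_bracket_eq (hf : W ≤ pre f U) (r r' r'' : Rep M W U) (ξ η ζ : VField Y W) :
    (r.bracket Q hf ξ r' η).pair Q hf ⁅ξ, η⁆ r'' ζ =
      ∑ i, ∑ j, ∑ l, r.h i * r'.h j * r''.h l *
        pull f hf (Q.pairing U (Q.bracket U (r.q i) (r'.q j)) (r''.q l)) -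
      ∑ i, ∑ l, η.act (r.h i) * r''.h l * pull f hf (Q.pairing U (r.q i) (r''.q l)) +
      ∑ j, ∑ l, ξ.act (r'.h j) * r''.h l * pull f hf (Q.pairing U (r'.q j) (r''.q l)) +
      ∑ i, ∑ j, r'.h j * pull f hf (Q.pairing U (r.q i) (r'.q j)) * ζ.act (r.h i) +
      r''.α.ap ⁅ξ, η⁆ - (Form.iotaD η r.α).ap ζ + (Form.lie ξ r'.α).ap ζ := by
  rw [pair, sum_bracket Q hf r ξ r' η (fun h q => ∑ l, h * r''.h l *
    pull f hf (Q.pairing U q (r''.q l))), bracket_α, Form.add_ap, Form.add_ap, Form.neg_ap,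
    Form.sum_ap]
  simp only [Form.sum_ap, Form.smul_ap, Form.d_ap, O_neg_mul, Finset.sum_neg_distrib]
  ring

/-- Differentiating gⱼkₗ f^*⟨pⱼ,rₗ⟩ along ξ and writing ξ(f^*⟨pⱼ,rₗ⟩) = ∑ hᵢ f^*(π(qᵢ)⟨pⱼ,rₗ⟩)
reduces the tensor part to invariance in Q. The terms in dhᵢ cancel against those in η(hᵢ) and
ζ(hᵢ), and the form terms by the formulas for `lie` and `iotaD`. -/
theorem pair_bracket_add (hf : W ≤ pre f U) {r r' r'' : Rep M W U} {ξ η ζ : VField Y W}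
    (H : r.Compat Q f ξ) :
    (r.bracket Q hf ξ r' η).pair Q hf ⁅ξ, η⁆ r'' ζ +
      r'.pair Q hf η (r.bracket Q hf ξ r'' ζ) ⁅ξ, ζ⁆ = ξ.act (r'.pair Q hf η r'' ζ) := by
  rw [pair_comm Q hf r', pair_bracket_eq, pair_bracket_eq, pair, map_add, map_add, map_sum]
  have e : ∀ j, ξ.act (∑ l, r'.h j * r''.h l * pull f hf (Q.pairing U (r'.q j) (r''.q l))) =
      ∑ i, ∑ l, (r.h i * r'.h j * r''.h l *
        pull f hf (Q.pairing U (Q.bracket U (r.q i) (r'.q j)) (r''.q l)) +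
        r.h i * r''.h l * r'.h j *
        pull f hf (Q.pairing U (Q.bracket U (r.q i) (r''.q l)) (r'.q j))) +
      ∑ l, ξ.act (r'.h j) * r''.h l * pull f hf (Q.pairing U (r'.q j) (r''.q l)) +
      ∑ l, ξ.act (r''.h l) * r'.h j * pull f hf (Q.pairing U (r''.q l) (r'.q j)) := by
    intro j
    rw [map_sum, Finset.sum_comm, ← Finset.sum_add_distrib, ← Finset.sum_add_distrib]
    refine Finset.sum_congr rfl fun l _ => ?_
    have e1 : ∑ i, (r.h i * r'.h j * r''.h l *
        pull f hf (Q.pairing U (Q.bracket U (r.q i) (r'.q j)) (r''.q l)) +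
        r.h i * r''.h l * r'.h j *
        pull f hf (Q.pairing U (Q.bracket U (r.q i) (r''.q l)) (r'.q j))) =
        r'.h j * r''.h l * ∑ i, r.h i * pull f hf ((Q.anchor U (r.q i)).act
          (Q.pairing U (r'.q j) (r''.q l))) := by
      rw [Finset.mul_sum]
      refine Finset.sum_congr rfl fun i _ => ?_
      rw [← Q.pairing_bracket, map_add, Q.pairing_symm (r'.q j)]
      ring
    rw [e1, ← DfEq.act_pull H hf, VField.act_mul, VField.act_mul, Q.pairing_symm (r''.q l)]
    ring
  rw [Finset.sum_congr rfl fun j _ => e j]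
  simp only [Finset.sum_add_distrib]
  have s1 : ∑ j, ∑ i, ∑ l, r.h i * r'.h j * r''.h l *
        pull f hf (Q.pairing U (Q.bracket U (r.q i) (r'.q j)) (r''.q l)) =
      ∑ i, ∑ j, ∑ l, r.h i * r'.h j * r''.h l *
        pull f hf (Q.pairing U (Q.bracket U (r.q i) (r'.q j)) (r''.q l)) := Finset.sum_comm
  have s2 : ∑ j, ∑ i, ∑ l, r.h i * r''.h l * r'.h j *
        pull f hf (Q.pairing U (Q.bracket U (r.q i) (r''.q l)) (r'.q j)) =
      ∑ i, ∑ l, ∑ j, r.h i * r''.h l * r'.h j *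
        pull f hf (Q.pairing U (Q.bracket U (r.q i) (r''.q l)) (r'.q j)) := by
    rw [Finset.sum_comm]
    exact Finset.sum_congr rfl fun i _ => Finset.sum_comm
  have s3 : ∑ j, ∑ l, ξ.act (r''.h l) * r'.h j * pull f hf (Q.pairing U (r''.q l) (r'.q j)) =
      ∑ l, ∑ j, ξ.act (r''.h l) * r'.h j * pull f hf (Q.pairing U (r''.q l) (r'.q j)) :=
    Finset.sum_comm
  have s4 : ∑ i, ∑ j, ζ.act (r.h i) * r'.h j * pull f hf (Q.pairing U (r.q i) (r'.q j)) =
      ∑ i, ∑ j, r'.h j * pull f hf (Q.pairing U (r.q i) (r'.q j)) * ζ.act (r.h i) :=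
    Finset.sum_congr rfl fun i _ => Finset.sum_congr rfl fun j _ => by ring
  have s5 : ∑ i, ∑ j, η.act (r.h i) * r''.h j * pull f hf (Q.pairing U (r.q i) (r''.q j)) =
      ∑ i, ∑ j, r''.h j * pull f hf (Q.pairing U (r.q i) (r''.q j)) * η.act (r.h i) :=
    Finset.sum_congr rfl fun i _ => Finset.sum_congr rfl fun j _ => by ring
  rw [s1, s2, s3, s4, s5, Form.iotaD_ap, Form.iotaD_ap, Form.lie_ap, Form.lie_ap,
    VField.bracket_swap ζ η, Form.ap_neg]
  ring

end Rep

end InverseImage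

end Axioms

/-! ### Gluing local operations into operations on sections. -/

section Construction

variable {𝕜 K : Type} [RCLike 𝕜] [RCLike K] [NormedAlgebra 𝕜 K] {n : WithTop ℕ∞}
  [Fact (n = ∞ ∨ n = ω)]

open Mfd PMod

theorem Mfd.O_congr {X : Mfd.{u, v} 𝕜 K n} {U : Opens X} {φ ψ : X.O U} (h : φ = ψ) (x : U) :
    φ.1 x = ψ.1 x := by rw [h]

theorem Mfd.O_gluing {X : Mfd.{u, v} 𝕜 K n} {U : Opens X} (W : U → Opens X)
    (hxW : ∀ x, x.1 ∈ W x) (ψ : ∀ x : U, X.O (U ⊓ W x))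
    (hψ : ∀ (x y : U) (hy : y.1 ∈ W x),
      (ψ y).1 ⟨y.1, y.2, hxW y⟩ = (ψ x).1 ⟨y.1, y.2, hy⟩) :
    ∃ φ : X.O U, ∀ x, X.resO (inf_le_left : U ⊓ W x ≤ U) φ = ψ x := by
  obtain ⟨φ, hφ⟩ := exists_O (fun x : U => (ψ x).1 ⟨x.1, x.2, hxW x⟩) fun x hx =>
    ⟨U ⊓ W ⟨x, hx⟩, inf_le_left, ψ ⟨x, hx⟩, ⟨hx, hxW ⟨x, hx⟩⟩, fun y =>
      hψ ⟨x, hx⟩ ⟨y.1, y.2.1⟩ y.2.2⟩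
  exact ⟨φ, fun x => X.O_ext fun y => (hφ ⟨y.1, y.2.1⟩).trans (hψ x ⟨y.1, y.2.1⟩ y.2.2)⟩

theorem Mfd.O_locality_inf {X : Mfd.{u, v} 𝕜 K n} {U V : Opens X} (hV : V ≤ U) (W : U → Opens X)
    (hxW : ∀ x, x.1 ∈ W x) {φ ψ : X.O V}
    (h : ∀ x, X.resO (inf_le_left : V ⊓ W x ≤ V) φ = X.resO inf_le_left ψ) : φ = ψ :=
  O_locality fun x hx => ⟨V ⊓ W ⟨x, hV hx⟩, inf_le_left, ⟨hx, hxW ⟨x, hV hx⟩⟩, h ⟨x, hV hx⟩⟩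

/-- The values of the local fields on a function agree on overlaps and glue to a function; all
identities are then checked on the cover. Needed because the anchor on sections is given only by
germs of vector fields. -/
theorem VField.gluing {X : Mfd.{u, v} 𝕜 K n} {U : Opens X} (W : U → Opens X) (hW : ∀ x, W x ≤ U)
    (hxW : ∀ x, x.1 ∈ W x) (ξ : ∀ x, VField X (W x))
    (h : ∀ x y, VField.res (inf_le_left : W x ⊓ W y ≤ W x) (ξ x) =
      VField.res inf_le_right (ξ y)) :
    ∃ η : VField X U, ∀ x, VField.res (hW x) η = ξ x := by
  have agree : ∀ (V : Opens X) (φ : X.O V) (x y : U) (z : X) (hz : z ∈ V) (hx : z ∈ W x)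
      (hy : z ∈ W y), ((ξ x).toFun (V ⊓ W x) inf_le_right (X.resO inf_le_left φ)).1 ⟨z, hz, hx⟩ =
        ((ξ y).toFun (V ⊓ W y) inf_le_right (X.resO inf_le_left φ)).1 ⟨z, hz, hy⟩ := by
    intro V φ x y z hz hx hy
    have h1 : (ξ x).toFun (V ⊓ (W x ⊓ W y)) (inf_le_right.trans inf_le_left)
        (X.resO inf_le_left φ) =
      (ξ y).toFun (V ⊓ (W x ⊓ W y)) (inf_le_right.trans inf_le_right)
        (X.resO inf_le_left φ) :=
      congrArg (fun η : VField X (W x ⊓ W y) => η.toFun (V ⊓ (W x ⊓ W y)) inf_le_right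
        (X.resO inf_le_left φ)) (h x y)
    have n1 := (ξ x).natural (V ⊓ W x) (V ⊓ (W x ⊓ W y)) inf_le_right
      (inf_le_inf_left V inf_le_left) (X.resO inf_le_left φ)
    have n2 := (ξ y).natural (V ⊓ W y) (V ⊓ (W x ⊓ W y)) inf_le_right
      (inf_le_inf_left V inf_le_right) (X.resO inf_le_left φ)
    exact O_congr (n1.symm.trans (h1.trans n2)) ⟨z, hz, hx, hy⟩
  have key : ∀ (V : Opens X) (hV : V ≤ U) (φ : X.O V), ∃ ψ : X.O V, ∀ x,
      X.resO (inf_le_left : V ⊓ W x ≤ V) ψ =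
        (ξ x).toFun (V ⊓ W x) inf_le_right (X.resO inf_le_left φ) := by
    intro V hV φ
    obtain ⟨ψ, hψ⟩ := Mfd.O_gluing (U := V) (fun x => W ⟨x.1, hV x.2⟩) (fun x => hxW _)
      (fun x => (ξ ⟨x.1, hV x.2⟩).toFun (V ⊓ W ⟨x.1, hV x.2⟩) inf_le_right
        (X.resO inf_le_left φ)) fun x z hz => agree V φ _ _ z.1 z.2 (hxW ⟨z.1, hV z.2⟩) hz
    exact ⟨ψ, fun x => X.O_ext fun z => (O_congr (hψ ⟨z.1, z.2.1⟩) ⟨z.1, z.2.1, hxW _⟩).trans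
      (agree V φ _ x z.1 z.2.1 (hxW ⟨z.1, hV z.2.1⟩) z.2.2)⟩
  choose F hF using key
  refine ⟨⟨fun V hV => ⟨⟨F V hV, fun φ ψ => ?_⟩, fun c φ => ?_⟩, fun V hV φ ψ => ?_,
    fun V V' hV hV' φ => ?_, fun V hV φ x hx => ?_⟩, fun x => VField.ext fun V hV φ => ?_⟩
  · refine O_locality_inf hV W hxW fun x => ?_
    rw [map_add, hF, hF, hF, map_add, map_add]
  · refine O_locality_inf hV W hxW fun x => ?_
    rw [RingHom.id_apply, map_smul, hF, hF, map_smul, map_smul]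
  · refine O_locality_inf hV W hxW fun x => ?_
    change X.resO _ (F V hV (φ * ψ)) = X.resO _ (φ * F V hV ψ + ψ * F V hV φ)
    rw [map_add, map_mul, map_mul, hF, hF, hF, map_mul, (ξ x).leibniz]
  · refine O_locality_inf (hV'.trans hV) W hxW fun x => ?_
    refine (hF _ _ _ _).trans ?_
    have h1 := congrArg (X.resO (inf_le_inf_right (W x) hV')) (hF V hV φ x)
    refine Eq.trans ?_ h1.symm
    exact (ξ x).natural (V ⊓ W x) (V' ⊓ W x) inf_le_right (inf_le_inf_right (W x) hV')
      (X.resO inf_le_left φ)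
  -- Tangency is a pointwise condition, so it is inherited from the member of the cover attached to
  -- the point.
  · have h1 := O_congr (hF V hV φ ⟨x.1, hV x.2⟩) ⟨x.1, x.2, hxW ⟨x.1, hV x.2⟩⟩
    refine Eq.trans h1 ((ξ _).tangent _ _ _ _ ?_)
    have : (X.resO (inf_le_left : V ⊓ W ⟨x.1, hV x.2⟩ ≤ V) φ).1 =
        φ.1 ∘ TopologicalSpace.Opens.inclusion inf_le_left := rfl
    rw [this, mfderiv_comp (I' := 𝓘(𝕜, X.E))]
    · erw [hx]; exact ContinuousLinearMap.zero_comp _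
    · exact φ.2.mdifferentiable (by have := one_le (n := n); positivity) _
    · exact (contMDiff_inclusion (n := 1) inf_le_left).mdifferentiable (by simp) _
  · refine X.O_ext fun z => ?_
    exact (O_congr (hF V (hV.trans (hW x)) φ x) ⟨z.1, z.2, hV z.2⟩).trans
      (O_congr ((ξ x).natural V (V ⊓ W x) hV inf_le_left φ) ⟨z.1, z.2, hV z.2⟩)

namespace InverseImage

variable {Y : Mfd.{w₁, w₂} 𝕜 K n} {X : Mfd.{u, v} 𝕜 K n} {f : Y.Hom X}
  {M : SMod.{u, v, w} X} (Q : CourantStr M) {V V' : Opens Y}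

variable (f) in
theorem Fam.res_smul (h : V' ≤ V) (φ : Y.O V) (s : Fam f Q V) :
    Fam.res f Q h (φ • s) = Y.resO h φ • Fam.res f Q h s := funext fun y => by
  rw [fam_smul, og_res]
  rfl

variable {Q} in
/-- Sections of the inverse image are equal if they are locally. -/
theorem sec_locality {s t : (inverseImage f Q).Sec V}
    (h : ∀ y ∈ V, ∃ (W : Opens Y) (hW : W ≤ V), y ∈ W ∧
      Fam.res f Q hW s.1 = Fam.res f Q hW t.1) : s = t :=
  Subtype.ext (funext fun y => by
    obtain ⟨W, hW, hy, e⟩ := h y.1 y.2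
    exact congrFun e ⟨y.1, hy⟩)

variable {Q} in
theorem exists_represents (s : (inverseImage f Q).Sec V) {y : Y} (hy : y ∈ V) :
    ∃ (W : Opens Y) (hW : W ≤ V) (U : Opens X) (hf : W ≤ pre f U) (r : Rep M W U)
      (ξ : VField Y W), y ∈ W ∧ r.Represents hf ξ (Fam.res f Q hW s.1) := s.2 y hy

variable {Q} in
theorem exists_represents₂ (s t : (inverseImage f Q).Sec V) {y : Y} (hy : y ∈ V) :
    ∃ (W : Opens Y) (hW : W ≤ V) (U : Opens X) (hf : W ≤ pre f U) (r r' : Rep M W U)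
      (ξ η : VField Y W), y ∈ W ∧ r.Represents hf ξ (Fam.res f Q hW s.1) ∧
        r'.Represents hf η (Fam.res f Q hW t.1) := by
  obtain ⟨W, hW, U, hf, r, ξ, hyW, H⟩ := exists_represents s hy
  obtain ⟨W', hW', U', hf', r', ξ', hyW', H'⟩ := exists_represents t hy
  have h1 : W ⊓ W' ≤ pre f (U ⊓ U') := fun z hz => ⟨hf hz.1, hf' hz.2⟩
  exact ⟨W ⊓ W', inf_le_left.trans hW, U ⊓ U', h1, _, _, _, _, ⟨hyW, hyW'⟩,
    H.res inf_le_left inf_le_left h1, H'.res inf_le_right inf_le_right h1⟩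

variable {Q} in
theorem exists_represents₃ (s t u : (inverseImage f Q).Sec V) {y : Y} (hy : y ∈ V) :
    ∃ (W : Opens Y) (hW : W ≤ V) (U : Opens X) (hf : W ≤ pre f U) (r r' r'' : Rep M W U)
      (ξ η ζ : VField Y W), y ∈ W ∧ r.Represents hf ξ (Fam.res f Q hW s.1) ∧
        r'.Represents hf η (Fam.res f Q hW t.1) ∧ r''.Represents hf ζ (Fam.res f Q hW u.1) := by
  obtain ⟨W, hW, U, hf, r, r', ξ, η, hyW, H, H'⟩ := exists_represents₂ s t hy
  obtain ⟨W', hW', U', hf', r'', ζ, hyW', H''⟩ := exists_represents u hy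
  have h1 : W ⊓ W' ≤ pre f (U ⊓ U') := fun z hz => ⟨hf hz.1, hf' hz.2⟩
  exact ⟨W ⊓ W', inf_le_left.trans hW, U ⊓ U', h1, _, _, _, _, _, _, ⟨hyW, hyW'⟩,
    H.res inf_le_left inf_le_left h1, H'.res inf_le_left inf_le_left h1,
    H''.res inf_le_right inf_le_right h1⟩

/-- At each point any choice of representing triples gives the same stalk element, by
`bracket_pair_congr`. The family so defined is represented by the bracket formula wherever s and t
are represented, so it is a section. -/
theorem exists_sec_bracket (s t : (inverseImage f Q).Sec V) :
    ∃ u : (inverseImage f Q).Sec V, ∀ (W : Opens Y) (hW : W ≤ V) (U : Opens X)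
      (hf : W ≤ pre f U) (r r' : Rep M W U) (ξ η : VField Y W),
      r.Represents hf ξ (Fam.res f Q hW s.1) → r'.Represents hf η (Fam.res f Q hW t.1) →
        (r.bracket Q hf ξ r' η).Represents hf ⁅ξ, η⁆ (Fam.res f Q hW u.1) := by
  have key : ∀ y : V, ∃ c : Stalk f Q y.1, ∀ (W : Opens Y) (hW : W ≤ V) (U : Opens X)
      (hf : W ≤ pre f U) (r r' : Rep M W U) (ξ η : VField Y W) (hy : y.1 ∈ W),
      r.Represents hf ξ (Fam.res f Q hW s.1) → r'.Represents hf η (Fam.res f Q hW t.1) →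
        c = (r.bracket Q hf ξ r' η).val Q hf ⁅ξ, η⁆ ⟨y.1, hy⟩ := by
    intro y
    obtain ⟨W₂, hW₂, U₂, hf₂, r₂, r₂', ξ₂, η₂, hy₂, H₂, H₂'⟩ := exists_represents₂ s t y.2
    rw [Rep.represents_iff] at H₂ H₂'
    refine ⟨(r₂.bracket Q hf₂ ξ₂ r₂' η₂).val Q hf₂ ⁅ξ₂, η₂⁆ ⟨y.1, hy₂⟩,
      fun W hW U hf r r' ξ η hy H H' => ?_⟩
    rw [Rep.represents_iff] at H H'
    exact (Rep.bracket_pair_congr Q H₂.1 H₂'.1 H.1 H'.1 hy₂ hy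
      ((congrFun H₂.2 ⟨y.1, hy₂⟩).symm.trans (congrFun H.2 ⟨y.1, hy⟩))
      ((congrFun H₂'.2 ⟨y.1, hy₂⟩).symm.trans (congrFun H'.2 ⟨y.1, hy⟩))).1
  choose F hF using key
  have rep : ∀ (W : Opens Y) (hW : W ≤ V) (U : Opens X)
      (hf : W ≤ pre f U) (r r' : Rep M W U) (ξ η : VField Y W),
      r.Represents hf ξ (Fam.res f Q hW s.1) → r'.Represents hf η (Fam.res f Q hW t.1) →
        (r.bracket Q hf ξ r' η).Represents hf ⁅ξ, η⁆ (fun y => F ⟨y.1, hW y.2⟩) :=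
    fun W hW U hf r r' ξ η H H' => (Rep.represents_iff Q).2
      ⟨Rep.compat_bracket Q hf H.1 H'.1, funext fun y => hF ⟨y.1, hW y.2⟩ W hW U hf r r' ξ η y.2 H H'⟩
  refine ⟨⟨F, fun y hy => ?_⟩, rep⟩
  obtain ⟨W, hW, U, hf, r, r', ξ, η, hyW, H, H'⟩ := exists_represents₂ s t hy
  exact ⟨W, hW, U, hf, _, _, hyW, rep W hW U hf r r' ξ η H H'⟩

theorem exists_sec_pairing (s t : (inverseImage f Q).Sec V) :
    ∃ φ : Y.O V, ∀ (W : Opens Y) (hW : W ≤ V) (U : Opens X)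
      (hf : W ≤ pre f U) (r r' : Rep M W U) (ξ η : VField Y W),
      r.Represents hf ξ (Fam.res f Q hW s.1) → r'.Represents hf η (Fam.res f Q hW t.1) →
        Y.resO hW φ = r.pair Q hf ξ r' η := by
  have key : ∀ y : V, ∃ c : K, ∀ (W : Opens Y) (hW : W ≤ V) (U : Opens X)
      (hf : W ≤ pre f U) (r r' : Rep M W U) (ξ η : VField Y W) (hy : y.1 ∈ W),
      r.Represents hf ξ (Fam.res f Q hW s.1) → r'.Represents hf η (Fam.res f Q hW t.1) →
        c = (r.pair Q hf ξ r' η).1 ⟨y.1, hy⟩ := by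
    intro y
    obtain ⟨W₂, hW₂, U₂, hf₂, r₂, r₂', ξ₂, η₂, hy₂, H₂, H₂'⟩ := exists_represents₂ s t y.2
    rw [Rep.represents_iff] at H₂ H₂'
    refine ⟨(r₂.pair Q hf₂ ξ₂ r₂' η₂).1 ⟨y.1, hy₂⟩,
      fun W hW U hf r r' ξ η hy H H' => ?_⟩
    rw [Rep.represents_iff] at H H'
    have := (Rep.bracket_pair_congr Q H₂.1 H₂'.1 H.1 H'.1 hy₂ hy
      ((congrFun H₂.2 ⟨y.1, hy₂⟩).symm.trans (congrFun H.2 ⟨y.1, hy⟩))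
      ((congrFun H₂'.2 ⟨y.1, hy₂⟩).symm.trans (congrFun H'.2 ⟨y.1, hy⟩))).2
    -- Equal germs have equal values at the point, and those values define the function.
    obtain ⟨W₃, hy₃, h, h', e⟩ := (gm_eq_iff (P := unit Y)).1 this
    exact congrArg (fun χ : Y.O W₃ => χ.1 ⟨y.1, hy₃⟩) e
  choose F hF using key
  obtain ⟨φ, hφ⟩ := exists_O F fun y hy => by
    obtain ⟨W, hW, U, hf, r, r', ξ, η, hyW, H, H'⟩ := exists_represents₂ s t hy
    exact ⟨W, hW, r.pair Q hf ξ r' η, hyW,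
      fun z => hF ⟨z.1, hW z.2⟩ W hW U hf r r' ξ η z.2 H H'⟩
  exact ⟨φ, fun W hW U hf r r' ξ η H H' => Y.O_ext fun z =>
    (hφ ⟨z.1, hW z.2⟩).trans (hF ⟨z.1, hW z.2⟩ W hW U hf r r' ξ η z.2 H H')⟩

theorem exists_sec_anchor (s : (inverseImage f Q).Sec V) :
    ∃ ζ : VField Y V, ∀ (W : Opens Y) (hW : W ≤ V) (U : Opens X)
      (hf : W ≤ pre f U) (r : Rep M W U) (ξ : VField Y W),
      r.Represents hf ξ (Fam.res f Q hW s.1) → VField.res hW ζ = ξ := by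
  have key : ∀ y : V, ∃ (W : Opens Y) (hW : W ≤ V) (ξ : VField Y W), y.1 ∈ W ∧
      ∀ z : W, gm (P := tangent Y) z.1 z.2 ξ = (s.1 ⟨z.1, hW z.2⟩).2 := fun y => by
    obtain ⟨W, hW, U, hf, r, ξ, hyW, H⟩ := exists_represents s y.2
    exact ⟨W, hW, ξ, hyW, fun z => (congrArg Prod.snd (H.2 z)).symm⟩
  choose W hW ξ hyW hξ using key
  obtain ⟨ζ, hζ⟩ := VField.gluing W hW hyW ξ fun x y => VField.eq_of_gm_eq fun z =>
    (gm_res (P := tangent Y) z.1 inf_le_left z.2 (ξ x)).trans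
      (((hξ x ⟨z.1, z.2.1⟩).trans (hξ y ⟨z.1, z.2.2⟩).symm).trans
        (gm_res (P := tangent Y) z.1 inf_le_right z.2 (ξ y)).symm)
  refine ⟨ζ, fun W' hW' U hf r ξ' H => VField.eq_of_gm_eq fun z => ?_⟩
  refine (gm_res (P := tangent Y) z.1 hW' z.2 ζ).trans
    (((gm_res (P := tangent Y) z.1 (hW ⟨z.1, hW' z.2⟩) (hyW ⟨z.1, hW' z.2⟩) ζ).symm.trans ?_).trans
      (congrArg Prod.snd (H.2 z)))
  rw [hζ]
  exact hξ ⟨z.1, hW' z.2⟩ ⟨z.1, hyW _⟩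

/-- The bracket of the inverse image. -/
noncomputable def secBracket (s t : (inverseImage f Q).Sec V) : (inverseImage f Q).Sec V :=
  (exists_sec_bracket Q s t).choose

/-- The pairing of the inverse image. -/
noncomputable def secPairing (s t : (inverseImage f Q).Sec V) : Y.O V :=
  (exists_sec_pairing Q s t).choose

/-- The anchor of the inverse image. -/
noncomputable def secAnchor (s : (inverseImage f Q).Sec V) : VField Y V :=
  (exists_sec_anchor Q s).choose

theorem represents_omega {W : Opens Y} {U : Opens X} (hf : W ≤ pre f U) (α : Form Y 1 W) :
    (⟨α, Empty, Empty.elim, Empty.elim⟩ : Rep M W U).Represents hf 0 (omega f Q α) := by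
  refine (Rep.represents_iff Q).2 ⟨fun U' hU W' hW hf φ => rfl, ?_⟩
  rw [Rep.val, Rep.fst, map_zero, add_zero]
  exact (add_zero _).symm

/-- The co-anchor of the inverse image. -/
noncomputable def secCoanchor : Form Y 1 V →ₗ[Y.O V] (inverseImage f Q).Sec V where
  toFun α := ⟨omega f Q α, fun y hy => ⟨V, le_rfl, ⊤, fun _ _ => trivial, _, _, hy,
    represents_omega Q _ α⟩⟩
  map_add' α β := Subtype.ext (map_add _ α β)
  map_smul' φ α := Subtype.ext (map_smul _ φ α)

variable {Q} {s t : (inverseImage f Q).Sec V} {W : Opens Y} {hW : W ≤ V} {U : Opens X}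
  {hf : W ≤ pre f U} {r r' : Rep M W U} {ξ η : VField Y W}

theorem secBracket_rep (H : r.Represents hf ξ (Fam.res f Q hW s.1))
    (H' : r'.Represents hf η (Fam.res f Q hW t.1)) :
    (r.bracket Q hf ξ r' η).Represents hf ⁅ξ, η⁆ (Fam.res f Q hW (secBracket Q s t).1) :=
  (exists_sec_bracket Q s t).choose_spec W hW U hf r r' ξ η H H'

theorem secPairing_rep (H : r.Represents hf ξ (Fam.res f Q hW s.1))
    (H' : r'.Represents hf η (Fam.res f Q hW t.1)) :
    Y.resO hW (secPairing Q s t) = r.pair Q hf ξ r' η :=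
  (exists_sec_pairing Q s t).choose_spec W hW U hf r r' ξ η H H'

theorem secAnchor_rep (H : r.Represents hf ξ (Fam.res f Q hW s.1)) :
    VField.res hW (secAnchor Q s) = ξ :=
  (exists_sec_anchor Q s).choose_spec W hW U hf r ξ H

theorem secCoanchor_rep (hW : W ≤ V) (hf : W ≤ pre f U) (α : Form Y 1 V) :
    (⟨Form.res hW α, Empty, Empty.elim, Empty.elim⟩ : Rep M W U).Represents hf 0
      (Fam.res f Q hW (secCoanchor Q α).1) := by
  have : Fam.res f Q hW (secCoanchor Q α).1 = omega f Q (Form.res hW α) := res_omega f Q hW α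
  rw [this]
  exact represents_omega Q hf _

theorem res_secCoanchor (hW : W ≤ V) (α : Form Y 1 V) :
    Fam.res f Q hW (secCoanchor Q α).1 = omega f Q (Form.res hW α) := res_omega f Q hW α

theorem res_sec_add (hW : W ≤ V) (s t : (inverseImage f Q).Sec V) :
    Fam.res f Q hW (s + t).1 = Fam.res f Q hW s.1 + Fam.res f Q hW t.1 := rfl

theorem res_sec_smul (hW : W ≤ V) (φ : Y.O V) (s : (inverseImage f Q).Sec V) :
    Fam.res f Q hW (φ • s).1 = Y.resO hW φ • Fam.res f Q hW s.1 := Fam.res_smul f Q hW φ s.1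

theorem rep_add (H : r.Represents hf ξ (Fam.res f Q hW s.1))
    (H' : r'.Represents hf η (Fam.res f Q hW t.1)) :
    (r.add r').Represents hf (ξ + η) (Fam.res f Q hW (s + t).1) := H.add H'

theorem rep_smul (H : r.Represents hf ξ (Fam.res f Q hW s.1)) (φ : Y.O V) :
    (r.smul (Y.resO hW φ)).Represents hf (Y.resO hW φ • ξ) (Fam.res f Q hW (φ • s).1) := by
  rw [res_sec_smul]
  exact H.smul _

end InverseImage

end Construction

/-! ### The Courant algebroid structure and its uniqueness. -/

section Structure

variable {𝕜 K : Type} [RCLike 𝕜] [RCLike K] [NormedAlgebra 𝕜 K] {n : WithTop ℕ∞}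
  [Fact (n = ∞ ∨ n = ω)]

open Mfd PMod

namespace InverseImage

variable {Y : Mfd.{w₁, w₂} 𝕜 K n} {X : Mfd.{u, v} 𝕜 K n} {f : Y.Hom X}
  {M : SMod.{u, v, w} X}

namespace Rep

variable (Q : CourantStr M) {W : Opens Y} {U : Opens X}

theorem add_pair (hf : W ≤ pre f U) (r₁ r₂ : Rep M W U) (ξ₁ ξ₂ : VField Y W)
    (r' : Rep M W U) (η : VField Y W) :
    (r₁.add r₂).pair Q hf (ξ₁ + ξ₂) r' η = r₁.pair Q hf ξ₁ r' η + r₂.pair Q hf ξ₂ r' η := by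
  have e : ∑ i, ∑ j, (r₁.add r₂).h i * r'.h j *
      pull f hf (Q.pairing U ((r₁.add r₂).q i) (r'.q j)) =
    ∑ i, ∑ j, r₁.h i * r'.h j * pull f hf (Q.pairing U (r₁.q i) (r'.q j)) +
      ∑ i, ∑ j, r₂.h i * r'.h j * pull f hf (Q.pairing U (r₂.q i) (r'.q j)) :=
    Fintype.sum_sum_type _
  rw [pair, pair, pair, e, show (r₁.add r₂).α = r₁.α + r₂.α from rfl, Form.ap_add, Form.add_ap]
  ring

theorem smul_pair (hf : W ≤ pre f U) (r : Rep M W U) (ξ : VField Y W) (φ : Y.O W)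
    (r' : Rep M W U) (η : VField Y W) :
    (r.smul φ).pair Q hf (φ • ξ) r' η = φ * r.pair Q hf ξ r' η := by
  have e : ∑ i, ∑ j, (r.smul φ).h i * r'.h j *
      pull f hf (Q.pairing U ((r.smul φ).q i) (r'.q j)) =
    φ * ∑ i, ∑ j, r.h i * r'.h j * pull f hf (Q.pairing U (r.q i) (r'.q j)) := by
    simp only [Finset.mul_sum]
    refine Finset.sum_congr rfl fun i _ => Finset.sum_congr rfl fun j _ => ?_
    change φ * r.h i * r'.h j * _ = _
    rw [mul_assoc, mul_assoc, mul_assoc]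
    rfl
  rw [pair, pair, e, show (r.smul φ).α = φ • r.α from rfl, Form.ap_smul, Form.smul_ap]
  ring

theorem pair_form (hf : W ≤ pre f U) (r : Rep M W U) (ξ : VField Y W) (β : Form Y 1 W) :
    r.pair Q hf ξ ⟨β, Empty, Empty.elim, Empty.elim⟩ 0 = β.ap ξ := by
  rw [pair, Form.ap_zero, add_zero, add_eq_right]
  exact Finset.sum_eq_zero fun i _ => Finset.sum_of_isEmpty _

/-- The second triple has no tensor terms and zero vector field, so every term but L_ξ β drops out.
-/
theorem val_bracket_form (hf : W ≤ pre f U) (r : Rep M W U) (ξ : VField Y W) (β : Form Y 1 W) :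
    (r.bracket Q hf ξ ⟨β, Empty, Empty.elim, Empty.elim⟩ 0).val Q hf ⁅ξ, (0 : VField Y W)⁆ =
      omega f Q (Form.lie ξ β) := by
  have e : ⁅ξ, (0 : VField Y W)⁆ = 0 := by
    have := VField.bracket_add ξ 0 0
    rwa [add_zero, left_eq_add] at this
  have e' : ∀ (h : Y.O W) (q : M.Sec U), tensorBracket Q hf
      (⟨β, Empty, Empty.elim, Empty.elim⟩ : Rep M W U) 0 h q = 0 := by
    intro h q
    rw [tensorBracket, show (0 : VField Y W).act h = 0 from rfl, zero_smul, sub_zero]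
    exact Finset.sum_of_isEmpty _
  rw [val, fst_bracket, e, Form.zero_iotaD, map_zero, map_zero, neg_zero, zero_add, add_zero,
    Finset.sum_eq_zero fun i _ => e' _ _, zero_add]
  exact (congrArg _ (Finset.sum_of_isEmpty _)).trans (add_zero _)

end Rep

section

variable {Q : CourantStr M} {V V' : Opens Y}

theorem secPairing_symm (s t : (inverseImage f Q).Sec V) : secPairing Q s t = secPairing Q t s :=
  O_locality fun y hy => by
    obtain ⟨W, hW, U, hf, r, r', ξ, η, hyW, H, H'⟩ := exists_represents₂ s t hy
    exact ⟨W, hW, hyW, by rw [secPairing_rep H H', secPairing_rep H' H, Rep.pair_comm]⟩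

theorem secPairing_add_left (s s' t : (inverseImage f Q).Sec V) :
    secPairing Q (s + s') t = secPairing Q s t + secPairing Q s' t :=
  O_locality fun y hy => by
    obtain ⟨W, hW, U, hf, r, r', r'', ξ, η, ζ, hyW, H, H', H''⟩ := exists_represents₃ s s' t hy
    exact ⟨W, hW, hyW, by
      rw [map_add, secPairing_rep H H'', secPairing_rep H' H'', secPairing_rep (rep_add H H') H'',
        Rep.add_pair]⟩

theorem secPairing_smul_left (φ : Y.O V) (s t : (inverseImage f Q).Sec V) :
    secPairing Q (φ • s) t = φ • secPairing Q s t :=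
  O_locality fun y hy => by
    obtain ⟨W, hW, U, hf, r, r', ξ, η, hyW, H, H'⟩ := exists_represents₂ s t hy
    exact ⟨W, hW, hyW, by
      rw [smul_eq_mul, map_mul, secPairing_rep H H', secPairing_rep (rep_smul H φ) H',
        Rep.smul_pair]⟩

theorem res_secBracket_eq {s t : (inverseImage f Q).Sec V} {W : Opens Y} {hW : W ≤ V}
    {U : Opens X} {hf : W ≤ pre f U} {r r' : Rep M W U} {ξ η : VField Y W}
    (H : r.Represents hf ξ (Fam.res f Q hW s.1))
    (H' : r'.Represents hf η (Fam.res f Q hW t.1)) :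
    Fam.res f Q hW (secBracket Q s t).1 = (r.bracket Q hf ξ r' η).val Q hf ⁅ξ, η⁆ :=
  ((Rep.represents_iff Q).1 (secBracket_rep H H')).2

theorem secBracket_add_left (s s' t : (inverseImage f Q).Sec V) :
    secBracket Q (s + s') t = secBracket Q s t + secBracket Q s' t :=
  sec_locality fun y hy => by
    obtain ⟨W, hW, U, hf, r, r', r'', ξ, η, ζ, hyW, H, H', H''⟩ := exists_represents₃ s s' t hy
    exact ⟨W, hW, hyW, by
      rw [res_sec_add, res_secBracket_eq H H'', res_secBracket_eq H' H'',
        res_secBracket_eq (rep_add H H') H'', Rep.val_add_bracket]⟩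

theorem secBracket_symm (s t : (inverseImage f Q).Sec V) :
    secBracket Q s t + secBracket Q t s = secCoanchor Q (Form.d (secPairing Q s t)) :=
  sec_locality fun y hy => by
    obtain ⟨W, hW, U, hf, r, r', ξ, η, hyW, H, H'⟩ := exists_represents₂ s t hy
    exact ⟨W, hW, hyW, by
      rw [res_sec_add, res_secBracket_eq H H', res_secBracket_eq H' H, res_secCoanchor,
        Form.res_d, secPairing_rep H H', Rep.val_bracket_add_val_bracket]⟩

/-- Follows from additivity on the left, since the bracket is determined by its reversal and the
pairing. -/
theorem secBracket_add_right (s t t' : (inverseImage f Q).Sec V) :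
    secBracket Q s (t + t') = secBracket Q s t + secBracket Q s t' := by
  have e : ∀ t, secBracket Q s t = secCoanchor Q (Form.d (secPairing Q t s)) - secBracket Q t s :=
    fun t => by rw [← secBracket_symm, add_sub_cancel_left]
  rw [e, e t, e t', secPairing_add_left, secBracket_add_left, Form.d_add, map_add]
  abel

theorem secBracket_jacobi (s t u : (inverseImage f Q).Sec V) :
    secBracket Q s (secBracket Q t u) =
      secBracket Q (secBracket Q s t) u + secBracket Q t (secBracket Q s u) :=
  sec_locality fun y hy => by
    obtain ⟨W, hW, U, hf, r, r', r'', ξ, η, ζ, hyW, H, H', H''⟩ := exists_represents₃ s t u hy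
    exact ⟨W, hW, hyW, by
      rw [res_sec_add, res_secBracket_eq H (secBracket_rep H' H''),
        res_secBracket_eq (secBracket_rep H H') H'', res_secBracket_eq H' (secBracket_rep H H''),
        Rep.val_jacobi Q hf H.1 H'.1 H''.1]⟩

theorem secAnchor_bracket (s t : (inverseImage f Q).Sec V) :
    secAnchor Q (secBracket Q s t) = ⁅secAnchor Q s, secAnchor Q t⁆ :=
  VField.locality fun y hy => by
    obtain ⟨W, hW, U, hf, r, r', ξ, η, hyW, H, H'⟩ := exists_represents₂ s t hy
    exact ⟨W, hW, hyW, by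
      rw [VField.res_bracket, secAnchor_rep H, secAnchor_rep H',
        secAnchor_rep (secBracket_rep H H')]⟩

theorem secAnchor_add (s t : (inverseImage f Q).Sec V) :
    secAnchor Q (s + t) = secAnchor Q s + secAnchor Q t :=
  VField.locality fun y hy => by
    obtain ⟨W, hW, U, hf, r, r', ξ, η, hyW, H, H'⟩ := exists_represents₂ s t hy
    exact ⟨W, hW, hyW, by
      rw [map_add, secAnchor_rep H, secAnchor_rep H', secAnchor_rep (rep_add H H')]⟩

theorem secAnchor_smul (φ : Y.O V) (s : (inverseImage f Q).Sec V) :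
    secAnchor Q (φ • s) = φ • secAnchor Q s :=
  VField.locality fun y hy => by
    obtain ⟨W, hW, U, hf, r, ξ, hyW, H⟩ := exists_represents s hy
    exact ⟨W, hW, hyW, by
      rw [VField.res_smul, secAnchor_rep H, secAnchor_rep (rep_smul H φ)]⟩

theorem secAnchor_coanchor (α : Form Y 1 V) : secAnchor Q (secCoanchor (f := f) Q α) = 0 :=
  secAnchor_rep (secCoanchor_rep (U := ⊤) le_rfl (fun _ _ => trivial) α)

theorem secBracket_smul (s t : (inverseImage f Q).Sec V) (φ : Y.O V) :
    secBracket Q s (φ • t) = φ • secBracket Q s t + (secAnchor Q s).act φ • t :=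
  sec_locality fun y hy => by
    obtain ⟨W, hW, U, hf, r, r', ξ, η, hyW, H, H'⟩ := exists_represents₂ s t hy
    exact ⟨W, hW, hyW, by
      rw [res_sec_add, res_sec_smul, res_sec_smul, res_secBracket_eq H (rep_smul H' φ),
        res_secBracket_eq H H', Rep.val_bracket_smul, ((Rep.represents_iff Q).1 H').2,
        ← VField.res_act, secAnchor_rep H]⟩

theorem secPairing_bracket (s t u : (inverseImage f Q).Sec V) :
    secPairing Q (secBracket Q s t) u + secPairing Q t (secBracket Q s u) =
      (secAnchor Q s).act (secPairing Q t u) :=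
  O_locality fun y hy => by
    obtain ⟨W, hW, U, hf, r, r', r'', ξ, η, ζ, hyW, H, H', H''⟩ := exists_represents₃ s t u hy
    exact ⟨W, hW, hyW, by
      rw [map_add, secPairing_rep (secBracket_rep H H') H'',
        secPairing_rep H' (secBracket_rep H H''), ← VField.res_act, secAnchor_rep H,
        secPairing_rep H' H'', Rep.pair_bracket_add Q hf H.1]⟩

theorem secBracket_coanchor (s : (inverseImage f Q).Sec V) (α : Form Y 1 V) :
    secBracket Q s (secCoanchor Q α) = secCoanchor Q (Form.lie (secAnchor Q s) α) :=
  sec_locality fun y hy => by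
    obtain ⟨W, hW, U, hf, r, ξ, hyW, H⟩ := exists_represents s hy
    exact ⟨W, hW, hyW, by
      rw [res_secBracket_eq H (secCoanchor_rep hW hf α), Rep.val_bracket_form, res_secCoanchor,
        Form.res_lie, secAnchor_rep H]⟩

theorem secPairing_coanchor (s : (inverseImage f Q).Sec V) (α : Form Y 1 V) :
    secPairing Q s (secCoanchor Q α) = α.ap (secAnchor Q s) :=
  O_locality fun y hy => by
    obtain ⟨W, hW, U, hf, r, ξ, hyW, H⟩ := exists_represents s hy
    exact ⟨W, hW, hyW, by
      rw [secPairing_rep H (secCoanchor_rep hW hf α), Rep.pair_form, ← Form.res_ap,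
        secAnchor_rep H]⟩

theorem res_secBracket (h : V' ≤ V) (s t : (inverseImage f Q).Sec V) :
    (inverseImage f Q).res h (secBracket Q s t) =
      secBracket Q ((inverseImage f Q).res h s) ((inverseImage f Q).res h t) :=
  sec_locality fun y hy => by
    obtain ⟨W, hW, U, hf, r, r', ξ, η, hyW, H, H'⟩ := exists_represents₂
      ((inverseImage f Q).res h s) ((inverseImage f Q).res h t) hy
    refine ⟨W, hW, hyW, ?_⟩
    rw [res_secBracket_eq H H']
    exact res_secBracket_eq (s := s) (t := t) (hW := hW.trans h) H H'

theorem res_secPairing (h : V' ≤ V) (s t : (inverseImage f Q).Sec V) :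
    Y.resO h (secPairing Q s t) =
      secPairing Q ((inverseImage f Q).res h s) ((inverseImage f Q).res h t) :=
  O_locality fun y hy => by
    obtain ⟨W, hW, U, hf, r, r', ξ, η, hyW, H, H'⟩ := exists_represents₂
      ((inverseImage f Q).res h s) ((inverseImage f Q).res h t) hy
    refine ⟨W, hW, hyW, ?_⟩
    rw [secPairing_rep H H']
    exact secPairing_rep (s := s) (t := t) (hW := hW.trans h) H H'

theorem res_secAnchor (h : V' ≤ V) (s : (inverseImage f Q).Sec V) :
    VField.res h (secAnchor Q s) = secAnchor Q ((inverseImage f Q).res h s) :=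
  VField.locality fun y hy => by
    obtain ⟨W, hW, U, hf, r, ξ, hyW, H⟩ := exists_represents ((inverseImage f Q).res h s) hy
    refine ⟨W, hW, hyW, ?_⟩
    rw [secAnchor_rep H]
    exact secAnchor_rep (s := s) (hW := hW.trans h) H

end

variable (f) (Q : CourantStr M)

/-- The Courant algebroid structure of the inverse image. -/
noncomputable def courantStr : CourantStr (inverseImage f Q) where
  bracket V s t := secBracket Q s t
  pairing V := LinearMap.mk₂ (Y.O V) (secPairing Q) secPairing_add_left secPairing_smul_left
    (fun s t t' => by
      rw [secPairing_symm, secPairing_add_left, secPairing_symm t, secPairing_symm t'])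
    (fun φ s t => by rw [secPairing_symm, secPairing_smul_left, secPairing_symm t])
  anchor V := ⟨⟨secAnchor Q, secAnchor_add⟩, secAnchor_smul⟩
  coanchor V := secCoanchor Q
  res_bracket h s t := res_secBracket h s t
  res_pairing h s t := res_secPairing h s t
  res_anchor h s := res_secAnchor h s
  res_coanchor h α := Subtype.ext (res_omega f Q h α)
  add_bracket := secBracket_add_left
  bracket_add := secBracket_add_right
  jacobi := secBracket_jacobi
  anchor_bracket := secAnchor_bracket
  pairing_symm := secPairing_symm
  anchor_coanchor := secAnchor_coanchor
  bracket_smul := secBracket_smul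
  pairing_bracket := secPairing_bracket
  bracket_coanchor := secBracket_coanchor
  pairing_coanchor := secPairing_coanchor
  bracket_symm := secBracket_symm

theorem isInverseImage_courantStr : IsInverseImage f Q (courantStr f Q) where
  bracket_eq W U hf r r' ξ η s t H H' := secBracket_rep (hW := le_rfl) H H'
  pairing_eq W U hf r r' ξ η s t H H' := secPairing_rep (hW := le_rfl) H H'
  anchor_eq W U hf r ξ s H := secAnchor_rep (hW := le_rfl) H
  coanchor_eq W U hf α := represents_omega Q hf α

variable {f Q}

theorem _root_.CourantStr.ext_of {X : Mfd.{u, v} 𝕜 K n} {M : SMod.{u, v, w} X}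
    {P P' : CourantStr M} (h₁ : ∀ V s t, P.bracket V s t = P'.bracket V s t)
    (h₂ : ∀ V s t, P.pairing V s t = P'.pairing V s t) (h₃ : ∀ V s, P.anchor V s = P'.anchor V s)
    (h₄ : ∀ V α, P.coanchor V α = P'.coanchor V α) : P = P' := by
  cases P
  cases P'
  congr 1
  · exact funext fun V => funext fun s => funext fun t => h₁ V s t
  · exact funext fun V => LinearMap.ext₂ (h₂ V)
  · exact funext fun V => LinearMap.ext (h₃ V)
  · exact funext fun V => LinearMap.ext (h₄ V)

/-- Any two sections have representing triples on a common neighbourhood of each point, and the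
formulas determine the restricted operations there. -/
theorem IsInverseImage.unique {P P' : CourantStr (inverseImage f Q)} (H : IsInverseImage f Q P)
    (H' : IsInverseImage f Q P') : P' = P := by
  refine CourantStr.ext_of (fun V s t => sec_locality fun y hy => ?_)
    (fun V s t => O_locality fun y hy => ?_) (fun V s => VField.locality fun y hy => ?_)
    (fun V α => Subtype.ext ?_)
  · obtain ⟨W, hW, U, hf, r, r', ξ, η, hyW, h, h'⟩ := exists_represents₂ s t hy
    refine ⟨W, hW, hyW, ?_⟩
    have e := ((Rep.represents_iff Q).1 (H.bracket_eq W U hf r r' ξ η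
      ((inverseImage f Q).res hW s) ((inverseImage f Q).res hW t) h h')).2
    have e' := ((Rep.represents_iff Q).1 (H'.bracket_eq W U hf r r' ξ η
      ((inverseImage f Q).res hW s) ((inverseImage f Q).res hW t) h h')).2
    rw [← P.res_bracket] at e
    rw [← P'.res_bracket] at e'
    exact e'.trans e.symm
  · obtain ⟨W, hW, U, hf, r, r', ξ, η, hyW, h, h'⟩ := exists_represents₂ s t hy
    refine ⟨W, hW, hyW, ?_⟩
    rw [P.res_pairing, P'.res_pairing]
    exact (H'.pairing_eq W U hf r r' ξ η _ _ h h').trans (H.pairing_eq W U hf r r' ξ η _ _ h h').symm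
  · obtain ⟨W, hW, U, hf, r, ξ, hyW, h⟩ := exists_represents s hy
    refine ⟨W, hW, hyW, ?_⟩
    rw [P.res_anchor, P'.res_anchor]
    exact (H'.anchor_eq W U hf r ξ _ h).trans (H.anchor_eq W U hf r ξ _ h).symm
  · exact ((Rep.represents_iff Q).1 (H'.coanchor_eq V ⊤ (fun _ _ => trivial) α)).2.trans
      ((Rep.represents_iff Q).1 (H.coanchor_eq V ⊤ (fun _ _ => trivial) α)).2.symm

end InverseImage

end Structure

/-! ### Exactness of the inverse image. -/

section Exactness

variable {𝕜 K : Type} [RCLike 𝕜] [RCLike K] [NormedAlgebra 𝕜 K] {n : WithTop ℕ∞}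
  [Fact (n = ∞ ∨ n = ω)]

open Mfd PMod

/-- Finitely many local conditions hold on a common neighbourhood. -/
theorem exists_common_nhd {T : Type*} [TopologicalSpace T] {ι : Type*} [Finite ι]
    {p : ι → Opens T → Prop} (hp : ∀ i U V, V ≤ U → p i U → p i V) {U : Opens T} {x : T}
    (hx : x ∈ U) (h : ∀ i, ∃ V ≤ U, x ∈ V ∧ p i V) : ∃ V ≤ U, x ∈ V ∧ ∀ i, p i V := by
  have := Fintype.ofFinite ι
  choose V hV hxV hpV using h
  refine ⟨U ⊓ Finset.univ.inf V, inf_le_left, ⟨hx, ?_⟩, fun i =>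
    hp i _ _ (inf_le_right.trans (Finset.inf_le (Finset.mem_univ i))) (hpV i)⟩
  rw [Opens.coe_finset_inf]
  simpa using hxV

namespace CourantStr

variable {X : Mfd.{u, v} 𝕜 K n} {M : SMod.{u, v, w} X} {Q : CourantStr M}

/-- The coordinate vector fields lift locally along a surjective anchor. -/
theorem IsExact.exists_lift_coordField (hQ : Q.IsExact) {U : Opens X} {x : X} (hx : x ∈ U)
    (p : X) (hU : U ≤ chartDom p) : ∃ (V : Opens X) (hV : V ≤ U) (e : X.Idx → M.Sec V), x ∈ V ∧
      ∀ k, Q.anchor V (e k) = VField.res (hV.trans hU) (coordField p k) := by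
  obtain ⟨V, hV, hxV, h⟩ := exists_common_nhd (ι := X.Idx) (p := fun k V => ∃ (hV : V ≤ U)
    (e : M.Sec V), Q.anchor V e = VField.res (hV.trans hU) (coordField p k))
    (by
      rintro k V V' h ⟨hV, e, he⟩
      exact ⟨h.trans hV, M.res h e, by rw [← Q.res_anchor, he]; rfl⟩) hx
    (fun k => by
      obtain ⟨V, hV, q, hxV, hq⟩ := hQ.2.2 U (VField.res hU (coordField p k)) x hx
      exact ⟨V, hV, hxV, hV, q, hq⟩)
  choose hV' e he using h
  exact ⟨V, hV, e, hxV, he⟩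

end CourantStr

namespace InverseImage

variable {Y : Mfd.{w₁, w₂} 𝕜 K n} {X : Mfd.{u, v} 𝕜 K n} {f : Y.Hom X}
  {M : SMod.{u, v, w} X} {Q : CourantStr M}

theorem d_pull_eq_sum (p : X) {W : Opens Y} {V : Opens X} (hV : V ≤ chartDom p)
    (hf : W ≤ pre f V) (φ : X.O V) :
    Form.d (pull f hf φ) = ∑ k, pull f hf (pd p k V hV φ) •
      Form.d (pull f hf (X.resO hV (coord p k))) :=
  Form.ext_ap fun W' hW' ζ => by
    rw [Form.res_d, Form.d_ap, map_sum, Form.sum_ap]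
    refine (act_pull_eq_sum f p hV (hW'.trans hf) ζ φ).trans (Finset.sum_congr rfl fun k _ => ?_)
    rw [Form.res_smul, Form.smul_ap, mul_comm]
    rfl

/-- A left inverse of the co-anchor exists on each stalk. With eₖ lifting ∂ₖ, send h⊗m to ∑ h
f^*⟨m,eₖ⟩ d(xₖ∘f); on 1⊗π†dψ this gives ∑ f^*(∂ₖψ) d(xₖ∘f) = d(ψ∘f), so the relations are respected.
-/
theorem secCoanchor_injective (hQ : Q.IsExact) (V : Opens Y) :
    Function.Injective (secCoanchor Q : Form Y 1 V →ₗ[Y.O V] (inverseImage f Q).Sec V) := by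
  rw [injective_iff_map_eq_zero]
  intro α hα
  refine Form.eq_of_gm_eq fun y => ?_
  obtain ⟨y, hy⟩ := y
  obtain ⟨U, hU, e, hyU, he⟩ := hQ.exists_lift_coordField (mem_chartDom (f y)) (f y) le_rfl
  let W := V ⊓ pre f U
  have hf : W ≤ pre f U := inf_le_right
  have hyW : y ∈ W := ⟨hy, hyU⟩
  let dx : X.Idx → (forms Y 1).Germ y := fun k =>
    gm (P := forms Y 1) y hyW (Form.d (pull f hf (X.resO hU (coord (f y) k))))
  let b : Y.OGerm y →+ M.toPMod.Germ (f y) →+ (forms Y 1).Germ y :=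
    AddMonoidHom.mk' (fun h => AddMonoidHom.mk' (fun m =>
      ∑ k, (h * pullGerm f y (Q.germPairing (e k) hyU m)) • dx k)
      (fun m m' => by simp only [map_add, mul_add, add_smul, Finset.sum_add_distrib]))
      (fun h h' => by
        refine AddMonoidHom.ext fun m => ?_
        simp only [add_mul, add_smul, Finset.sum_add_distrib, AddMonoidHom.add_apply,
          AddMonoidHom.mk'_apply])
  have hb : ∀ (W' : Opens Y) (hW : W' ≤ W) (U' : Opens X) (hU' : U' ≤ U) (hf' : W' ≤ pre f U')
      (hy : y ∈ W') (h : Y.O W') (q : M.Sec U'),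
      b (og y hy h) (gm (P := M.toPMod) (f y) (mem_of hf' hy) q) =
        gm (P := forms Y 1) y hy (∑ k, (h * pull f hf' (Q.pairing U' q (M.res hU' (e k)))) •
          Form.d (pull f hf' (X.resO (hU'.trans hU) (coord (f y) k)))) := by
    intro W' hW U' hU' hf' hy' h q
    let Φ : Form Y 1 W' →+ (forms Y 1).Germ y :=
      ⟨⟨gm (P := forms Y 1) y hy', gm_zero (P := forms Y 1) hy'⟩, gm_add (P := forms Y 1) hy'⟩
    refine Eq.trans ?_ (map_sum Φ (fun k => (h * pull f hf' (Q.pairing U' q (M.res hU' (e k)))) •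
      Form.d (pull f hf' (X.resO (hU'.trans hU) (coord (f y) k)))) Finset.univ).symm
    change ∑ k, (og y hy' h * pullGerm f y (Q.germPairing (e k) hyU
      (gm (P := M.toPMod) (f y) (mem_of hf' hy') q))) • dx k = _
    refine Finset.sum_congr rfl fun k _ => ?_
    change _ = gm (P := forms Y 1) y hy' (_ • _)
    rw [gm_smul (P := forms Y 1), og_mul, ← Q.germPairing_res hU' (e k) (mem_of hf' hy'),
      Q.germPairing_gm, pullGerm_og f hf' hy']
    exact congrArg _ (gm_res (P := forms Y 1) y hW hy' _).symm
  obtain ⟨F, hF, hF'⟩ := exists_lift Q hf hyW (AddMonoidHom.id _) b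
    (fun W' hW U' hU' hf' hy' φ h q => by
      rw [hb W' hW U' hU' hf', hb W' hW U' hU' hf']
      refine congrArg _ (Finset.sum_congr rfl fun k _ => ?_)
      rw [map_smul, LinearMap.smul_apply, smul_eq_mul, map_mul, mul_comm (pull f hf' φ), mul_assoc])
    (fun W' hW U' hU' hf' hy' c ψ => by
      rw [hb W' hW U' hU' hf', d_pull_eq_sum (f y) (hU'.trans hU) hf', Finset.smul_sum]
      refine congrArg (gm (P := forms Y 1) y hy') (Finset.sum_congr rfl fun k _ => ?_)
      rw [Q.coanchor_d_pairing, ← Q.res_anchor, he, smul_smul]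
      rfl)
  have h0 : omega f Q α ⟨y, hy⟩ = 0 := congrFun (congrArg Subtype.val hα) ⟨y, hy⟩
  -- The class of (α, 0) vanishes, and F is the identity on forms.
  have h1 := hF' (gm (P := forms Y 1) y hy α, 0) (0, 0) (congrArg Prod.fst h0)
  have h2 : ∀ β, F (β, 0) = β := fun β => by
    have := hF Empty ∅ β Empty.elim Empty.elim
    simpa using this
  rw [h2, h2] at h1
  exact h1.trans (gm_zero (P := forms Y 1) hy).symm

/-- Modulo the image of π† each qᵢ is ∑ π(qᵢ)(xₖ)eₖ. When ξ = 0 the coefficients of the eₖ sum to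
zero over i, and the π† parts turn into pulled-back forms by the relations. -/
theorem exists_secCoanchor (hQ : Q.IsExact) {V : Opens Y} (s : (inverseImage f Q).Sec V)
    (hs : secAnchor Q s = 0) {y : Y} (hy : y ∈ V) :
    ∃ (W : Opens Y) (hW : W ≤ V) (α : Form Y 1 W), y ∈ W ∧
      (inverseImage f Q).res hW s = secCoanchor Q α := by
  obtain ⟨W, hW, U, hf, r, ξ, hyW, H⟩ := exists_represents s hy
  have hξ : ξ = 0 := by rw [← secAnchor_rep H, hs, map_zero]
  subst hξ
  obtain ⟨U₁, hU₁, e, hyU₁, he⟩ := hQ.exists_lift_coordField (U := U ⊓ chartDom (f y))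
    ⟨hf hyW, mem_chartDom (f y)⟩ (f y) inf_le_right
  have hc : U₁ ≤ chartDom (f y) := hU₁.trans inf_le_right
  have hUU₁ : U₁ ≤ U := hU₁.trans inf_le_left
  -- Exactness of Q gives each γᵢ only near f(y); there are finitely many i, so one neighbourhood
  -- serves all of them.
  obtain ⟨U₂, hU₂, hyU₂, hγ⟩ := exists_common_nhd (ι := r.ι) (p := fun i V => ∃ (hV : V ≤ U₁)
      (γ : Form X 1 V), M.res (hV.trans hUU₁) (r.q i) =
        ∑ k, (Q.anchor V (M.res (hV.trans hUU₁) (r.q i))).act (X.resO (hV.trans hc) (coord (f y) k)) •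
          M.res hV (e k) + Q.coanchor V γ)
    (by
      rintro i V V' h ⟨hV, γ, hγ⟩
      refine ⟨h.trans hV, Form.res h γ, ?_⟩
      have := congrArg (M.res h) hγ
      rw [M.res_res, map_add, map_sum, Q.res_coanchor] at this
      refine this.trans (congrArg₂ (· + ·) (Finset.sum_congr rfl fun k _ => ?_) rfl)
      rw [M.res_smul, M.res_res, ← VField.res_act, Q.res_anchor, M.res_res]
      rfl) hyU₁
    (fun i => by
      let q := M.res hUU₁ (r.q i)
      have h0 : Q.anchor U₁ (q - ∑ k, (Q.anchor U₁ q).act (X.resO hc (coord (f y) k)) • e k) = 0 := by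
        rw [map_sub, map_sum, sub_eq_zero]
        simp only [map_smul, he]
        exact VField.eq_sum_coordField (f y) hc _
      obtain ⟨V, hV, γ, hyV, hγ⟩ := hQ.2.1 U₁ _ h0 (f y) hyU₁
      refine ⟨V, hV, hyV, hV, γ, ?_⟩
      rw [← hγ, map_sub, map_sum, M.res_res, ← add_sub_assoc, eq_sub_iff_add_eq, add_comm]
      refine congrArg₂ (· + ·) (Finset.sum_congr rfl fun k _ => ?_) rfl
      rw [M.res_smul, ← VField.res_act, Q.res_anchor, M.res_res]
      rfl)
  choose hU₂' γ hγ using hγ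
  let W₂ := W ⊓ pre f U₂
  have hf₂ : W₂ ≤ pre f U₂ := inf_le_right
  have hWW₂ : W₂ ≤ W := inf_le_left
  have H₂ := H.res hWW₂ (hU₂.trans hUU₁) hf₂
  let x : X.Idx → X.O U₂ := fun k => X.resO (hU₂.trans hc) (coord (f y) k)
  refine ⟨W₂, hWW₂.trans hW, Form.res hWW₂ r.α + ∑ i, ∑ k, (Y.resO hWW₂ (r.h i) * pull f hf₂
    ((γ i).ap (VField.res (hU₂.trans hc) (coordField (f y) k)))) • Form.d (pull f hf₂ (x k)),
    ⟨hyW, hyU₂⟩, Subtype.ext ?_⟩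
  refine ((Rep.represents_iff Q).1 H₂).2.trans ?_
  change _ = omega f Q _
  rw [Rep.val, map_zero, map_zero, add_zero, Rep.fst, map_add]
  refine congrArg (omega f Q (Form.res hWW₂ r.α) + ·) ?_
  have e1 : ∀ i, Y.resO hWW₂ (r.h i) • tau f Q hf₂ (M.res (hU₂.trans hUU₁) (r.q i)) =
      ∑ k, (Y.resO hWW₂ (r.h i) * pull f hf₂
        ((Q.anchor U₂ (M.res (hU₂.trans hUU₁) (r.q i))).act (x k))) •
          tau f Q hf₂ (M.res hU₂ (e k)) +
      ∑ k, (Y.resO hWW₂ (r.h i) * pull f hf₂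
        ((γ i).ap (VField.res (hU₂.trans hc) (coordField (f y) k)))) •
          omega f Q (Form.d (pull f hf₂ (x k))) := by
    intro i
    have h1 : tau f Q hf₂ (M.res (hU₂.trans hUU₁) (r.q i)) = _ := congrArg (tau f Q hf₂) (hγ i)
    have h2 : Q.coanchor U₂ (γ i) = ∑ k, (γ i).ap (VField.res (hU₂.trans hc)
        (coordField (f y) k)) • Q.coanchor U₂ (Form.d (x k)) := by
      conv_lhs => rw [Form.eq_sum_d_coord (f y) (hU₂.trans hc) (γ i), map_sum]
      exact Finset.sum_congr rfl fun k _ => map_smul _ _ _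
    rw [h1, map_add, map_sum, h2, map_sum, smul_add, Finset.smul_sum, Finset.smul_sum]
    refine congrArg₂ (· + ·) (Finset.sum_congr rfl fun k _ => ?_)
      (Finset.sum_congr rfl fun k _ => ?_)
    · rw [tau_smul, smul_smul]
    · rw [tau_smul, smul_smul, tau_coanchor_d]
  refine (Finset.sum_congr (s₁ := (Finset.univ : Finset r.ι)) rfl fun i _ => e1 i).trans ?_
  rw [Finset.sum_add_distrib, Finset.sum_comm, map_sum]
  have e2 : ∀ k, ∑ i, (Y.resO hWW₂ (r.h i) * pull f hf₂
        ((Q.anchor U₂ (M.res (hU₂.trans hUU₁) (r.q i))).act (x k))) •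
          tau f Q hf₂ (M.res hU₂ (e k)) = 0 := by
    intro k
    rw [← Finset.sum_smul]
    -- By compatibility ∑ hᵢ f^*(π(qᵢ)xₖ) is the zero vector field applied to xₖ∘f.
    refine (congrArg (· • _) (DfEq.act_pull H₂.1 hf₂ (x k)).symm).trans ?_
    exact zero_smul _ _
  rw [Finset.sum_eq_zero fun k _ => e2 k, zero_add]
  refine Finset.sum_congr rfl fun i _ => ?_
  rw [map_sum]
  exact Finset.sum_congr rfl fun k _ => (map_smul _ _ _).symm

theorem exists_sec_of_rep {W : Opens Y} {U : Opens X} {hf : W ≤ pre f U} {r : Rep M W U}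
    {ξ : VField Y W} (H : r.Compat Q f ξ) :
    ∃ s : (inverseImage f Q).Sec W, r.Represents hf ξ (Fam.res f Q le_rfl s.1) :=
  ⟨⟨r.val Q hf ξ, fun y hy => ⟨W, le_rfl, U, hf, r, ξ, hy, (Rep.represents_iff Q).2 ⟨H, rfl⟩⟩⟩,
    (Rep.represents_iff Q).2 ⟨H, rfl⟩⟩

theorem isExact_courantStr (hQ : Q.IsExact) : (courantStr f Q).IsExact := by
  refine ⟨secCoanchor_injective hQ, fun V s hs y hy => ?_, fun V ξ y hy => ?_⟩
  · obtain ⟨W, hW, α, hyW, h⟩ := exists_secCoanchor hQ s hs hy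
    exact ⟨W, hW, α, hyW, h⟩
  · obtain ⟨U, hU, e, hyU, he⟩ := hQ.exists_lift_coordField (mem_chartDom (f y)) (f y) le_rfl
    let W := V ⊓ pre f U
    have hf : W ≤ pre f U := inf_le_right
    let ζ : VField Y W := VField.res inf_le_left ξ
    -- The coordinate expression of df(ζ), with each ∂ₖ replaced by its lift eₖ, is a preimage of ζ
    -- under the anchor.
    let r : Rep M W U := ⟨0, X.Idx, fun k => ζ.act (pull f hf (X.resO hU (coord (f y) k))), e⟩
    have hr : r.Compat Q f ζ := by
      have := DfEq_coord f (f y) hU hf ζ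
      simp only [← he] at this
      exact this
    obtain ⟨s, hs⟩ := exists_sec_of_rep (hf := hf) hr
    exact ⟨W, inf_le_left, s, ⟨hy, hyU⟩, secAnchor_rep hs⟩

end InverseImage

end Exactness

/-! ### The induced connection. -/

section InducedMap

variable {𝕜 K : Type} [RCLike 𝕜] [RCLike K] [NormedAlgebra 𝕜 K] {n : WithTop ℕ∞}
  [Fact (n = ∞ ∨ n = ω)]

open Mfd PMod

theorem TMap.ext_of {X : Mfd.{u, v} 𝕜 K n} {M : SMod.{u, v, w} X} {U : Opens X} {D D' : TMap M U}
    (h : ∀ V hV ξ, D.toFun V hV ξ = D'.toFun V hV ξ) : D = D' := by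
  cases D
  cases D'
  congr 1
  exact funext fun V => funext fun hV => LinearMap.ext (h V hV)

namespace InverseImage

variable {Y : Mfd.{w₁, w₂} 𝕜 K n} {X : Mfd.{u, v} 𝕜 K n} {f : Y.Hom X}
  {M : SMod.{u, v, w} X} {Q : CourantStr M} {U : Opens X} {D : TMap M U}

/-- Expand each vᵢ in the frame ∂ₖ and use linearity of D. The resulting coefficients ∑ hᵢ
f^*(vᵢ(xₖ)) equal ξ(xₖ∘f), so the sum depends on ξ alone and not on how df(ξ) is written. -/
theorem sum_smul_tau_eq (D : TMap M U) {p : X} {W : Opens Y} {U' : Opens X} (hU : U' ≤ U)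
    (hp : U' ≤ chartDom p) (hf : W ≤ pre f U') {ι : Type} [Fintype ι] {ξ : VField Y W}
    {h : ι → Y.O W} {v : ι → VField X U'} (H : DfEq f ξ h v) :
    ∑ i, h i • tau f Q hf (D.toFun U' hU (v i)) =
      ∑ k, ξ.act (pull f hf (X.resO hp (coord p k))) •
        tau f Q hf (D.toFun U' hU (VField.res hp (coordField p k))) := by
  have e : ∀ i, h i • tau f Q hf (D.toFun U' hU (v i)) =
      ∑ k, (h i * pull f hf ((v i).act (X.resO hp (coord p k)))) •
        tau f Q hf (D.toFun U' hU (VField.res hp (coordField p k))) := by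
    intro i
    conv_lhs => rw [VField.eq_sum_coordField p hp (v i), map_sum, map_sum, Finset.smul_sum]
    refine Finset.sum_congr rfl fun k _ => ?_
    rw [map_smul, tau_smul, smul_smul]
  rw [Finset.sum_congr rfl fun i _ => e i, Finset.sum_comm]
  refine Finset.sum_congr rfl fun k _ => ?_
  rw [← Finset.sum_smul, DfEq.act_pull H hf]

variable (Q) in
theorem res_val_of_DfEq (D : TMap M U) {p : X} {W W' : Opens Y} {U' U'' : Opens X} (hU : U' ≤ U)
    (hp : U'' ≤ chartDom p) (hf : W ≤ pre f U') (hf' : W' ≤ pre f U'') (hW' : W' ≤ W)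
    (hU' : U'' ≤ U') {ι : Type} [Fintype ι] {ξ : VField Y W}
    {h : ι → Y.O W} {v : ι → VField X U'} (H : DfEq f ξ h v) :
    Fam.res f Q hW' ((⟨0, ι, h, fun i => D.toFun U' hU (v i)⟩ : Rep M W U').val Q hf ξ) =
      ∑ k, (VField.res hW' ξ).act (pull f hf' (X.resO hp (coord p k))) •
        tau f Q hf' (D.toFun U'' (hU'.trans hU) (VField.res hp (coordField p k))) +
      sigma f Q (VField.res hW' ξ) := by
  rw [← sum_smul_tau_eq D (hU'.trans hU) hp hf' (H.res hW' hU'), Rep.res_val Q hf hf' hW' hU',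
    Rep.val, Rep.fst]
  refine congrArg (· + _) ?_
  change omega f Q (Form.res hW' 0) + ∑ i : ι, Y.resO hW' (h i) • tau f Q hf'
    (M.res hU' (D.toFun U' hU (v i))) = _
  rw [map_zero, map_zero, zero_add]
  exact Finset.sum_congr rfl fun i _ => by rw [← D.natural U' U'' hU hU']

theorem exists_induced (hD : ∀ (V : Opens X) (h : V ≤ U) (ξ : VField X V),
      Q.anchor V (D.toFun V h ξ) = ξ) {V : Opens Y} (hV : V ≤ pre f U) (ξ : VField Y V) :
    ∃ s : (inverseImage f Q).Sec V, ∀ (W : Opens Y) (hW : W ≤ V) (U' : Opens X) (hU : U' ≤ U)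
      (hf : W ≤ pre f U') (ι : Type) (_ : Fintype ι) (h : ι → Y.O W) (v : ι → VField X U'),
      DfEq f (VField.res hW ξ) h v →
        (⟨0, ι, h, fun i => D.toFun U' hU (v i)⟩ : Rep M W U').Represents hf (VField.res hW ξ)
          (Fam.res f Q hW s.1) := by
  have key : ∀ y : V, ∃ c : Stalk f Q y.1, ∀ (W : Opens Y) (hW : W ≤ V) (U' : Opens X)
      (hU : U' ≤ U) (hf : W ≤ pre f U') (ι : Type) (_ : Fintype ι) (h : ι → Y.O W)
      (v : ι → VField X U') (hy : y.1 ∈ W), DfEq f (VField.res hW ξ) h v →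
        c = (⟨0, ι, h, fun i => D.toFun U' hU (v i)⟩ : Rep M W U').val Q hf (VField.res hW ξ)
          ⟨y.1, hy⟩ := by
    rintro ⟨y, hy⟩
    -- The coordinate decomposition at f(y) serves as reference; any other decomposition is compared
    -- with it after restriction to the intersection.
    obtain ⟨W₀, U₀, hW₀, hU₀, hp, hyW₀, hf₀, hyU₀⟩ := exists_chart_nhd f hy (hV hy)
    refine ⟨(⟨0, X.Idx, fun k => (VField.res hW₀ ξ).act (pull f hf₀ (X.resO hp (coord (f y) k))),
      fun k => D.toFun U₀ hU₀ (VField.res hp (coordField (f y) k))⟩ : Rep M W₀ U₀).val Q hf₀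
        (VField.res hW₀ ξ) ⟨y, hyW₀⟩, fun W hW U' hU hf ι _ h v hy' H => ?_⟩
    have hf₁ : W ⊓ W₀ ≤ pre f (U' ⊓ U₀) := fun z hz => ⟨hf hz.1, hf₀ hz.2⟩
    have hp₁ : U' ⊓ U₀ ≤ chartDom (f y) := inf_le_right.trans hp
    exact (congrFun (res_val_of_DfEq Q D hU₀ hp₁ hf₀ hf₁ inf_le_right inf_le_right
      (DfEq_coord f (f y) hp hf₀ (VField.res hW₀ ξ))) ⟨y, hy', hyW₀⟩).trans
      (congrFun (res_val_of_DfEq Q D hU hp₁ hf hf₁ inf_le_left inf_le_left H)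
        ⟨y, hy', hyW₀⟩).symm
  choose F hF using key
  have rep : ∀ (W : Opens Y) (hW : W ≤ V) (U' : Opens X) (hU : U' ≤ U)
      (hf : W ≤ pre f U') (ι : Type) (_ : Fintype ι) (h : ι → Y.O W) (v : ι → VField X U'),
      DfEq f (VField.res hW ξ) h v →
        (⟨0, ι, h, fun i => D.toFun U' hU (v i)⟩ : Rep M W U').Represents hf (VField.res hW ξ)
          (fun z => F ⟨z.1, hW z.2⟩) := fun W hW U' hU hf ι _ h v H =>
    (Rep.represents_iff Q).2 ⟨by
      change DfEq f (VField.res hW ξ) h fun i => Q.anchor U' (D.toFun U' hU (v i))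
      simpa only [hD] using H,
      funext fun z => hF ⟨z.1, hW z.2⟩ W hW U' hU hf ι _ h v z.2 H⟩
  refine ⟨⟨F, fun y hy => ?_⟩, rep⟩
  obtain ⟨W₀, U₀, hW₀, hU₀, hp, hyW₀, hf₀, hyU₀⟩ := exists_chart_nhd f hy (hV hy)
  exact ⟨W₀, hW₀, U₀, hf₀, _, _, hyW₀, rep W₀ hW₀ U₀ hU₀ hf₀ _ _ _ _
    (DfEq_coord f (f y) hp hf₀ _)⟩

/-- The induced map, on a vector field. -/
noncomputable def inducedSec (hD : ∀ (V : Opens X) (h : V ≤ U) (ξ : VField X V),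
      Q.anchor V (D.toFun V h ξ) = ξ) {V : Opens Y} (hV : V ≤ pre f U) (ξ : VField Y V) :
    (inverseImage f Q).Sec V := (exists_induced hD hV ξ).choose

section

variable (hD : ∀ (V : Opens X) (h : V ≤ U) (ξ : VField X V), Q.anchor V (D.toFun V h ξ) = ξ)
  {V : Opens Y} (hV : V ≤ pre f U)

theorem inducedSec_rep (ξ : VField Y V) {W : Opens Y} (hW : W ≤ V) {U' : Opens X}
    (hU : U' ≤ U) (hf : W ≤ pre f U') {ι : Type} [Fintype ι] {h : ι → Y.O W}
    {v : ι → VField X U'} (H : DfEq f (VField.res hW ξ) h v) :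
    (⟨0, ι, h, fun i => D.toFun U' hU (v i)⟩ : Rep M W U').Represents hf (VField.res hW ξ)
      (Fam.res f Q hW (inducedSec hD hV ξ).1) :=
  (exists_induced hD hV ξ).choose_spec W hW U' hU hf ι _ h v H

theorem res_inducedSec (ξ : VField Y V) {W : Opens Y} (hW : W ≤ V) {U' : Opens X}
    (hU : U' ≤ U) (hf : W ≤ pre f U') {p : X} (hp : U' ≤ chartDom p) :
    Fam.res f Q hW (inducedSec hD hV ξ).1 =
      ∑ k, (VField.res hW ξ).act (pull f hf (X.resO hp (coord p k))) •
        tau f Q hf (D.toFun U' hU (VField.res hp (coordField p k))) +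
      sigma f Q (VField.res hW ξ) := by
  refine ((Rep.represents_iff Q).1 (inducedSec_rep hD hV ξ hW hU hf
    (DfEq_coord f p hp hf _))).2.trans ?_
  rw [Rep.val, Rep.fst, map_zero, zero_add]

/-- The map `f^{++}(D)`. -/
noncomputable def inducedMap : TMap (inverseImage f Q) (pre f U) where
  toFun V hV :=
    { toFun := inducedSec hD hV
      map_add' := fun ξ η => sec_locality fun y hy => by
        obtain ⟨W, U', hW, hU, hp, hyW, hf, hyU⟩ := exists_chart_nhd f hy (hV hy)
        refine ⟨W, hW, hyW, ?_⟩
        rw [res_sec_add, res_inducedSec hD hV _ hW hU hf hp, res_inducedSec hD hV _ hW hU hf hp,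
          res_inducedSec hD hV _ hW hU hf hp, map_add, map_add]
        simp only [VField.add_act, add_smul, Finset.sum_add_distrib]
        abel
      map_smul' := fun φ ξ => sec_locality fun y hy => by
        obtain ⟨W, U', hW, hU, hp, hyW, hf, hyU⟩ := exists_chart_nhd f hy (hV hy)
        refine ⟨W, hW, hyW, ?_⟩
        rw [RingHom.id_apply, res_sec_smul, res_inducedSec hD hV _ hW hU hf hp,
          res_inducedSec hD hV _ hW hU hf hp, VField.res_smul, map_smul, smul_add, Finset.smul_sum]
        simp only [VField.smul_act, mul_smul] }
  natural V V' hV h ξ := sec_locality fun y hy => by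
    obtain ⟨W, U', hW, hU, hp, hyW, hf, hyU⟩ := exists_chart_nhd f hy (hV (h hy))
    have hW' : W ⊓ V' ≤ V' := inf_le_right
    have hf' : W ⊓ V' ≤ pre f U' := inf_le_left.trans hf
    refine ⟨W ⊓ V', hW', ⟨hyW, hy⟩, ?_⟩
    exact (res_inducedSec hD (h.trans hV) _ hW' hU hf' hp).trans
      (res_inducedSec hD hV ξ (hW'.trans h) hU hf' hp).symm

theorem isInducedMap_inducedMap : IsInducedMap f Q D (inducedMap (f := f) hD) :=
  fun W hW U' hU hf m ξ h v H => inducedSec_rep hD hW ξ le_rfl hU hf H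

end

theorem IsInducedMap.unique {D' D'' : TMap (inverseImage f Q) (pre f U)}
    (H : IsInducedMap f Q D D') (H' : IsInducedMap f Q D D'') : D'' = D' :=
  TMap.ext_of fun V hV ξ => sec_locality fun y hy => by
    obtain ⟨W, U', hW, hU, hp, hyW, hf, hyU⟩ := exists_chart_nhd f hy (hV hy)
    refine ⟨W, hW, hyW, ?_⟩
    have h1 := ((Rep.represents_iff Q).1 (H W (hW.trans hV) U' hU hf _ _ _ _
      (DfEq_coord f (f y) hp hf (VField.res hW ξ)))).2
    have h2 := ((Rep.represents_iff Q).1 (H' W (hW.trans hV) U' hU hf _ _ _ _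
      (DfEq_coord f (f y) hp hf (VField.res hW ξ)))).2
    rw [D'.natural V W hV hW] at h1
    rw [D''.natural V W hV hW] at h2
    exact h2.trans h1.symm

theorem Rep.pair_of_isotropic {W : Opens Y} (hf : W ≤ pre f U) {r r' : Rep M W U}
    (h : ∀ i j, Q.pairing U (r.q i) (r'.q j) = 0) (hr : r.α = 0) (hr' : r'.α = 0)
    (ξ η : VField Y W) : r.pair Q hf ξ r' η = 0 := by
  rw [pair, hr, hr', Form.zero_ap, Form.zero_ap, add_zero, add_zero]
  refine Finset.sum_eq_zero fun i _ => Finset.sum_eq_zero fun j _ => ?_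
  rw [h, map_zero, mul_zero]

/-- The representing triple of D'(ξ) has vector part ξ, zero form part and tensor factors in the
image of D, so every term of the pairing vanishes by isotropy of D. -/
theorem isConnection_inducedMap (hD : Q.IsConnection D) :
    (courantStr f Q).IsConnection (inducedMap (f := f) hD.1) := by
  refine ⟨fun V hV ξ => VField.locality fun y hy => ?_,
    fun V hV ξ η => O_locality fun y hy => ?_⟩
  · obtain ⟨W, U', hW, hU, hp, hyW, hf, hyU⟩ := exists_chart_nhd f hy (hV hy)
    exact ⟨W, hW, hyW, secAnchor_rep (inducedSec_rep hD.1 hV ξ hW hU hf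
      (DfEq_coord f (f y) hp hf (VField.res hW ξ)))⟩
  · obtain ⟨W, U', hW, hU, hp, hyW, hf, hyU⟩ := exists_chart_nhd f hy (hV hy)
    refine ⟨W, hW, hyW, ?_⟩
    rw [map_zero]
    exact (secPairing_rep (inducedSec_rep hD.1 hV ξ hW hU hf
      (DfEq_coord f (f y) hp hf (VField.res hW ξ))) (inducedSec_rep hD.1 hV η hW hU hf
      (DfEq_coord f (f y) hp hf (VField.res hW η)))).trans
      (Rep.pair_of_isotropic hf (fun i j => hD.2 _ _ _ _) rfl rfl _ _)

end InverseImage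

end InducedMap

/-! ### Curvature of a connection as a closed 3-form. -/

section Curvature

variable {𝕜 K : Type} [RCLike 𝕜] [RCLike K] [NormedAlgebra 𝕜 K] {n : WithTop ℕ∞}
  [Fact (n = ∞ ∨ n = ω)]

open Mfd PMod

theorem Mfd.eq_zero_of_eq_neg {X : Mfd.{u, v} 𝕜 K n} {U : Opens X} {φ : X.O U} (h : φ = -φ) :
    φ = 0 :=
  X.O_ext fun x => self_eq_neg.1 (O_congr h x)

namespace CourantStr

variable {X : Mfd.{u, v} 𝕜 K n} {M : SMod.{u, v, w} X} {Q : CourantStr M} {U V : Opens X}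

theorem coanchor_bracket (Q : CourantStr M) (κ : Form X 1 U) (q : M.Sec U) :
    Q.bracket U (Q.coanchor U κ) q = -Q.coanchor U (Form.iotaD (Q.anchor U q) κ) := by
  rw [Q.bracket_swap, Q.bracket_coanchor, Q.pairing_symm, Q.pairing_coanchor, Form.iotaD, map_sub]
  abel

theorem coanchor_pairing (Q : CourantStr M) (κ : Form X 1 U) (q : M.Sec U) :
    Q.pairing U (Q.coanchor U κ) q = κ.ap (Q.anchor U q) := by
  rw [Q.pairing_symm, Q.pairing_coanchor]

section isotropic

variable {a b c : M.Sec U}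

theorem pairing_bracket_swap_right (h : Q.pairing U b c = 0) :
    Q.pairing U (Q.bracket U a b) c = -Q.pairing U (Q.bracket U a c) b := by
  have := Q.pairing_bracket a b c
  rw [h, map_zero, Q.pairing_symm b] at this
  exact eq_neg_of_add_eq_zero_left this

theorem pairing_bracket_swap_left (h : Q.pairing U a b = 0) :
    Q.pairing U (Q.bracket U a b) c = -Q.pairing U (Q.bracket U b a) c := by
  have := Q.bracket_symm a b
  rw [h, Form.d_zero, map_zero] at this
  rw [eq_neg_of_add_eq_zero_left this, map_neg, LinearMap.neg_apply]

end isotropic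

/-- The trilinear expression `⟨[Dξ, Dη], Dζ⟩`. -/
def cubic (Q : CourantStr M) (D : TMap M U) (hV : V ≤ U) (ξ η ζ : VField X V) : X.O V :=
  Q.pairing V (Q.bracket V (D.toFun V hV ξ) (D.toFun V hV η)) (D.toFun V hV ζ)

namespace IsConnection

variable {D : TMap M U}

theorem cubic_swap_right (hD : Q.IsConnection D) (hV : V ≤ U) (ξ η ζ : VField X V) :
    Q.cubic D hV ξ η ζ = -Q.cubic D hV ξ ζ η :=
  pairing_bracket_swap_right (hD.2 V hV η ζ)

theorem cubic_swap_left (hD : Q.IsConnection D) (hV : V ≤ U) (ξ η ζ : VField X V) :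
    Q.cubic D hV ξ η ζ = -Q.cubic D hV η ξ ζ :=
  pairing_bracket_swap_left (hD.2 V hV ξ η)

/-- Carries the evident linearity in the last slot to the other two, where the bracket by itself is
not tensorial. -/
theorem cubic_rotate (hD : Q.IsConnection D) (hV : V ≤ U) (ξ η ζ : VField X V) :
    Q.cubic D hV ξ η ζ = Q.cubic D hV ζ ξ η := by
  rw [hD.cubic_swap_right, hD.cubic_swap_left, neg_neg]

theorem cubic_add (Q : CourantStr M) (D : TMap M U) (hV : V ≤ U) (ξ η ζ ζ' : VField X V) :
    Q.cubic D hV ξ η (ζ + ζ') = Q.cubic D hV ξ η ζ + Q.cubic D hV ξ η ζ' := by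
  rw [cubic, map_add, map_add]
  rfl

theorem cubic_smul (Q : CourantStr M) (D : TMap M U) (hV : V ≤ U) (φ : X.O V)
    (ξ η ζ : VField X V) : Q.cubic D hV ξ η (φ • ζ) = φ * Q.cubic D hV ξ η ζ := by
  rw [cubic, map_smul, map_smul]
  rfl

theorem cubic_self_left (hD : Q.IsConnection D) (hV : V ≤ U) (ξ ζ : VField X V) :
    Q.cubic D hV ξ ξ ζ = 0 := eq_zero_of_eq_neg (hD.cubic_swap_left hV ξ ξ ζ)

theorem cubic_self_right (hD : Q.IsConnection D) (hV : V ≤ U) (ξ ζ : VField X V) :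
    Q.cubic D hV ξ ζ ζ = 0 := eq_zero_of_eq_neg (hD.cubic_swap_right hV ξ ζ ζ)

theorem res_cubic (Q : CourantStr M) (D : TMap M U) (hV : V ≤ U) {W : Opens X} (hW : W ≤ V)
    (ξ η ζ : VField X V) : Q.cubic D (hW.trans hV) (VField.res hW ξ) (VField.res hW η)
      (VField.res hW ζ) = X.resO hW (Q.cubic D hV ξ η ζ) := by
  rw [cubic, cubic, D.natural V W hV hW, D.natural V W hV hW, D.natural V W hV hW, Q.res_pairing,
    Q.res_bracket]

theorem fin_three_cases : ∀ i : Fin 3, i = 0 ∨ i = 1 ∨ i = 2 := by decide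

theorem fin_three_ne : (1 : Fin 3) ≠ 0 ∧ (2 : Fin 3) ≠ 0 ∧ (2 : Fin 3) ≠ 1 := by decide

/-- The curvature of a connection, as a `3`-form. -/
def curvature (hD : Q.IsConnection D) : Form X 3 U where
  toFun V hV :=
    { toFun := fun ξ => Q.cubic D hV (ξ 0) (ξ 1) (ξ 2)
      map_update_add' := fun m i x y => by
        obtain rfl | rfl | rfl := fin_three_cases i
        · simp only [Function.update_self, Function.update_of_ne fin_three_ne.1,
            Function.update_of_ne fin_three_ne.2.1,
            hD.cubic_rotate hV _ (m 1) (m 2), hD.cubic_rotate hV (m 2), cubic_add]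
        · simp only [Function.update_self, Function.update_of_ne fin_three_ne.1.symm,
            Function.update_of_ne fin_three_ne.2.2, hD.cubic_rotate hV (m 0),
            cubic_add]
        · simp only [Function.update_self, Function.update_of_ne fin_three_ne.2.1.symm,
            Function.update_of_ne fin_three_ne.2.2.symm, cubic_add]
      map_update_smul' := fun m i c x => by
        obtain rfl | rfl | rfl := fin_three_cases i
        · simp only [Function.update_self, Function.update_of_ne fin_three_ne.1,
            Function.update_of_ne fin_three_ne.2.1,
            hD.cubic_rotate hV _ (m 1) (m 2), hD.cubic_rotate hV (m 2), cubic_smul, smul_eq_mul]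
        · simp only [Function.update_self, Function.update_of_ne fin_three_ne.1.symm,
            Function.update_of_ne fin_three_ne.2.2, hD.cubic_rotate hV (m 0),
            cubic_smul, smul_eq_mul]
        · simp only [Function.update_self, Function.update_of_ne fin_three_ne.2.1.symm,
            Function.update_of_ne fin_three_ne.2.2.symm, cubic_smul, smul_eq_mul]
      map_eq_zero_of_eq' := fun m i j h hij => by
        obtain rfl | rfl | rfl := fin_three_cases i <;>
          obtain rfl | rfl | rfl := fin_three_cases j
        · exact absurd rfl hij
        · rw [h, hD.cubic_self_left]
        · rw [h, hD.cubic_rotate, hD.cubic_self_left]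
        · rw [h, hD.cubic_self_left]
        · exact absurd rfl hij
        · rw [h, hD.cubic_self_right]
        · rw [h, hD.cubic_rotate, hD.cubic_self_left]
        · rw [h, hD.cubic_self_right]
        · exact absurd rfl hij }
  natural V W hV hW ξ := res_cubic Q D hV hW _ _ _

theorem contract_curvature_ap (hD : Q.IsConnection D) (hV : V ≤ U) (ξ η ζ : VField X V) :
    ((Form.res hV hD.curvature).contract ξ η).ap ζ = Q.cubic D hV ξ η ζ :=
  (Form.contract_apply (Form.res hV hD.curvature) ξ η le_rfl ζ)

/-- [Dξ,Dη] - D[ξ,η] lies in the kernel of the anchor, so it is locally π†γ. Pairing with Dζ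
recovers γ(ζ), and isotropy removes the term D[ξ,η]. -/
theorem isCurvature_curvature (hD : Q.IsConnection D) (hQ : Q.IsExact) :
    Q.IsCurvature D hD.curvature := by
  refine fun V hV ξ η => M.locality _ _ fun x hx => ?_
  have h0 : Q.anchor V (Q.bracket V (D.toFun V hV ξ) (D.toFun V hV η) - D.toFun V hV ⁅ξ, η⁆) =
      0 := by
    rw [map_sub, Q.anchor_bracket, hD.1, hD.1, hD.1, sub_self]
  obtain ⟨W, hW, γ, hxW, hγ⟩ := hQ.2.1 V _ h0 x hx
  refine ⟨W, hW, hxW, ?_⟩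
  rw [Q.res_coanchor]
  refine hγ.trans (congrArg _ (Form.ext_ap fun W' hW' ζ => ?_))
  have h1 : (Form.res hW' γ).ap ζ = Q.pairing W' (D.toFun W' (hW'.trans (hW.trans hV)) ζ)
      (Q.coanchor W' (Form.res hW' γ)) := by rw [Q.pairing_coanchor, hD.1]
  rw [h1, ← Q.res_coanchor, ← hγ, Q.pairing_symm]
  have h2 : (Form.res hW' (Form.res hW ((Form.res hV hD.curvature).contract ξ η))).ap ζ =
      Q.cubic D (hW'.trans (hW.trans hV)) (VField.res (hW'.trans hW) ξ)
        (VField.res (hW'.trans hW) η) ζ :=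
    Form.contract_apply (Form.res hV hD.curvature) ξ η (hW'.trans hW) ζ
  rw [h2, M.res_res, map_sub, Q.res_bracket, ← D.natural V W' hV (hW'.trans hW),
    ← D.natural V W' hV (hW'.trans hW), ← D.natural V W' hV (hW'.trans hW), map_sub,
    LinearMap.sub_apply, hD.2, sub_zero]
  rfl

end IsConnection

theorem IsCurvature.unique (hQ : Q.IsExact) {D : TMap M U} {G H : Form X 3 U}
    (hG : Q.IsCurvature D G) (hH : Q.IsCurvature D H) : G = H := by
  refine Form.ext fun V hV ξ => ?_
  have h1 := hQ.1 V ((hG V hV (ξ 0) (ξ 1)).symm.trans (hH V hV (ξ 0) (ξ 1)))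
  have h2 : ∀ F : Form X 3 U, F.toFun V hV ξ =
      ((Form.res hV F).contract (ξ 0) (ξ 1)).ap (ξ 2) := fun F => by
    refine Eq.trans ?_ (Form.contract_apply (Form.res hV F) (ξ 0) (ξ 1) le_rfl (ξ 2)).symm
    refine congrArg (F.toFun V hV) (funext fun a => ?_)
    fin_cases a <;> rfl
  rw [h2, h2, h1]

namespace IsConnection

variable {D : TMap M U}

theorem bracket_eq (hD : Q.IsConnection D) (hQ : Q.IsExact) (hV : V ≤ U) (ξ η : VField X V) :
    Q.bracket V (D.toFun V hV ξ) (D.toFun V hV η) = D.toFun V hV ⁅ξ, η⁆ +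
      Q.coanchor V ((Form.res hV hD.curvature).contract ξ η) := by
  rw [← hD.isCurvature_curvature hQ V hV, add_sub_cancel]

/-- Write [Dξ,Dη] = D[ξ,η] + π†κ with κ the contracted curvature. Then [π†κ,Dζ] = -π†(ι_ζ dκ)
produces the derivatives. -/
theorem pairing_bracket_bracket_left (hD : Q.IsConnection D) (hQ : Q.IsExact) (hV : V ≤ U)
    (ξ η ζ θ : VField X V) :
    Q.pairing V (Q.bracket V (Q.bracket V (D.toFun V hV ξ) (D.toFun V hV η)) (D.toFun V hV ζ))
      (D.toFun V hV θ) = Q.cubic D hV ⁅ξ, η⁆ ζ θ - ζ.act (Q.cubic D hV ξ η θ) +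
        θ.act (Q.cubic D hV ξ η ζ) + Q.cubic D hV ξ η ⁅ζ, θ⁆ := by
  rw [hD.bracket_eq hQ, Q.add_bracket, Q.coanchor_bracket, map_add, LinearMap.add_apply, map_neg,
    LinearMap.neg_apply, Q.pairing_symm (Q.coanchor V _), Q.pairing_coanchor, hD.1, hD.1,
    Form.iotaD_ap, hD.contract_curvature_ap, hD.contract_curvature_ap, hD.contract_curvature_ap]
  change Q.cubic D hV ⁅ξ, η⁆ ζ θ + -_ = _
  ring

/-- With each bracket split into its D part and its π† part, only the mixed pairings survive: D is
isotropic, and so is the image of π†. -/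
theorem pairing_bracket_bracket (hD : Q.IsConnection D) (hQ : Q.IsExact) (hV : V ≤ U)
    (ξ η ζ θ : VField X V) :
    Q.pairing V (Q.bracket V (D.toFun V hV ξ) (D.toFun V hV η))
      (Q.bracket V (D.toFun V hV ζ) (D.toFun V hV θ)) =
        Q.cubic D hV ζ θ ⁅ξ, η⁆ + Q.cubic D hV ξ η ⁅ζ, θ⁆ := by
  simp only [hD.bracket_eq hQ, map_add, LinearMap.add_apply, hD.2, Q.pairing_coanchor,
    Q.coanchor_pairing, Q.anchor_coanchor, Form.ap_zero, hD.1, zero_add,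
    add_zero]
  rw [hD.contract_curvature_ap, hD.contract_curvature_ap, add_comm]

theorem act_cubic (hD : Q.IsConnection D) (hV : V ≤ U) (ξ η ζ θ : VField X V) :
    ξ.act (Q.cubic D hV η ζ θ) =
      Q.pairing V (Q.bracket V (D.toFun V hV ξ) (Q.bracket V (D.toFun V hV η) (D.toFun V hV ζ)))
        (D.toFun V hV θ) +
      Q.pairing V (Q.bracket V (D.toFun V hV η) (D.toFun V hV ζ))
        (Q.bracket V (D.toFun V hV ξ) (D.toFun V hV θ)) := by
  rw [Q.pairing_bracket, hD.1, cubic]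

/-- The Koszul formula is the Leibniz identity for Dξ₀, Dξ₁, Dξ₂ paired with Dξ₃. Invariance of the
pairing produces the derivatives along ξ₀ and ξ₁, and `pairing_bracket_bracket_left` those along ξ₂
and ξ₃. -/
theorem isClosed_curvature (hD : Q.IsConnection D) (hQ : Q.IsExact) : hD.curvature.IsClosed := by
  intro V hV ξ
  change (ξ 0).act (Q.cubic D hV (ξ 1) (ξ 2) (ξ 3)) - (ξ 1).act (Q.cubic D hV (ξ 0) (ξ 2) (ξ 3))
      + (ξ 2).act (Q.cubic D hV (ξ 0) (ξ 1) (ξ 3)) - (ξ 3).act (Q.cubic D hV (ξ 0) (ξ 1) (ξ 2))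
      - Q.cubic D hV ⁅ξ 0, ξ 1⁆ (ξ 2) (ξ 3) + Q.cubic D hV ⁅ξ 0, ξ 2⁆ (ξ 1) (ξ 3)
      - Q.cubic D hV ⁅ξ 0, ξ 3⁆ (ξ 1) (ξ 2) - Q.cubic D hV ⁅ξ 1, ξ 2⁆ (ξ 0) (ξ 3)
      + Q.cubic D hV ⁅ξ 1, ξ 3⁆ (ξ 0) (ξ 2) - Q.cubic D hV ⁅ξ 2, ξ 3⁆ (ξ 0) (ξ 1) = 0
  have h1 := hD.act_cubic hV (ξ 0) (ξ 1) (ξ 2) (ξ 3)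
  have h2 := hD.act_cubic hV (ξ 1) (ξ 0) (ξ 2) (ξ 3)
  have h3 := hD.pairing_bracket_bracket_left hQ hV (ξ 0) (ξ 1) (ξ 2) (ξ 3)
  -- After this the unevaluated term ⟨[Dξ₁,[Dξ₀,Dξ₂]],Dξ₃⟩ occurs in both `h1` and `h2`, and cancels
  -- in the difference.
  rw [Q.jacobi, map_add, LinearMap.add_apply, h3, hD.pairing_bracket_bracket hQ] at h1
  rw [hD.pairing_bracket_bracket hQ] at h2
  rw [h1, h2, hD.cubic_rotate hV _ _ ⁅ξ 0, ξ 2⁆, hD.cubic_rotate hV _ _ ⁅ξ 0, ξ 3⁆,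
    hD.cubic_rotate hV _ _ ⁅ξ 1, ξ 2⁆, hD.cubic_rotate hV _ _ ⁅ξ 1, ξ 3⁆,
    hD.cubic_rotate hV _ _ ⁅ξ 2, ξ 3⁆]
  ring

end IsConnection

end CourantStr

/-! ### The curvature of the induced connection is the pull-back. -/

namespace InverseImage

variable {Y : Mfd.{w₁, w₂} 𝕜 K n} {X : Mfd.{u, v} 𝕜 K n} {f : Y.Hom X}
  {M : SMod.{u, v, w} X} {Q : CourantStr M} {U : Opens X} {D : TMap M U}

theorem sum_fin_three {A : Type*} [AddCommMonoid A] {m : ℕ} (F : Fin m → Fin m → Fin m → A) :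
    ∑ I : Fin 3 → Fin m, F (I 0) (I 1) (I 2) = ∑ i, ∑ j, ∑ l, F i j l := by
  have e : ∑ I : Fin 3 → Fin m, F (I 0) (I 1) (I 2) =
      ∑ p : Fin m × Fin m × Fin m, F p.1 p.2.1 p.2.2 :=
    Fintype.sum_equiv ⟨fun I => (I 0, I 1, I 2), fun p => ![p.1, p.2.1, p.2.2],
      fun I => funext fun a => by fin_cases a <;> rfl, fun p => rfl⟩ _ _ fun I => rfl
  rw [e, Fintype.sum_prod_type]
  exact Finset.sum_congr rfl fun i _ => Fintype.sum_prod_type _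

/-- Evaluate ⟨[D'ξ₀,D'ξ₁],D'ξ₂⟩ by the formulas for triples (0, ∑ h⊗Dv, ξ). Exactness of Q is not
involved: the statement concerns only the trilinear forms. -/
theorem isPullback_curvature (hD : Q.IsConnection D) :
    IsPullback f hD.curvature (isConnection_inducedMap (f := f) hD).curvature := by
  intro W hW U' hU hf m ξ h v H
  have h3 : ∀ a, (⟨0, Fin m, h a, fun i => D.toFun U' hU (v a i)⟩ : Rep M W U').Represents hf
      (ξ a) (Fam.res f Q le_rfl (inducedSec hD.1 hW (ξ a)).1) := fun a =>
    inducedSec_rep hD.1 hW (ξ a) le_rfl hU hf (H a)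
  have h4 := secPairing_rep (secBracket_rep (h3 0) (h3 1)) (h3 2)
  refine Eq.trans h4 ?_
  rw [Rep.pair_bracket_eq, Form.zero_ap, Form.iotaD_ap, Form.lie_ap]
  -- Every term containing a pairing ⟨Dv,Dw⟩ or a form part vanishes, which leaves only the triple
  -- sum.
  simp only [hD.2, map_zero, mul_zero, zero_mul, Finset.sum_const_zero, Form.zero_ap, sub_zero,
    add_zero]
  rw [← sum_fin_three (fun i j l => h 0 i * h 1 j * h 2 l * pull f hf
    (Q.pairing U' (Q.bracket U' (D.toFun U' hU (v 0 i)) (D.toFun U' hU (v 1 j)))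
      (D.toFun U' hU (v 2 l))))]
  refine Finset.sum_congr rfl fun I _ => ?_
  rw [Fin.prod_univ_three]
  rfl

theorem IsPullback.unique {k : ℕ} {H : Form X k U} {G G' : Form Y k (pre f U)}
    (h : IsPullback f H G) (h' : IsPullback f H G') : G' = G :=
  Form.ext fun V hV ξ => O_locality fun y hy => by
    obtain ⟨W, U', hW, hU, hp, hyW, hf, hyU⟩ := exists_chart_nhd f hy (hV hy)
    refine ⟨W, hW, hyW, ?_⟩
    rw [← G.natural V W hV hW, ← G'.natural V W hV hW]
    exact (h' W (hW.trans hV) U' hU hf _ _ _ _ fun a => DfEq_coord f (f y) hp hf _).trans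
      (h W (hW.trans hV) U' hU hf _ _ _ _ fun a => DfEq_coord f (f y) hp hf _).symm

end InverseImage

end Curvature

/-! ### Assembly of the main theorem. -/

theorem mainTheorem11 {𝕜 K : Type} [RCLike 𝕜] [RCLike K] [NormedAlgebra 𝕜 K] {n : WithTop ℕ∞}
    [Fact (n = ∞ ∨ n = ω)] {Y : Mfd.{w₁, w₂} 𝕜 K n} {X : Mfd.{u, v} 𝕜 K n} (f : Y.Hom X)
    {M : SMod.{u, v, w} X} (Q : CourantStr M) :
    -- the inverse image `f^{++}Q` is a well-defined Courant algebroid `P`, exact if `Q` is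
    ∃ P : CourantStr (inverseImage f Q),
      InverseImage.IsInverseImage f Q P ∧
      (∀ P', InverseImage.IsInverseImage f Q P' → P' = P) ∧
      (Q.IsExact → P.IsExact) ∧
      -- a connection `D` on `Q` over `U` induces a well-defined connection `D'` on `f^{++}Q`
      ∀ (U : Opens X) (D : TMap M U), Q.IsConnection D →
        ∃ D' : TMap (inverseImage f Q) (InverseImage.pre f U),
          InverseImage.IsInducedMap f Q D D' ∧
          (∀ D'', InverseImage.IsInducedMap f Q D D'' → D'' = D') ∧
          P.IsConnection D' ∧
          -- for exact `Q`, the curvature of `D'` is the pull-back of the curvature of `D`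
          (Q.IsExact →
            ∃ H : Form X 3 U,
              Q.IsCurvature D H ∧ (∀ G, Q.IsCurvature D G → G = H) ∧ H.IsClosed ∧
              ∃ H' : Form Y 3 (InverseImage.pre f U),
                InverseImage.IsPullback f H H' ∧
                (∀ G, InverseImage.IsPullback f H G → G = H') ∧
                P.IsCurvature D' H' ∧ (∀ G, P.IsCurvature D' G → G = H') ∧ H'.IsClosed) := by
  refine ⟨InverseImage.courantStr f Q, InverseImage.isInverseImage_courantStr f Q,
    fun P' h => (InverseImage.isInverseImage_courantStr f Q).unique h,
    InverseImage.isExact_courantStr, fun U D hD => ?_⟩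
  refine ⟨InverseImage.inducedMap hD.1, InverseImage.isInducedMap_inducedMap hD.1,
    fun D'' h => (InverseImage.isInducedMap_inducedMap hD.1).unique h,
    InverseImage.isConnection_inducedMap hD, fun hQ => ?_⟩
  have hD' := InverseImage.isConnection_inducedMap (f := f) hD
  have hP := InverseImage.isExact_courantStr (f := f) hQ
  have hc := hD.isCurvature_curvature hQ
  have hc' := hD'.isCurvature_curvature hP
  exact ⟨hD.curvature, hc, fun G hG => CourantStr.IsCurvature.unique hQ hG hc,
    hD.isClosed_curvature hQ, hD'.curvature, InverseImage.isPullback_curvature hD,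
    fun G hG => InverseImage.IsPullback.unique (InverseImage.isPullback_curvature hD) hG, hc',
    fun G hG => CourantStr.IsCurvature.unique hP hG hc', hD'.isClosed_curvature hP⟩
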